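/- \textbf{Setting.} Let $X=(X_1,\dots,X_d)$ be a random vector in $\mathbb{R}^d$ with finite second moments and $Y$ a real random variable on the same probability space with $\mathbb{E}[Y^2]<\infty$ and $\mathbb{E}[Y]=0$. For $S\subset\{1,\dots,d\}$ write $X_S=(X_j)_{j\in S}$; equality of conditional expectations means almost sure equality. For $\beta\in\mathbb{R}^d$ let $\operatorname{supp}(\beta)=\{j:\beta_j\neq 0\}$ and $\beta\circ x=(\beta_jx_j)_j$. Let $\mu$ be a probability measure on $\mathbb{R}$ whose support is compact and contained in $(0,\infty)$, put $\psi(z)=\int e^{-tz}\,\mu(dt)$, $$q_t(\omega)=\prod_{j=1}^d\frac{2t}{4\pi^2\omega_j^2+t^2},\qquad k(\omega)=\int q_t(\omega)\,\mu(dt),$$ and let $H$ be the reproducing kernel Hilbert space of the $\ell_1$-type kernel $K(x,x')=\psi(\|x-x'\|_1)$, i.e. the space of real-valued $f\in C(\mathbb{R}^d)\cap L_2(\mathbb{R}^d)$ with $\|f\|_H^2=\int_{\mathbb{R}^d}|\hat f(\omega)|^2/k(\omega)\,d\omega<\infty$, where $\hat f(\omega)=\int f(x)e^{-2\pi i\langle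 x,\omega\rangle}dx$ (in the $L_2$ sense). For $\lambda>0$ define $$\mathcal{J}(\beta,\lambda)=\min_{f\in H}\Big\{\mathbb{E}\big[(Y-f(\beta\circ X))^2\big]+\lambda\|f\|_H^2\Big\},\qquad \mathrm{D}\mathcal{J}(\beta,\lambda)[v]=\lim_{s\to0^+}\frac{\mathcal{J}(\beta+sv,\lambda)-\mathcal{J}(\beta,\lambda)}{s}.$$ A point $\beta$ is a directional stationary point of $\mathcal{J}(\cdot,\lambda)$ if $\mathrm{D}\mathcal{J}(\beta,\lambda)[v]$ exists and is $\ge 0$ for all $v\in\mathbb{R}^d$. Put $$\mathcal{M}_i(\beta)=\iiint\Big|\mathbb{E}\big[(Y-\mathbb{E}[Y|X_{\operatorname{supp}(\beta)}])\,e^{-2\pi \mathbf{i}\langle\omega,\beta\circ X\rangle}e^{-2\pi \mathbf{i}\zeta X_i}\big]\Big|^2\frac{d\zeta}{2\pi^2\zeta^2}\;t\,q_t(\omega)\,d\omega\,\mu(dt),$$ where $\mathbf{i}$ denotes the imaginary unit. \textbf{Assumptions.} Let $S_*$ be the intersection of all $S\subset\{1,\dots,d\}$ with $\mathbb{E}[Y|X]=\mathbb{E}[Y|X_S]$,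 and assume that $\mathbb{E}[Y|X]=\mathbb{E}[Y|X_{S_*}]$ (so $S_*$ is the core sufficient feature set), that $X_{S_*}$ and $X_{S_*^c}$ are independent, and that the variables $(X_j)_{j\in S_*}$ are mutually independent. Let $i\in S\subset S_*$ with $\mathbb{E}[Y|X_{S\setminus\{i\}}]\neq\mathbb{E}[Y|X_S]$. \textbf{Theorem.} (a) Let $\mathsf{C}\subset\{\beta\in\mathbb{R}^d:\beta_i=0\text{ and }\beta_j>0\text{ for all }j\in S\setminus\{i\}\}$ be compact. Then $\mathcal{M}_i$ is finite on $\mathsf{C}$ and $$\inf_{\beta\in\mathsf{C}}\mathcal{M}_i(\beta)>0$$ (with $\inf\emptyset=+\infty$). Moreover there are constants $\varepsilon>0$ and $\lambda_0>0$ such that for all $\lambda\in(0,\lambda_0)$ and all $\beta\in\mathsf{C}$ the directional derivative $\mathrm{D}\mathcal{J}(\beta,\lambda)[e_i]$ exists and satisfies $$\lambda\cdot\mathrm{D}\mathcal{J}(\beta,\lambda)[e_i]\le-\varepsilon.$$ (b) Let $\mathsf{C}\subset\mathbb{R}^d$ be compact with $\beta_j>0$ for all $j\in S\setminus\{i\}$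 and all $\beta\in\mathsf{C}$. Then there is $\lambda_0>0$ such that for all $\lambda\in(0,\lambda_0)$ every directional stationary point $\beta_\dagger$ of $\mathcal{J}(\cdot,\lambda)$ satisfies $i\in\operatorname{supp}(\beta_\dagger)$ or $\beta_\dagger\notin\mathsf{C}$. -/

import Mathlib

open MeasureTheory ProbabilityTheory Filter Topology
open scoped ENNReal FourierTransform

noncomputable section

namespace CompKernel

/-- The Euclidean space `ℝ^d`. -/
abbrev E (d : ℕ) := EuclideanSpace ℝ (Fin d)

/-- The Hadamard product `β ∘ x`, with coordinates `β_j x_j`. -/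
def hadamard {d : ℕ} (β x : E d) : E d := WithLp.toLp 2 (fun j => β j * x j)

/-- The support `{j : β_j ≠ 0}` of a vector. -/
def supp {d : ℕ} (β : E d) : Set (Fin d) := {j | β j ≠ 0}

/-! ### Translation-invariant reproducing kernel Hilbert spaces -/

/-- The translation-invariant RKHS with spectral density `k`: the real-valued functions
`f ∈ C(ℝ^d) ∩ L₂(ℝ^d)` with `∫ |f̂(ω)|² / k(ω) dω < ∞`. Here `f̂` is the `L₂` Fourier transform,
normalized as `f̂(ω) = ∫ f(x) e^{-2πi⟨x, ω⟩} dx`. -/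
structure RKHS {d : ℕ} (k : E d → ℝ) where
  toFun : E d → ℝ
  continuous_toFun : Continuous toFun
  memLp_toFun : MemLp (fun x => (toFun x : ℂ)) 2 (volume : Measure (E d))
  energy_lt_top :
    ∫⁻ ω, ‖(𝓕 (memLp_toFun.toLp (fun x => (toFun x : ℂ))) : Lp ℂ 2 (volume : Measure (E d))) ω‖ₑ ^ 2
      / ENNReal.ofReal (k ω) < ⊤

/-- The squared norm `‖f‖_H² = ∫ |f̂(ω)|² / k(ω) dω`. -/
def RKHS.normSq {d : ℕ} {k : E d → ℝ} (f : RKHS k) : ℝ :=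
  (∫⁻ ω, ‖(𝓕 (f.memLp_toFun.toLp (fun x => (f.toFun x : ℂ))) :
      Lp ℂ 2 (volume : Measure (E d))) ω‖ₑ ^ 2 / ENNReal.ofReal (k ω)).toReal

/-- The zero function belongs to `H`; in particular `H` is nonempty. -/
instance {d : ℕ} (k : E d → ℝ) : Inhabited (RKHS k) where
  default :=
    { toFun := fun _ => 0
      continuous_toFun := continuous_const
      memLp_toFun := by simp
      energy_lt_top := by
        have h0 : ∀ h : MemLp (fun _ : E d => ((0 : ℝ) : ℂ)) 2 volume,
            (𝓕 (h.toLp (fun _ : E d => ((0 : ℝ) : ℂ))) : Lp ℂ 2 (volume : Measure (E d))) = 0 := by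
          intro h
          rw [← norm_eq_zero, Lp.norm_fourier_eq, norm_eq_zero]
          rw [Lp.eq_zero_iff_ae_eq_zero]
          filter_upwards [h.coeFn_toLp] with x hx
          simpa using hx
        rw [lintegral_congr_ae (g := fun _ => 0)]
        · simp
        · rw [h0]
          filter_upwards [Lp.coeFn_zero ℂ 2 (volume : Measure (E d))] with x hx
          rw [hx]
          simp }

/-- `q_t(ω) = ∏_j 2t / (4π² ω_j² + t²)`, the Fourier transform of `x ↦ e^{-t‖x‖₁}`. -/
def qDensity {d : ℕ} (t : ℝ) (ω : E d) : ℝ :=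
  ∏ j, 2 * t / (4 * Real.pi ^ 2 * (ω j) ^ 2 + t ^ 2)

/-- The spectral density `k(ω) = ∫ q_t(ω) μ(dt)` of the `ℓ₁`-type kernel
`K(x, x') = ψ(‖x - x'‖₁)`, `ψ(z) = ∫ e^{-tz} μ(dt)`. -/
def ell1Density {d : ℕ} (μ : Measure ℝ) (ω : E d) : ℝ := ∫ t, qDensity t ω ∂μ

/-! ### The objective -/

section Objective

variable {d : ℕ} {Ω : Type*} [MeasurableSpace Ω]

/-- `I(f, β, lam) = E[(Y - f(β ∘ X))²] + lam ‖f‖_H²`. -/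
def ridgeLoss (P : Measure Ω) (X : Ω → E d) (Y : Ω → ℝ) {k : E d → ℝ}
    (f : RKHS k) (β : E d) (lam : ℝ) : ℝ :=
  (∫ w, (Y w - f.toFun (hadamard β (X w))) ^ 2 ∂P) + lam * f.normSq

/-- `J(β, lam) = min_{f ∈ H} I(f, β, lam)`, for the RKHS of the `ℓ₁`-type kernel of `μ`. -/
def objective (P : Measure Ω) (X : Ω → E d) (Y : Ω → ℝ) (μ : Measure ℝ)
    (β : E d) (lam : ℝ) : ℝ :=
  ⨅ f : RKHS (ell1Density (d := d) μ), ridgeLoss P X Y f β lam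

end Objective

/-- `D` is the (one-sided) directional derivative of `F` at `β` in direction `v`: the limit
`lim_{s → 0+} (F(β + s v) - F(β)) / s` exists and equals `D`. -/
def HasDirDeriv {d : ℕ} (F : E d → ℝ) (β v : E d) (D : ℝ) : Prop :=
  Tendsto (fun s : ℝ => (F (β + s • v) - F β) / s) (𝓝[>] 0) (𝓝 D)

/-- `β` is a directional stationary point of `F`: all directional derivatives at `β` exist and are
nonnegative. -/
def IsDirStationary {d : ℕ} (F : E d → ℝ) (β : E d) : Prop :=
  ∀ v : E d, ∃ D : ℝ, HasDirDeriv F β v D ∧ 0 ≤ D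

/-! ### Feature sets -/

section Features

variable {d : ℕ} {Ω : Type*} [MeasurableSpace Ω]

/-- The subvector `X_S = (X_j)_{j ∈ S}`. -/
def subvec (X : Ω → E d) (S : Set (Fin d)) : Ω → (S → ℝ) := fun w j => X w j

/-- The conditional expectation `E[Y | X_S]`. -/
def condOn (P : Measure Ω) (X : Ω → E d) (Y : Ω → ℝ) (S : Set (Fin d)) : Ω → ℝ :=
  P[Y | MeasurableSpace.comap (subvec X S) inferInstance]

/-- `S` is sufficient: `E[Y | X] = E[Y | X_S]` almost surely. -/
def IsSufficient (P : Measure Ω) (X : Ω → E d) (Y : Ω → ℝ) (S : Set (Fin d)) : Prop :=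
  P[Y | MeasurableSpace.comap X inferInstance] =ᵐ[P] condOn P X Y S

/-- `T` is the core sufficient feature set: it is the intersection of all the sufficient sets,
and it is itself sufficient. -/
def IsCoreSufficient (P : Measure Ω) (X : Ω → E d) (Y : Ω → ℝ) (T : Set (Fin d)) : Prop :=
  T = ⋂₀ {S : Set (Fin d) | IsSufficient P X Y S} ∧ IsSufficient P X Y T

/-- The integral
`M_i(β) = ∭ |E[(Y - E[Y | X_{supp β}]) e^{-2πi⟨ω, β ∘ X⟩} e^{-2πi ζ X_i}]|² / (2π² ζ²) dζ
  · t q_t(ω) dω μ(dt)`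
of a nonnegative function, with values in `[0, ∞]`. -/
def mainTerm (P : Measure Ω) (X : Ω → E d) (Y : Ω → ℝ) (μ : Measure ℝ)
    (i : Fin d) (β : E d) : ℝ≥0∞ :=
  ∫⁻ t, (∫⁻ ω : E d,
    (∫⁻ ζ : ℝ,
      ‖∫ w, ((Y w - condOn P X Y (supp β) w : ℝ) : ℂ)
          * Complex.exp (((-2 * Real.pi * inner ℝ ω (hadamard β (X w)) : ℝ) : ℂ) * Complex.I)
          * Complex.exp (((-2 * Real.pi * ζ * X w i : ℝ) : ℂ) * Complex.I) ∂P‖ₑ ^ 2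
        * ENNReal.ofReal (1 / (2 * Real.pi ^ 2 * ζ ^ 2)))
      * ENNReal.ofReal (t * qDensity t ω)) ∂μ

end Features

end CompKernel

end

/-! The objective is a ridge regression, so it can be read off its residual. Let `T_β` be the
integral operator on `L²(P)` with kernel `ψ(‖β ∘ X - β ∘ X'‖₁)`, and let `r` solve `r + λ⁻¹ T_β r =
y`. Then `r` is the residual of the minimiser, and `J(β, λ) = ⟨y, r⟩` (`objective_eq_inner`). By the
envelope argument `tendsto_slope_inner_ridgeResidual`, only the kernel has to be differentiated. At
`β_i = 0` a move along `e_i` adds exactly `s |X_i - X_i'|` to the `ℓ₁` distance. Hence `λ · DJ[e_i]`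
is the quadratic form at `r` of the slope kernel `|X_i - X_i'| ∫ t e^{-t‖β ∘ X - β ∘ X'‖₁} μ(dt)`,
and this form must be bounded away from zero on the negative side.

The sign comes from the representation `|z| = ∫ (1 - cos 2πζz) dζ / (2π²ζ²)`. It writes `|x| + |y| -
|x - y|` as the Gram kernel of the features `e^{-2πiζx} - 1`. If `r` annihilates all characters of
`β ∘ X`, the terms in `|x|` and `|y|` drop out, and minus the slope form is a weighted energy of the
means `E[r e^{-2πi⟨ω, β ∘ X⟩} e^{-2πiζX_i}]` (`lintegral_enorm_meanFeature`). For the population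
residual `Y - E[Y | X_supp(β)]` this energy is `M_i(β)`.

The ridge residual annihilates these characters only approximately: its Gram form is at most
`λ‖y‖²`. Compactness bridges the gap. Square integrable kernels give weakly continuous quadratic
forms on balls of `L²(P)`, so the maximum of minus the slope form and the Gram form attains its
infimum over `β ∈ C` and `r` in a ball subject to a weakly closed constraint
(`exists_forall_le_max_kernelForm`). If this maximum is positive everywhere, it has a uniform lower
bound `ε`. For small `λ` the Gram form falls below `ε`, so the slope form must be at most `-ε`. The
same `ε` bounds `M_i` from below.

The constraint says that `y - r` is orthogonal to `1_{A ∩ B} - P(B) 1_A` for `A ∈ σ(X_{S \ i})` and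
`B ∈ σ(X_i)`. Both residuals satisfy it, because `y - r` is then a function of features other than
`i`, and these are jointly independent of `X_i`. For positivity (`exists_margin`), suppose both
forms are nonpositive. Then `r` annihilates every function of `X_S`, so the constraint transfers to
`Y` itself and yields `E[Y | X_S] = E[Y | X_{S \ i}]`, which is excluded. -/

namespace CompKernel

set_option linter.unusedSectionVars false

/-! ### Inverse Fourier transforms on `L¹ ∩ L²`. -/

section FourierAnalysis

variable {V : Type*} [NormedAddCommGroup V] [InnerProductSpace ℝ V] [FiniteDimensional ℝ V]
  [MeasurableSpace V] [BorelSpace V]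

theorem continuous_fourierInv_of_integrable {g : V → ℂ} (hg : Integrable g) :
    Continuous (𝓕⁻ g : V → ℂ) := by
  refine VectorFourier.fourierIntegral_continuous (e := Real.fourierChar) (L := -innerₗ V)
    Real.continuous_fourierChar ?_ hg
  exact (continuous_inner (𝕜 := ℝ) (E := V)).neg

/-- On `L¹ ∩ L²`, the inverse `L²` Fourier transform is given by the Fourier integral. -/
theorem coeFn_fourierInv_toLp {g : V → ℂ} (hg : Integrable g) (hg2 : MemLp g 2) :
    (𝓕⁻ (hg2.toLp g) : Lp ℂ 2 (volume : Measure V)) =ᵐ[volume] (𝓕⁻ g : V → ℂ) := by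
  -- Both sides are compared against smooth compactly supported test functions. The `L²` transform
  -- is moved onto the test function by duality of tempered distributions, the Fourier integral by
  -- Fubini.
  refine ae_eq_of_integral_contDiff_smul_eq ?_ ?_ ?_
  · exact (Lp.memLp _).locallyIntegrable (by norm_num)
  · exact (continuous_fourierInv_of_integrable hg).locallyIntegrable
  intro φ hφ hφc
  have hc : HasCompactSupport (fun x => (φ x : ℂ)) := hφc.comp_left (g := fun x : ℝ => (x : ℂ)) rfl
  set Φ := hc.toSchwartzMap (Complex.ofRealCLM.contDiff.comp hφ) with hΦ
  have hΦx : ∀ x, Φ x = φ x := fun x => rfl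
  have h := DFunLike.congr_fun (Lp.fourierInv_toTemperedDistribution_eq (hg2.toLp g)) Φ
  rw [TemperedDistribution.fourierInv_apply, Lp.toTemperedDistribution_apply,
    Lp.toTemperedDistribution_apply] at h
  have e1 : ∫ x, φ x • (𝓕⁻ (hg2.toLp g) : Lp ℂ 2 (volume : Measure V)) x
      = ∫ x, Φ x • (𝓕⁻ (hg2.toLp g) : Lp ℂ 2 (volume : Measure V)) x := by
    simp only [hΦx, Complex.coe_smul]
  have e2 : ∫ x, φ x • (𝓕⁻ g : V → ℂ) x = ∫ x, Φ x • (𝓕⁻ g : V → ℂ) x := by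
    simp only [hΦx, Complex.coe_smul]
  rw [e1, e2, ← h]
  have e3 : ∫ x, (𝓕⁻ Φ) x • (hg2.toLp g) x = ∫ x, (𝓕⁻ Φ) x • g x := by
    refine integral_congr_ae ?_
    filter_upwards [hg2.coeFn_toLp] with x hx
    rw [hx]
  rw [e3]
  have := VectorFourier.integral_fourierIntegral_smul_eq_flip (e := Real.fourierChar)
    (μ := (volume : Measure V)) (ν := (volume : Measure V)) (L := -innerₗ V) (f := Φ) (g := g)
    Real.continuous_fourierChar (continuous_inner (𝕜 := ℝ) (E := V)).neg
    Φ.integrable hg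
  have hflip : (-innerₗ V).flip = -innerₗ V := by
    ext x y; simp [real_inner_comm]
  rw [hflip] at this
  rw [SchwartzMap.fourierInv_coe]
  exact this

end FourierAnalysis

/-! ### The Laplace–Cauchy Fourier pair and the integral representation of `|z|`. -/

section Laplace

theorem integrable_exp_neg_mul_abs {t : ℝ} (ht : 0 < t) :
    Integrable (fun x : ℝ => Real.exp (-t * |x|)) := by
  rw [← integrableOn_univ, ← Set.Iic_union_Ioi (a := (0 : ℝ)), integrableOn_union]
  constructor
  · refine (integrableOn_exp_mul_Iic ht 0).congr_fun (fun x hx => ?_) measurableSet_Iic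
    simp [abs_of_nonpos (Set.mem_Iic.1 hx)]
  · refine (integrableOn_exp_mul_Ioi (neg_neg_of_pos ht) 0).congr_fun (fun x hx => ?_)
      measurableSet_Ioi
    simp [abs_of_pos (Set.mem_Ioi.1 hx)]

theorem fourier_exp_neg_mul_abs {t : ℝ} (ht : 0 < t) (ω : ℝ) :
    𝓕 (fun x : ℝ => (Real.exp (-t * |x|) : ℂ)) ω
      = ((2 * t / (4 * Real.pi ^ 2 * ω ^ 2 + t ^ 2) : ℝ) : ℂ) := by
  rw [Real.fourier_real_eq_integral_exp_smul]
  have hre1 : (-(t : ℂ) - 2 * Real.pi * ω * Complex.I).re < 0 := by simpa using ht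
  have hre2 : 0 < ((t : ℂ) - 2 * Real.pi * ω * Complex.I).re := by simpa using ht
  have hi : Integrable (fun v : ℝ => Complex.exp (((-2 * Real.pi * v * ω : ℝ) : ℂ) * Complex.I) •
      (Real.exp (-t * |v|) : ℂ)) := by
    refine ((integrable_exp_neg_mul_abs ht).ofReal (𝕜 := ℂ)).bdd_mul (c := 1)
      (Continuous.aestronglyMeasurable (by fun_prop)) ?_
    exact Eventually.of_forall fun w => (Complex.norm_exp_ofReal_mul_I _).le
  rw [← setIntegral_univ, ← Set.Iic_union_Ioi (a := (0 : ℝ)),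
    setIntegral_union (Set.Iic_disjoint_Ioi le_rfl) measurableSet_Ioi hi.integrableOn
      hi.integrableOn]
  have h1 : ∫ v in Set.Ioi (0 : ℝ), Complex.exp (((-2 * Real.pi * v * ω : ℝ) : ℂ) * Complex.I) •
      (Real.exp (-t * |v|) : ℂ) = 1 / (t + 2 * Real.pi * ω * Complex.I) := by
    rw [setIntegral_congr_fun (g := fun v : ℝ =>
      Complex.exp ((-(t : ℂ) - 2 * Real.pi * ω * Complex.I) * v)) measurableSet_Ioi,
      integral_exp_mul_complex_Ioi hre1]
    · simp only [Complex.ofReal_zero, mul_zero, Complex.exp_zero]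
      rw [neg_div, ← div_neg]
      congr 1
      ring
    · intro v hv
      simp only [smul_eq_mul, abs_of_pos (Set.mem_Ioi.1 hv), Complex.ofReal_exp]
      rw [← Complex.exp_add]
      push_cast
      ring_nf
  have h2 : ∫ v in Set.Iic (0 : ℝ), Complex.exp (((-2 * Real.pi * v * ω : ℝ) : ℂ) * Complex.I) •
      (Real.exp (-t * |v|) : ℂ) = 1 / (t - 2 * Real.pi * ω * Complex.I) := by
    rw [setIntegral_congr_fun (g := fun v : ℝ =>
      Complex.exp (((t : ℂ) - 2 * Real.pi * ω * Complex.I) * v)) measurableSet_Iic,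
      integral_exp_mul_complex_Iic hre2]
    · simp
    · intro v hv
      simp only [smul_eq_mul, abs_of_nonpos (Set.mem_Iic.1 hv), Complex.ofReal_exp]
      rw [← Complex.exp_add]
      push_cast
      ring_nf
  rw [h1, h2]
  have n1 : (t : ℂ) + 2 * Real.pi * ω * Complex.I ≠ 0 := by
    intro h
    have := congrArg Complex.re h
    simp at this
    exact ht.ne' this
  have n2 : (t : ℂ) - 2 * Real.pi * ω * Complex.I ≠ 0 := by
    intro h
    have := congrArg Complex.re h
    simp at this
    exact ht.ne' this
  have n3 : (4 * Real.pi ^ 2 * ω ^ 2 + t ^ 2 : ℂ)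
      = (t - 2 * Real.pi * ω * Complex.I) * (t + 2 * Real.pi * ω * Complex.I) := by
    ring_nf
    rw [Complex.I_sq]
    ring
  push_cast
  rw [n3, div_add_div _ _ n2 n1]
  congr 1
  ring

theorem integrable_cauchyDensity {t : ℝ} (ht : 0 < t) :
    Integrable (fun ω : ℝ => 2 * t / (4 * Real.pi ^ 2 * ω ^ 2 + t ^ 2)) := by
  have h := (integrable_inv_one_add_sq.comp_mul_left' (R := 2 * Real.pi / t)
    (by positivity)).const_mul (2 / t)
  refine h.congr (Eventually.of_forall fun ω => ?_)
  simp only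
  have : (1 + (2 * Real.pi / t * ω) ^ 2) ≠ 0 := by positivity
  have h2 : 4 * Real.pi ^ 2 * ω ^ 2 + t ^ 2 ≠ 0 := by positivity
  field_simp
  ring

theorem integral_cauchyDensity_mul_exp {t : ℝ} (ht : 0 < t) (x : ℝ) :
    ∫ ω : ℝ, ((2 * t / (4 * Real.pi ^ 2 * ω ^ 2 + t ^ 2) : ℝ) : ℂ)
      * Complex.exp (((2 * Real.pi * (ω * x) : ℝ) : ℂ) * Complex.I) = Real.exp (-t * |x|) := by
  have hF : 𝓕 (fun x : ℝ => (Real.exp (-t * |x|) : ℂ))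
      = fun ω => ((2 * t / (4 * Real.pi ^ 2 * ω ^ 2 + t ^ 2) : ℝ) : ℂ) :=
    funext (fourier_exp_neg_mul_abs ht)
  have h := congrFun (Continuous.fourierInv_fourier_eq
    (f := fun x : ℝ => (Real.exp (-t * |x|) : ℂ)) (by fun_prop)
    (integrable_exp_neg_mul_abs ht).ofReal
    (by rw [hF]; exact (integrable_cauchyDensity ht).ofReal)) x
  rw [hF, Real.fourierInv_eq'] at h
  rw [← h]
  refine integral_congr_ae (Eventually.of_forall fun ω => ?_)
  simp only [smul_eq_mul]
  rw [mul_comm]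
  congr 3
  simp [mul_comm]

theorem integrable_one_sub_cos_div (z : ℝ) :
    Integrable (fun ζ : ℝ => (1 - Real.cos (2 * Real.pi * ζ * z)) / (2 * Real.pi ^ 2 * ζ ^ 2)) := by
  have hm : Measurable
      (fun ζ : ℝ => (1 - Real.cos (2 * Real.pi * ζ * z)) / (2 * Real.pi ^ 2 * ζ ^ 2)) := by
    fun_prop
  -- The constant `z² + 1` combines two bounds on `1 - cos`: the quadratic one, sharp near `ζ = 0`,
  -- gives `z²`, and the bound by 2 gives the 1 after multiplying by `ζ²`.
  refine (integrable_inv_one_add_sq.const_mul (z ^ 2 + 1)).mono' hm.aestronglyMeasurable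
    (Eventually.of_forall fun ζ => ?_)
  rw [Real.norm_eq_abs, abs_of_nonneg
    (div_nonneg (sub_nonneg.2 (Real.cos_le_one _)) (by positivity))]
  rcases eq_or_ne ζ 0 with rfl | hζ
  · simp; positivity
  rw [← div_eq_mul_inv, div_le_div_iff₀ (by positivity) (by positivity)]
  have c1 := Real.one_sub_sq_div_two_le_cos (x := 2 * Real.pi * ζ * z)
  have c2 := Real.neg_one_le_cos (2 * Real.pi * ζ * z)
  have hpi : 1 ≤ Real.pi ^ 2 := by nlinarith [Real.pi_gt_three]
  have hζ2 : 0 ≤ ζ ^ 2 := sq_nonneg ζ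
  calc (1 - Real.cos (2 * Real.pi * ζ * z)) * (1 + ζ ^ 2)
      = (1 - Real.cos (2 * Real.pi * ζ * z)) + (1 - Real.cos (2 * Real.pi * ζ * z)) * ζ ^ 2 := by
        ring
    _ ≤ (2 * Real.pi * ζ * z) ^ 2 / 2 + 2 * ζ ^ 2 := by
        gcongr <;> linarith
    _ ≤ (2 * Real.pi * ζ * z) ^ 2 / 2 + 2 * (Real.pi ^ 2 * ζ ^ 2) := by
        gcongr
        nlinarith
    _ = (z ^ 2 + 1) * (2 * Real.pi ^ 2 * ζ ^ 2) := by ring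

theorem integral_cauchyDensity_mul_one_sub_cos {t : ℝ} (ht : 0 < t) (z : ℝ) :
    ∫ ζ : ℝ, 2 * t / (4 * Real.pi ^ 2 * ζ ^ 2 + t ^ 2) * (1 - Real.cos (2 * Real.pi * ζ * z))
      = 1 - Real.exp (-t * |z|) := by
  have hi : Integrable fun ζ : ℝ => ((2 * t / (4 * Real.pi ^ 2 * ζ ^ 2 + t ^ 2) : ℝ) : ℂ) :=
    (integrable_cauchyDensity ht).ofReal (𝕜 := ℂ)
  have h1 : ∫ ζ : ℝ, ((2 * t / (4 * Real.pi ^ 2 * ζ ^ 2 + t ^ 2) : ℝ) : ℂ) = 1 := by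
    simpa using integral_cauchyDensity_mul_exp ht 0
  have h2 := integral_cauchyDensity_mul_exp ht z
  have hi2 : Integrable fun ζ : ℝ => ((2 * t / (4 * Real.pi ^ 2 * ζ ^ 2 + t ^ 2) : ℝ) : ℂ)
      * Complex.exp (((2 * Real.pi * (ζ * z) : ℝ) : ℂ) * Complex.I) :=
    hi.mul_bdd (c := 1) (Continuous.aestronglyMeasurable (by fun_prop))
      (Eventually.of_forall fun w => (Complex.norm_exp_ofReal_mul_I _).le)
  have h3 := integral_sub hi hi2
  rw [h1, h2] at h3
  have h4 := congrArg Complex.re h3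
  have h6 := (integral_re (hi.sub hi2)).trans h4
  have h5 : (RCLike.re ((1 : ℂ) - (Real.exp (-t * |z|) : ℂ)) : ℝ) = 1 - Real.exp (-t * |z|) := by
    simp [-Complex.ofReal_exp]
  rw [← h5]
  refine Eq.trans ?_ h6
  refine integral_congr_ae (Eventually.of_forall fun ζ => ?_)
  simp only [Pi.sub_apply, RCLike.re_eq_complex_re, Complex.sub_re, Complex.ofReal_re,
    Complex.re_ofReal_mul, Complex.exp_ofReal_mul_I_re]
  ring_nf

/-- Divide the identity for `1 - e^{-t|z|}` by `t` and let `t → 0+`. The Cauchy density over `t` is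
dominated by its limit `1 / (2π²ζ²)`, while the right side is a difference quotient of the
exponential. -/
theorem integral_one_sub_cos_div (z : ℝ) :
    ∫ ζ : ℝ, (1 - Real.cos (2 * Real.pi * ζ * z)) / (2 * Real.pi ^ 2 * ζ ^ 2) = |z| := by
  have hlim : Tendsto (fun t : ℝ => ∫ ζ : ℝ, 2 / (4 * Real.pi ^ 2 * ζ ^ 2 + t ^ 2)
      * (1 - Real.cos (2 * Real.pi * ζ * z))) (𝓝[>] 0)
      (𝓝 (∫ ζ : ℝ, (1 - Real.cos (2 * Real.pi * ζ * z)) / (2 * Real.pi ^ 2 * ζ ^ 2))) := by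
    refine tendsto_integral_filter_of_dominated_convergence _ ?_ ?_
      (integrable_one_sub_cos_div z) ?_
    · refine Eventually.of_forall fun t => Measurable.aestronglyMeasurable ?_
      fun_prop
    · filter_upwards [self_mem_nhdsWithin] with t ht
      have hae : ∀ᵐ ζ : ℝ, ζ ≠ 0 := by simp [ae_iff]
      filter_upwards [hae] with ζ hζ
      have hc : 0 ≤ 1 - Real.cos (2 * Real.pi * ζ * z) := sub_nonneg.2 (Real.cos_le_one _)
      rw [Real.norm_eq_abs, abs_of_nonneg (by positivity), div_mul_eq_mul_div,
        div_le_div_iff₀ (by positivity) (by positivity)]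
      nlinarith [mul_nonneg hc (sq_nonneg t)]
    · have hae : ∀ᵐ ζ : ℝ, ζ ≠ 0 := by simp [ae_iff]
      filter_upwards [hae] with ζ hζ
      have h0 : 4 * Real.pi ^ 2 * ζ ^ 2 + 0 ^ 2 ≠ 0 := by
        have : 0 < Real.pi := Real.pi_pos
        positivity
      have : ContinuousAt (fun t : ℝ => 2 / (4 * Real.pi ^ 2 * ζ ^ 2 + t ^ 2)
          * (1 - Real.cos (2 * Real.pi * ζ * z))) 0 := by
        fun_prop (disch := exact h0)
      have h2 := this.tendsto.mono_left (nhdsWithin_le_nhds (s := Set.Ioi 0))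
      convert h2 using 2
      field_simp
      ring
  have hlim2 : Tendsto (fun t : ℝ => (1 - Real.exp (-t * |z|)) / t) (𝓝[>] 0) (𝓝 |z|) := by
    have hd : HasDerivAt (fun t : ℝ => -Real.exp (-t * |z|)) |z| 0 := by
      have := (((hasDerivAt_id (0 : ℝ)).neg.mul_const |z|).exp).fun_neg
      simpa using this
    have := hd.tendsto_slope_zero_right
    refine this.congr fun t => ?_
    simp [div_eq_inv_mul]
    ring_nf
    simp
  refine tendsto_nhds_unique hlim (hlim2.congr' ?_)
  filter_upwards [self_mem_nhdsWithin] with t ht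
  have ht' : (0 : ℝ) < t := ht
  rw [← integral_cauchyDensity_mul_one_sub_cos ht', ← integral_div]
  refine integral_congr_ae (Eventually.of_forall fun ζ => ?_)
  simp only
  have : 4 * Real.pi ^ 2 * ζ ^ 2 + t ^ 2 ≠ 0 := by positivity
  field_simp

end Laplace

/-! ### Uniqueness of signed densities through characteristic functions and `π`-systems. -/

/-- A density whose Fourier–Stieltjes transform along `Z` vanishes integrates to zero over every
event in the `σ`-algebra of `Z`. -/
theorem setIntegral_preimage_eq_zero_of_charFun {V Ω : Type*} [NormedAddCommGroup V]
    [InnerProductSpace ℝ V] [CompleteSpace V] [SecondCountableTopology V]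
    [MeasurableSpace V] [BorelSpace V] [MeasurableSpace Ω] {P : Measure Ω}
    {r : Ω → ℝ} (hr : Integrable r P) {Z : Ω → V} (hZ : Measurable Z)
    (h : ∀ ω : V, ∫ w, (r w : ℂ) *
      Complex.exp (((-2 * Real.pi * inner ℝ ω (Z w) : ℝ) : ℂ) * Complex.I) ∂P = 0)
    {A : Set V} (hA : MeasurableSet A) : ∫ w in Z ⁻¹' A, r w ∂P = 0 := by
  have hfin : ∀ s : Ω → ℝ, Integrable s P →
      IsFiniteMeasure ((P.withDensity fun w => ENNReal.ofReal (s w)).map Z) := by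
    intro s hs
    have := isFiniteMeasure_withDensity_ofReal hs.2
    infer_instance
  have hchar : ∀ s : Ω → ℝ, Integrable s P → ∀ ω : V,
      charFun ((P.withDensity fun w => ENNReal.ofReal (s w)).map Z) ω
        = ∫ w, ((max (s w) 0 : ℝ) : ℂ) * Complex.exp ((inner ℝ (Z w) ω : ℂ) * Complex.I) ∂P := by
    intro s hs ω
    rw [charFun_apply, integral_map hZ.aemeasurable (by fun_prop)]
    rw [integral_withDensity_eq_integral_toReal_smul₀ hs.aemeasurable.ennreal_ofReal
      (by simp)]
    refine integral_congr_ae (Eventually.of_forall fun w => ?_)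
    simp [ENNReal.toReal_ofReal', Complex.real_smul]
  have hint : ∀ s : Ω → ℝ, Integrable s P → ∀ ω : V, Integrable (fun w => ((max (s w) 0 : ℝ) : ℂ) *
      Complex.exp ((inner ℝ (Z w) ω : ℂ) * Complex.I)) P := by
    intro s hs ω
    refine (hs.pos_part.ofReal (𝕜 := ℂ)).mul_bdd (c := 1) ?_ ?_
    · have : Measurable fun w => Complex.exp ((inner ℝ (Z w) ω : ℂ) * Complex.I) := by fun_prop
      exact this.aestronglyMeasurable
    · exact Eventually.of_forall fun w => (Complex.norm_exp_ofReal_mul_I _).le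
  have := hfin r hr
  have := hfin (fun w => -r w) hr.neg
  -- The positive and negative parts of `r` push forward to finite measures with equal
  -- characteristic functions. The frequency is rescaled by `-1 / (2π)` to match the convention of
  -- `charFun`.
  have heq : (P.withDensity fun w => ENNReal.ofReal (r w)).map Z
      = (P.withDensity fun w => ENNReal.ofReal (-r w)).map Z := by
    refine Measure.ext_of_charFun (funext fun ω => ?_)
    rw [hchar r hr, hchar (fun w => -r w) hr.neg, ← sub_eq_zero,
      ← integral_sub (hint r hr ω) (hint (fun w => -r w) hr.neg ω), ← h ((-1 / (2 * Real.pi)) • ω)]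
    refine integral_congr_ae (Eventually.of_forall fun w => ?_)
    have e1 : -2 * Real.pi * inner ℝ ((-1 / (2 * Real.pi)) • ω) (Z w) = inner ℝ (Z w) ω := by
      rw [inner_smul_left, real_inner_comm]
      simp
      field_simp
    simp only
    rw [e1, ← sub_mul, ← Complex.ofReal_sub]
    congr 3
    rcases le_total (r w) 0 with h0 | h0 <;> simp [h0]
  have h2 := congrArg (fun ν => ν A) heq
  rw [Measure.map_apply hZ hA, Measure.map_apply hZ hA, withDensity_apply _ (hZ hA),
    withDensity_apply _ (hZ hA)] at h2
  rw [integral_eq_lintegral_pos_part_sub_lintegral_neg_part hr.restrict, h2, sub_self]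

/-- An integrable function that integrates to zero over a generating `π`-system integrates to zero
over every event of the generated `σ`-algebra. -/
theorem setIntegral_eq_zero_of_isPiSystem {Ω : Type*} {m m0 : MeasurableSpace Ω} {P : Measure Ω}
    (hm : m ≤ m0) {f : Ω → ℝ} (hf : Integrable f P) {C : Set (Set Ω)}
    (hgen : m = MeasurableSpace.generateFrom C) (hC : IsPiSystem C)
    (h0 : ∀ s ∈ C, ∫ w in s, f w ∂P = 0) (hU : ∫ w, f w ∂P = 0)
    {s : Set Ω} (hs : MeasurableSet[m] s) : ∫ w in s, f w ∂P = 0 := by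
  induction s, hs using MeasurableSpace.induction_on_inter hgen hC with
  | empty => simp
  | basic t ht => exact h0 t ht
  | compl t ht ih =>
    have := integral_add_compl (hm t ht) hf
    rw [ih, hU, zero_add] at this
    exact this
  | iUnion g hd hg ih =>
    rw [integral_iUnion (fun i => hm _ (hg i)) hd hf.integrableOn]
    simp [ih]

/-! ### Square integrable kernels: weak continuity, ridge residuals and the envelope formula. -/

section KernelForm

variable {Ω : Type*} [MeasurableSpace Ω] {P : Measure Ω} [IsProbabilityMeasure P]

theorem memLp_mul_prod {u v : Ω → ℝ} (hu : MemLp u 2 P) (hv : MemLp v 2 P) :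
    MemLp (fun z : Ω × Ω => u z.1 * v z.2) 2 (P.prod P) := by
  have hm : AEStronglyMeasurable (fun z : Ω × Ω => u z.1 * v z.2) (P.prod P) :=
    hu.1.comp_fst.mul hv.1.comp_snd
  rw [memLp_two_iff_integrable_sq hm]
  have := hu.integrable_sq.mul_prod hv.integrable_sq
  refine this.congr (Eventually.of_forall fun z => ?_)
  simp only
  ring

/-- The tensor product `(w, w') ↦ u(w) v(w')` of two square integrable functions. -/
noncomputable def tensor (u v : Lp ℝ 2 P) : Lp ℝ 2 (P.prod P) :=
  (memLp_mul_prod (Lp.memLp u) (Lp.memLp v)).toLp _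

theorem coeFn_tensor (u v : Lp ℝ 2 P) :
    tensor u v =ᵐ[P.prod P] fun z => u z.1 * v z.2 :=
  MemLp.coeFn_toLp _

theorem tensor_congr {u v : Lp ℝ 2 P} {f g : Ω → ℝ} (hu : u =ᵐ[P] f) (hv : v =ᵐ[P] g) :
    tensor u v =ᵐ[P.prod P] fun z => f z.1 * g z.2 := by
  filter_upwards [coeFn_tensor u v, Measure.quasiMeasurePreserving_fst.ae_eq_comp hu,
    Measure.quasiMeasurePreserving_snd.ae_eq_comp hv] with z h1 h2 h3
  simp only [Function.comp] at h2 h3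
  rw [h1, h2, h3]

theorem inner_tensor (u v x y : Lp ℝ 2 P) :
    inner ℝ (tensor u v) (tensor x y) = inner ℝ u x * inner ℝ v y := by
  rw [L2.inner_def, L2.inner_def, L2.inner_def, ← integral_prod_mul]
  refine integral_congr_ae ?_
  filter_upwards [coeFn_tensor u v, coeFn_tensor x y] with z h1 h2
  rw [h1, h2]
  simp
  ring

theorem norm_tensor (u v : Lp ℝ 2 P) : ‖tensor u v‖ = ‖u‖ * ‖v‖ := by
  have h := inner_tensor u v u v
  rw [real_inner_self_eq_norm_sq, real_inner_self_eq_norm_sq, real_inner_self_eq_norm_sq,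
    ← mul_pow] at h
  exact (pow_left_inj₀ (norm_nonneg _) (by positivity) two_ne_zero).1 h

/-- Tensors of indicators make the integral of `κ` vanish over all measurable rectangles, which form
a generating `π`-system. -/
theorem eq_zero_of_forall_inner_tensor {κ : Lp ℝ 2 (P.prod P)}
    (h : ∀ u v, inner ℝ κ (tensor u v) = 0) : κ = 0 := by
  rw [Lp.eq_zero_iff_ae_eq_zero]
  have hi : Integrable κ (P.prod P) := (Lp.memLp κ).integrable one_le_two
  have hrect : ∀ s ∈ Set.image2 (fun x1 x2 : Set Ω => x1 ×ˢ x2) {s | MeasurableSet s}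
      {t | MeasurableSet t}, ∫ z in s, κ z ∂(P.prod P) = 0 := by
    rintro _ ⟨s, hs, t, ht, rfl⟩
    have := h (indicatorConstLp 2 hs (measure_ne_top _ _) 1)
      (indicatorConstLp 2 ht (measure_ne_top _ _) 1)
    rw [L2.inner_def] at this
    rw [← integral_indicator (hs.prod ht), ← this]
    refine integral_congr_ae ?_
    filter_upwards [tensor_congr (P := P) (indicatorConstLp_coeFn (p := 2) (hs := hs)
      (hμs := measure_ne_top P s) (c := (1 : ℝ))) (indicatorConstLp_coeFn (p := 2) (hs := ht)
      (hμs := measure_ne_top P t) (c := (1 : ℝ)))] with z hz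
    rw [hz]
    by_cases h1 : z.1 ∈ s <;> by_cases h2 : z.2 ∈ t <;>
      simp [Set.indicator, h1, h2]
  refine ae_eq_zero_of_forall_setIntegral_eq_of_sigmaFinite (fun _ _ _ => hi.integrableOn)
    fun s hs _ => ?_
  refine setIntegral_eq_zero_of_isPiSystem le_rfl hi generateFrom_prod.symm isPiSystem_prod
    hrect ?_ hs
  have := hrect Set.univ ⟨Set.univ, MeasurableSet.univ, Set.univ, MeasurableSet.univ, by simp⟩
  simpa using this

variable (P) in
/-- The tensor product as a continuous bilinear map. -/
noncomputable def tensorL : Lp ℝ 2 P →L[ℝ] Lp ℝ 2 P →L[ℝ] Lp ℝ 2 (P.prod P) :=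
  LinearMap.mkContinuous₂
    (LinearMap.mk₂ ℝ tensor
      (fun u u' v => by
        refine Lp.ext ?_
        filter_upwards [tensor_congr (Lp.coeFn_add u u') (EventuallyEq.refl _ (v : Ω → ℝ)),
          coeFn_tensor u v, coeFn_tensor u' v, Lp.coeFn_add (tensor u v) (tensor u' v)]
          with z h1 h2 h3 h4
        rw [h1, h4, Pi.add_apply, Pi.add_apply, h2, h3, add_mul])
      (fun c u v => by
        refine Lp.ext ?_
        filter_upwards [tensor_congr (Lp.coeFn_smul c u) (EventuallyEq.refl _ (v : Ω → ℝ)),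
          coeFn_tensor u v, Lp.coeFn_smul c (tensor u v)] with z h1 h2 h3
        rw [h1, h3, Pi.smul_apply, Pi.smul_apply, h2, smul_mul_assoc])
      (fun u v v' => by
        refine Lp.ext ?_
        filter_upwards [tensor_congr (EventuallyEq.refl _ (u : Ω → ℝ)) (Lp.coeFn_add v v'),
          coeFn_tensor u v, coeFn_tensor u v', Lp.coeFn_add (tensor u v) (tensor u v')]
          with z h1 h2 h3 h4
        rw [h1, h4, Pi.add_apply, Pi.add_apply, h2, h3, mul_add])
      (fun c u v => by
        refine Lp.ext ?_
        filter_upwards [tensor_congr (EventuallyEq.refl _ (u : Ω → ℝ)) (Lp.coeFn_smul c v),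
          coeFn_tensor u v, Lp.coeFn_smul c (tensor u v)] with z h1 h2 h3
        rw [h1, h3, Pi.smul_apply, Pi.smul_apply, h2, mul_smul_comm]))
    1 (fun u v => by simp [norm_tensor])

/-- The bilinear form `(u, v) ↦ ∬ κ(w, w') u(w) v(w') P(dw) P(dw')` of a square integrable
kernel. -/
noncomputable def kernelForm (κ : Lp ℝ 2 (P.prod P)) : Lp ℝ 2 P →L[ℝ] Lp ℝ 2 P →L[ℝ] ℝ :=
  ((ContinuousLinearMap.compL ℝ _ _ _) (innerSL ℝ κ)).comp (tensorL P)

theorem kernelForm_apply (κ : Lp ℝ 2 (P.prod P)) (u v : Lp ℝ 2 P) :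
    kernelForm κ u v = inner ℝ κ (tensor u v) := rfl

theorem kernelForm_toLp {κ : Ω × Ω → ℝ} (hκ : MemLp κ 2 (P.prod P)) (u v : Lp ℝ 2 P) :
    kernelForm (hκ.toLp κ) u v = ∫ z, κ z * (u z.1 * v z.2) ∂(P.prod P) := by
  rw [kernelForm_apply, L2.inner_def]
  refine integral_congr_ae ?_
  filter_upwards [coeFn_tensor u v, hκ.coeFn_toLp] with z h1 h2
  rw [h1, h2]
  simp
  ring

theorem abs_kernelForm_le (κ : Lp ℝ 2 (P.prod P)) (u v : Lp ℝ 2 P) :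
    |kernelForm κ u v| ≤ ‖κ‖ * (‖u‖ * ‖v‖) := by
  rw [kernelForm_apply, ← norm_tensor]
  exact abs_real_inner_le_norm _ _

theorem kernelForm_neg (κ : Lp ℝ 2 (P.prod P)) (u v : Lp ℝ 2 P) :
    kernelForm (-κ) u v = -kernelForm κ u v := by
  simp [kernelForm_apply]

theorem kernelForm_sub (κ κ' : Lp ℝ 2 (P.prod P)) (u v : Lp ℝ 2 P) :
    kernelForm (κ - κ') u v = kernelForm κ u v - kernelForm κ' u v := by
  simp [kernelForm_apply, inner_sub_left]

/-- The vector of `L²(P)` represented by a functional. -/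
noncomputable def rieszRep (φ : WeakDual ℝ (Lp ℝ 2 P)) : Lp ℝ 2 P :=
  (InnerProductSpace.toDual ℝ (Lp ℝ 2 P)).symm (WeakDual.toStrongDual φ)

theorem inner_rieszRep (φ : WeakDual ℝ (Lp ℝ 2 P)) (u : Lp ℝ 2 P) :
    inner ℝ (rieszRep φ) u = φ u :=
  InnerProductSpace.toDual_symm_apply

theorem continuous_inner_rieszRep (u : Lp ℝ 2 P) :
    Continuous fun φ : WeakDual ℝ (Lp ℝ 2 P) => inner ℝ (rieszRep φ) u := by
  simp only [inner_rieszRep]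
  exact WeakDual.eval_continuous u

theorem norm_rieszRep (φ : WeakDual ℝ (Lp ℝ 2 P)) :
    ‖rieszRep φ‖ = ‖WeakDual.toStrongDual φ‖ :=
  LinearIsometryEquiv.norm_map _ _

/-- The ball of radius `b` of `L²(P)` with the weak topology. -/
def weakBall (P : Measure Ω) (b : ℝ) : Set (WeakDual ℝ (Lp ℝ 2 P)) :=
  WeakDual.toStrongDual ⁻¹' Metric.closedBall 0 b

theorem norm_rieszRep_le {b : ℝ} {φ : WeakDual ℝ (Lp ℝ 2 P)} (h : φ ∈ weakBall P b) :
    ‖rieszRep φ‖ ≤ b := by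
  rw [norm_rieszRep]
  simpa [weakBall] using h

theorem exists_rieszRep_eq (r : Lp ℝ 2 P) {b : ℝ} (hr : ‖r‖ ≤ b) :
    ∃ φ ∈ weakBall P b, rieszRep φ = r := by
  refine ⟨StrongDual.toWeakDual (InnerProductSpace.toDual ℝ _ r), ?_, ?_⟩
  · simpa [weakBall] using hr
  · simp [rieszRep]

/-- The Hilbert–Schmidt property. The kernels whose quadratic form is weakly continuous on the ball
form a subspace, closed because forms of nearby kernels are uniformly close there. It contains every
tensor, whose form is a product of two weakly continuous functionals, and tensors have dense span.
-/
theorem continuousOn_kernelForm_rieszRep (κ : Lp ℝ 2 (P.prod P)) (b : ℝ) :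
    ContinuousOn (fun φ => kernelForm κ (rieszRep φ) (rieszRep φ)) (weakBall P b) := by
  let W : Submodule ℝ (Lp ℝ 2 (P.prod P)) :=
    { carrier := {κ | ContinuousOn (fun φ => kernelForm κ (rieszRep φ) (rieszRep φ))
        (weakBall P b)}
      add_mem' := by
        intro κ κ' h h'
        refine (ContinuousOn.add h h').congr fun φ _ => ?_
        simp [kernelForm_apply, inner_add_left]
      zero_mem' := by
        refine continuousOn_const (c := 0) |>.congr fun φ _ => ?_
        simp [kernelForm_apply]
      smul_mem' := by
        intro c κ h
        refine (ContinuousOn.const_smul h c).congr fun φ _ => ?_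
        simp [kernelForm_apply, inner_smul_left] }
  have hclosed : IsClosed (W : Set (Lp ℝ 2 (P.prod P))) := by
    refine isClosed_of_closure_subset fun κ hκ => ?_
    refine continuousOn_of_uniform_approx_of_continuousOn fun u hu => ?_
    obtain ⟨ε, hε, hεu⟩ := Metric.mem_uniformity_dist.1 hu
    have hδ : 0 < ε / (b ^ 2 + 1) := by positivity
    obtain ⟨κ', hκ', hd⟩ := Metric.mem_closure_iff.1 hκ _ hδ
    refine ⟨_, hκ', fun φ hφ => hεu ?_⟩
    rw [Real.dist_eq, ← kernelForm_sub]
    have hn := norm_rieszRep_le hφ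
    calc |kernelForm (κ - κ') (rieszRep φ) (rieszRep φ)|
        ≤ ‖κ - κ'‖ * (‖rieszRep φ‖ * ‖rieszRep φ‖) := abs_kernelForm_le _ _ _
      _ ≤ ‖κ - κ'‖ * (b ^ 2 + 1) := by
          gcongr
          nlinarith [norm_nonneg (rieszRep φ)]
      _ < ε := by
          rw [dist_eq_norm] at hd
          rwa [← lt_div_iff₀ (by positivity)]
  have htensor : ∀ u v, tensor u v ∈ W := by
    intro u v
    have : Continuous fun φ : WeakDual ℝ (Lp ℝ 2 P) =>
        inner ℝ (rieszRep φ) u * inner ℝ (rieszRep φ) v :=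
      (continuous_inner_rieszRep u).mul (continuous_inner_rieszRep v)
    refine this.continuousOn.congr fun φ _ => ?_
    simp only
    rw [kernelForm_apply, inner_tensor, real_inner_comm u, real_inner_comm v]
  have htop : W = ⊤ := by
    have : W.topologicalClosure = ⊤ := by
      rw [Submodule.topologicalClosure_eq_top_iff, Submodule.eq_bot_iff]
      intro κ hκ
      refine eq_zero_of_forall_inner_tensor fun u v => ?_
      rw [real_inner_comm]
      exact (Submodule.mem_orthogonal _ _).1 hκ _ (htensor u v)
    rwa [hclosed.submodule_topologicalClosure_eq] at this
  have : κ ∈ W := htop ▸ Submodule.mem_top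
  exact this

/-- Freezing the kernel at `a` costs at most `‖κ(p) - κ(a)‖ b²`, uniformly over the ball, so
separate continuity upgrades to joint continuity. -/
theorem continuousOn_kernelForm_prod {α : Type*} [TopologicalSpace α] {C : Set α}
    {κ : α → Lp ℝ 2 (P.prod P)} (hκ : ContinuousOn κ C) (b : ℝ) :
    ContinuousOn (fun p : α × WeakDual ℝ (Lp ℝ 2 P) =>
      kernelForm (κ p.1) (rieszRep p.2) (rieszRep p.2)) (C ×ˢ weakBall P b) := by
  rintro ⟨a, φ⟩ ⟨ha, hφ⟩
  have h1 : Tendsto (fun p : α × WeakDual ℝ (Lp ℝ 2 P) =>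
      kernelForm (κ a) (rieszRep p.2) (rieszRep p.2)) (𝓝[C ×ˢ weakBall P b] (a, φ))
      (𝓝 (kernelForm (κ a) (rieszRep φ) (rieszRep φ))) := by
    rw [nhdsWithin_prod_eq]
    exact (continuousOn_kernelForm_rieszRep (κ a) b φ hφ).tendsto.comp tendsto_snd
  have h2 : Tendsto (fun p : α × WeakDual ℝ (Lp ℝ 2 P) =>
      kernelForm (κ p.1 - κ a) (rieszRep p.2) (rieszRep p.2)) (𝓝[C ×ˢ weakBall P b] (a, φ))
      (𝓝 0) := by
    have h3 : Tendsto (fun p : α × WeakDual ℝ (Lp ℝ 2 P) => ‖κ p.1 - κ a‖ * (b * b))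
        (𝓝[C ×ˢ weakBall P b] (a, φ)) (𝓝 0) := by
      rw [nhdsWithin_prod_eq]
      have := ((hκ a ha).tendsto.sub_const (κ a)).norm.mul_const (b * b)
      rw [sub_self, norm_zero, zero_mul] at this
      exact this.comp tendsto_fst
    refine squeeze_zero_norm' ?_ h3
    filter_upwards [self_mem_nhdsWithin] with p hp
    have hn := norm_rieszRep_le hp.2
    refine (abs_kernelForm_le _ _ _).trans ?_
    gcongr
    exact (norm_nonneg _).trans hn
  have := h2.add h1
  rw [zero_add] at this
  refine this.congr fun p => ?_
  rw [kernelForm_sub]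
  ring

/-- Uniform positivity over a compact parameter set and a weakly closed constraint. -/
theorem exists_forall_le_max_kernelForm {α : Type*} [TopologicalSpace α] {C : Set α}
    (hC : IsCompact C) {κ κ' : α → Lp ℝ 2 (P.prod P)} (hκ : ContinuousOn κ C)
    (hκ' : ContinuousOn κ' C) (y : Lp ℝ 2 P) (W : Set (Lp ℝ 2 P)) (b : ℝ)
    (hpos : ∀ a ∈ C, ∀ r : Lp ℝ 2 P, (∀ h ∈ W, inner ℝ (y - r) h = 0) →
      0 < max (kernelForm (κ a) r r) (kernelForm (κ' a) r r)) :
    ∃ ε : ℝ, 0 < ε ∧ ∀ a ∈ C, ∀ r : Lp ℝ 2 P, ‖r‖ ≤ b → (∀ h ∈ W, inner ℝ (y - r) h = 0) →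
      ε ≤ max (kernelForm (κ a) r r) (kernelForm (κ' a) r r) := by
  set T : Set (WeakDual ℝ (Lp ℝ 2 P)) := {φ | ∀ h ∈ W, inner ℝ (y - rieszRep φ) h = 0} with hT
  have hTc : IsClosed T := by
    simp only [hT, Set.ofPred_forall, inner_sub_left]
    refine isClosed_iInter fun h => isClosed_iInter fun _ => isClosed_eq ?_ continuous_const
    exact continuous_const.sub (continuous_inner_rieszRep h)
  -- Banach–Alaoglu: the ball is weakly compact, and the constraint is a set of weakly continuous
  -- equations.
  have hK : IsCompact (C ×ˢ (weakBall P b ∩ T)) :=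
    hC.prod ((WeakDual.isCompact_closedBall (𝕜 := ℝ) 0 b).inter_right hTc)
  have hcont : ContinuousOn (fun p : α × WeakDual ℝ (Lp ℝ 2 P) =>
      max (kernelForm (κ p.1) (rieszRep p.2) (rieszRep p.2))
        (kernelForm (κ' p.1) (rieszRep p.2) (rieszRep p.2))) (C ×ˢ (weakBall P b ∩ T)) :=
    ((continuousOn_kernelForm_prod hκ b).sup (continuousOn_kernelForm_prod hκ' b)).mono
      (Set.prod_mono le_rfl Set.inter_subset_left)
  rcases (C ×ˢ (weakBall P b ∩ T)).eq_empty_or_nonempty with he | hne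
  · refine ⟨1, one_pos, fun a ha r hr hW => ?_⟩
    obtain ⟨φ, hφ, rfl⟩ := exists_rieszRep_eq r hr
    have : (a, φ) ∈ C ×ˢ (weakBall P b ∩ T) := ⟨ha, hφ, hW⟩
    rw [he] at this
    exact this.elim
  · obtain ⟨p, hp, hmin⟩ := hK.exists_isMinOn hne hcont
    refine ⟨_, hpos p.1 hp.1 (rieszRep p.2) hp.2.2, fun a ha r hr hW => ?_⟩
    obtain ⟨φ, hφ, rfl⟩ := exists_rieszRep_eq r hr
    exact hmin (a := (a, φ)) ⟨ha, hφ, hW⟩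

/-- `r` solves the regularized equation `r + λ⁻¹ T_κ r = y` in weak form. -/
def IsRidgeResidual (κ : Lp ℝ 2 (P.prod P)) (lam : ℝ) (y r : Lp ℝ 2 P) : Prop :=
  ∀ h, inner ℝ r h + lam⁻¹ * kernelForm κ r h = inner ℝ y h

/-- Lax–Milgram: a nonnegative form added to the inner product is coercive with constant 1. -/
theorem exists_isRidgeResidual {κ : Lp ℝ 2 (P.prod P)} (hpos : ∀ r, 0 ≤ kernelForm κ r r)
    {lam : ℝ} (hlam : 0 < lam) (y : Lp ℝ 2 P) : ∃ r, IsRidgeResidual κ lam y r := by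
  set B : Lp ℝ 2 P →L[ℝ] Lp ℝ 2 P →L[ℝ] ℝ := 
    (isBoundedBilinearMap_inner (𝕜 := ℝ) (E := Lp ℝ 2 P)).toContinuousLinearMap
      + lam⁻¹ • kernelForm κ with hB
  have hBa : ∀ u v, B u v = inner ℝ u v + lam⁻¹ * kernelForm κ u v := fun u v => rfl
  have hco : IsCoercive B := by
    refine ⟨1, one_pos, fun u => ?_⟩
    rw [hBa, real_inner_self_eq_norm_mul_norm, one_mul]
    have := mul_nonneg (inv_nonneg.2 hlam.le) (hpos u)
    linarith
  refine ⟨hco.continuousLinearEquivOfBilin.symm y, fun h => ?_⟩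
  rw [← hBa, ← hco.continuousLinearEquivOfBilin_apply]
  simp

theorem IsRidgeResidual.norm_le {κ : Lp ℝ 2 (P.prod P)} (hpos : ∀ r, 0 ≤ kernelForm κ r r)
    {lam : ℝ} (hlam : 0 < lam) {y r : Lp ℝ 2 P} (h : IsRidgeResidual κ lam y r) :
    ‖r‖ ≤ ‖y‖ := by
  have h1 := h r
  rw [real_inner_self_eq_norm_mul_norm] at h1
  have h2 := mul_nonneg (inv_nonneg.2 hlam.le) (hpos r)
  have h3 := real_inner_le_norm y r
  by_contra! hlt
  nlinarith [norm_nonneg y]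

/-- Testing the equation against `r` itself gives `λ⁻¹ κ(r, r) ≤ ⟨y, r⟩ ≤ ‖y‖²`. This quantifies how
nearly a ridge residual annihilates functions of the features for small `λ`. -/
theorem IsRidgeResidual.kernelForm_le {κ : Lp ℝ 2 (P.prod P)} (hpos : ∀ r, 0 ≤ kernelForm κ r r)
    {lam : ℝ} (hlam : 0 < lam) {y r : Lp ℝ 2 P} (h : IsRidgeResidual κ lam y r) :
    kernelForm κ r r ≤ lam * ‖y‖ ^ 2 := by
  have h1 := h r
  rw [real_inner_self_eq_norm_mul_norm] at h1
  have h3 := real_inner_le_norm y r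
  have h4 := h.norm_le hpos hlam
  have h5 : lam⁻¹ * kernelForm κ r r ≤ ‖y‖ ^ 2 := by
    nlinarith [norm_nonneg y, norm_nonneg r]
  rwa [inv_mul_le_iff₀ hlam] at h5

/-- The envelope theorem for the optimal value `⟨y, r_s⟩` along a differentiable path of
kernels. -/
theorem tendsto_slope_inner_ridgeResidual {κ : ℝ → Lp ℝ 2 (P.prod P)} {κ' : Lp ℝ 2 (P.prod P)}
    (hpos : ∀ s r, 0 ≤ kernelForm (κ s) r r)
    (hsymm : ∀ s u v, kernelForm (κ s) u v = kernelForm (κ s) v u)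
    (hκ : Tendsto (fun s => s⁻¹ • (κ s - κ 0)) (𝓝[>] 0) (𝓝 κ'))
    {lam : ℝ} (hlam : 0 < lam) {y : Lp ℝ 2 P} {r : ℝ → Lp ℝ 2 P}
    (hr : ∀ s, IsRidgeResidual (κ s) lam y (r s)) :
    Tendsto (fun s => (inner ℝ y (r s) - inner ℝ y (r 0)) / s) (𝓝[>] 0)
      (𝓝 (-(lam⁻¹ * kernelForm κ' (r 0) (r 0)))) := by
  have hs0 : Tendsto (fun s : ℝ => s) (𝓝[>] 0) (𝓝 0) :=
    tendsto_id.mono_left nhdsWithin_le_nhds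
  have hκ0 : Tendsto (fun s => κ s - κ 0) (𝓝[>] 0) (𝓝 0) := by
    have := hs0.smul hκ
    rw [zero_smul] at this
    refine this.congr' ?_
    filter_upwards [self_mem_nhdsWithin] with s hs
    rw [smul_inv_smul₀ (ne_of_gt hs)]
  -- Subtract the equations at `s` and `0` and test against `r s - r 0`. Nonnegativity of the form
  -- at `s` leaves a bound by `λ⁻¹ ‖κ s - κ 0‖ ‖r 0‖`.
  have hr0 : Tendsto r (𝓝[>] 0) (𝓝 (r 0)) := by
    rw [tendsto_iff_norm_sub_tendsto_zero]
    have h1 : Tendsto (fun s => lam⁻¹ * (‖κ s - κ 0‖ * ‖r 0‖)) (𝓝[>] 0) (𝓝 0) := by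
      simpa using (hκ0.norm.mul_const ‖r 0‖).const_mul lam⁻¹
    refine squeeze_zero (fun _ => norm_nonneg _) (fun s => ?_) h1
    set h := r s - r 0 with hh
    have e1 := hr s h
    have e2 := hr 0 h
    have e3 : inner ℝ h h + lam⁻¹ * kernelForm (κ s) h h
        = -(lam⁻¹ * kernelForm (κ s - κ 0) (r 0) h) := by
      have : kernelForm (κ s) h h = kernelForm (κ s) (r s) h - kernelForm (κ s) (r 0) h := by
        rw [← sub_apply, ← map_sub]
      have h5 : inner ℝ h h = inner ℝ (r s) h - inner ℝ (r 0) h := by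
        conv_lhs => rw [hh]
        rw [inner_sub_left]
      rw [this, h5, kernelForm_sub]
      linear_combination e1 - e2
    have e4 := mul_nonneg (inv_nonneg.2 hlam.le) (hpos s h)
    have e5 := neg_le_of_abs_le (abs_kernelForm_le (κ s - κ 0) (r 0) h)
    have e6 := mul_le_mul_of_nonneg_left e5 (inv_nonneg.2 hlam.le)
    rw [real_inner_self_eq_norm_mul_norm] at e3
    by_contra! hlt
    have hpos' : 0 < ‖h‖ := lt_of_le_of_lt (by positivity) hlt
    nlinarith
  have hlim : Tendsto (fun s => -(lam⁻¹ * kernelForm (s⁻¹ • (κ s - κ 0)) (r 0) (r s)))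
      (𝓝[>] 0) (𝓝 (-(lam⁻¹ * kernelForm κ' (r 0) (r 0)))) := by
    refine Tendsto.neg (Tendsto.const_mul _ ?_)
    simp only [kernelForm_apply]
    refine hκ.inner ?_
    exact ((tensorL P (r 0)).continuous.tendsto (r 0)).comp hr0
  refine hlim.congr' ?_
  filter_upwards [self_mem_nhdsWithin] with s hs
  have hs' : s ≠ 0 := ne_of_gt hs
  -- Testing each equation against the other solution gives, by symmetry, the exact increment `-λ⁻¹
  -- (κ s - κ 0)(r 0, r s)`. Hence `r` need only be continuous at `0`, not differentiable.
  have e1 := hr 0 (r s)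
  have e2 := hr s (r 0)
  rw [← e1, ← e2, hsymm s (r s) (r 0), real_inner_comm (r 0) (r s)]
  have : kernelForm (s⁻¹ • (κ s - κ 0)) (r 0) (r s)
      = s⁻¹ * (kernelForm (κ s) (r 0) (r s) - kernelForm (κ 0) (r 0) (r s)) := by
    rw [← kernelForm_sub]
    simp [kernelForm_apply, inner_smul_left]
  rw [this]
  field_simp
  ring

end KernelForm

/-! ### The spectral density of the `ℓ₁`-type kernel. -/

section Density

variable {d : ℕ}

/-- The `ℓ₁` norm. -/
noncomputable def l1norm (x : E d) : ℝ := ∑ j, |x j|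

theorem l1norm_nonneg (x : E d) : 0 ≤ l1norm x := Finset.sum_nonneg fun _ _ => abs_nonneg _

theorem l1norm_neg (x : E d) : l1norm (-x) = l1norm x := by simp [l1norm]

theorem continuous_l1norm : Continuous (l1norm : E d → ℝ) := by
  unfold l1norm; fun_prop

/-- The character `x ↦ e^{-2πi⟨ω, x⟩}`. -/
noncomputable def expChar (ω x : E d) : ℂ :=
  Complex.exp (((-2 * Real.pi * inner ℝ ω x : ℝ) : ℂ) * Complex.I)

theorem norm_expChar (ω x : E d) : ‖expChar ω x‖ = 1 := Complex.norm_exp_ofReal_mul_I _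

theorem continuous_expChar : Continuous fun p : E d × E d => expChar p.1 p.2 := by
  unfold expChar; fun_prop

theorem conj_expChar (ω x : E d) : (starRingEnd ℂ) (expChar ω x) = expChar ω (-x) := by
  rw [expChar, expChar, ← Complex.exp_conj, map_mul, Complex.conj_ofReal, Complex.conj_I,
    inner_neg_right]
  congr 1
  push_cast
  ring

theorem expChar_mul_conj (ω x y : E d) :
    expChar ω x * (starRingEnd ℂ) (expChar ω y) = expChar ω (x - y) := by
  rw [conj_expChar, expChar, expChar, expChar, ← Complex.exp_add, ← add_mul]
  congr 2
  rw [inner_sub_right, inner_neg_right]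
  push_cast
  ring

theorem qDensity_nonneg {t : ℝ} (ht : 0 ≤ t) (ω : E d) : 0 ≤ qDensity t ω :=
  Finset.prod_nonneg fun _ _ => by positivity

theorem measurable_qDensity : Measurable fun p : ℝ × E d => qDensity p.1 p.2 := by
  unfold qDensity; fun_prop

theorem integrable_qDensity {t : ℝ} (ht : 0 < t) : Integrable fun ω : E d => qDensity t ω := by
  have h := Integrable.fintype_prod (ι := Fin d) (𝕜 := ℝ) (μ := fun _ => (volume : Measure ℝ))
    (f := fun _ ω => 2 * t / (4 * Real.pi ^ 2 * ω ^ 2 + t ^ 2))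
    fun _ => integrable_cauchyDensity ht
  exact (PiLp.volume_preserving_ofLp (Fin d)).integrable_comp_of_integrable h

/-- The density and the character both factor over coordinates, so this is a product of
one-dimensional Cauchy transforms, evaluated at `-x j` because of the sign in `expChar`. -/
theorem integral_qDensity_mul_expChar {t : ℝ} (ht : 0 < t) (x : E d) :
    ∫ ω : E d, (qDensity t ω : ℂ) * expChar ω x = Real.exp (-t * l1norm x) := by
  have h := integral_fintype_prod_volume_eq_prod (ι := Fin d) (𝕜 := ℂ) (E := fun _ => ℝ)
    (fun j ω => ((2 * t / (4 * Real.pi ^ 2 * ω ^ 2 + t ^ 2) : ℝ) : ℂ)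
      * Complex.exp (((2 * Real.pi * (ω * -x j) : ℝ) : ℂ) * Complex.I))
  simp only [integral_cauchyDensity_mul_exp ht] at h
  have e : (Real.exp (-t * l1norm x) : ℂ) = ∏ j, (Real.exp (-t * |-x j|) : ℂ) := by
    rw [l1norm, Finset.mul_sum, Real.exp_sum]
    simp
  rw [e, ← h, ← (PiLp.volume_preserving_ofLp (Fin d)).integral_comp
    (MeasurableEquiv.toLp 2 (Fin d → ℝ)).symm.measurableEmbedding]
  refine integral_congr_ae (Eventually.of_forall fun ω => ?_)
  simp only [Finset.prod_mul_distrib, qDensity, expChar]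
  rw [← Complex.exp_sum, Complex.ofReal_prod]
  congr 2
  rw [← Finset.sum_mul, ← Complex.ofReal_sum]
  congr 2
  rw [PiLp.inner_apply, Finset.mul_sum]
  refine Finset.sum_congr rfl fun j _ => ?_
  simp
  ring

theorem integral_qDensity {t : ℝ} (ht : 0 < t) : ∫ ω : E d, qDensity t ω = 1 := by
  have h := integral_qDensity_mul_expChar ht (0 : E d)
  simp only [expChar, inner_zero_right, mul_zero, Complex.ofReal_zero, zero_mul,
    Complex.exp_zero, mul_one, l1norm, PiLp.zero_apply, abs_zero, Finset.sum_const_zero,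
    Real.exp_zero] at h
  rw [integral_complex_ofReal] at h
  exact_mod_cast h

/-- The kernel function `x ↦ ψ(‖x‖₁) = ∫ e^{-t‖x‖₁} μ(dt)`. -/
noncomputable def laplaceKernel (μ : Measure ℝ) (x : E d) : ℝ := ∫ t, Real.exp (-t * l1norm x) ∂μ

variable {μ : Measure ℝ} [IsFiniteMeasure μ] {a b : ℝ}

theorem integrable_exp_neg_mul (ha : 0 < a) (hμ : ∀ᵐ t ∂μ, t ∈ Set.Icc a b) {z : ℝ} (hz : 0 ≤ z) :
    Integrable (fun t => Real.exp (-t * z)) μ := by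
  refine Integrable.of_bound (C := 1) (Continuous.aestronglyMeasurable (by fun_prop)) ?_
  filter_upwards [hμ] with t ht
  rw [Real.norm_eq_abs, abs_of_pos (Real.exp_pos _), Real.exp_le_one_iff]
  have := mul_nonneg (ha.le.trans ht.1) hz
  linarith

theorem abs_laplaceKernel_le (ha : 0 < a) (hμ : ∀ᵐ t ∂μ, t ∈ Set.Icc a b) (x : E d) :
    |laplaceKernel μ x| ≤ μ.real Set.univ := by
  have := norm_integral_le_of_norm_le_const (μ := μ) (C := 1)
    (f := fun t => Real.exp (-t * l1norm x)) (by
      filter_upwards [hμ] with t ht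
      rw [Real.norm_eq_abs, abs_of_pos (Real.exp_pos _), Real.exp_le_one_iff]
      have := mul_nonneg (ha.le.trans ht.1) (l1norm_nonneg x)
      linarith)
  simpa [laplaceKernel] using this

theorem laplaceKernel_neg (x : E d) : laplaceKernel μ (-x) = laplaceKernel μ x := by
  simp [laplaceKernel, l1norm_neg]

theorem continuous_laplaceKernel (ha : 0 < a) (hμ : ∀ᵐ t ∂μ, t ∈ Set.Icc a b) :
    Continuous (laplaceKernel μ : E d → ℝ) := by
  refine continuous_of_dominated (bound := fun _ => 1) ?_ ?_ (integrable_const _) ?_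
  · intro x
    exact Continuous.aestronglyMeasurable (by fun_prop)
  · intro x
    filter_upwards [hμ] with t ht
    rw [Real.norm_eq_abs, abs_of_pos (Real.exp_pos _), Real.exp_le_one_iff]
    have := mul_nonneg (ha.le.trans ht.1) (l1norm_nonneg x)
    linarith
  · refine Eventually.of_forall fun t => ?_
    have := continuous_l1norm (d := d)
    fun_prop

theorem qDensity_le {t : ℝ} (ha : 0 < a) (ht : t ∈ Set.Icc a b) (ω : E d) :
    qDensity t ω ≤ (2 / a) ^ d := by
  have ht0 : 0 < t := ha.trans_le ht.1
  have : qDensity t ω ≤ ∏ _j : Fin d, 2 / a := by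
    refine Finset.prod_le_prod (fun _ _ => by positivity) fun j _ => ?_
    rw [div_le_div_iff₀ (by positivity) ha]
    have h1 : a * t ≤ t ^ 2 := by nlinarith [ht.1]
    nlinarith [sq_nonneg (Real.pi * ω j)]
  rwa [Finset.prod_const, Finset.card_univ, Fintype.card_fin] at this

/-- A minorant independent of `t`, which makes the mixture over `μ` strictly positive at every
frequency. Without it a vanishing energy would not force the characteristic function to vanish. -/
theorem le_qDensity {t : ℝ} (ha : 0 < a) (ht : t ∈ Set.Icc a b) (ω : E d) :
    ∏ j, 2 * a / (4 * Real.pi ^ 2 * (ω j) ^ 2 + b ^ 2) ≤ qDensity t ω := by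
  have ht0 : 0 < t := ha.trans_le ht.1
  refine Finset.prod_le_prod (fun _ _ => by positivity) fun j _ => ?_
  have h1 := ht.1
  have h2 := ht.2
  gcongr

theorem integrable_qDensity_left (ha : 0 < a) (hμ : ∀ᵐ t ∂μ, t ∈ Set.Icc a b) (ω : E d) :
    Integrable (fun t => qDensity t ω) μ := by
  refine Integrable.of_bound (C := (2 / a) ^ d)
    (measurable_qDensity.comp (measurable_id.prodMk measurable_const)).aestronglyMeasurable ?_
  filter_upwards [hμ] with t ht
  rw [Real.norm_eq_abs, abs_of_nonneg (qDensity_nonneg (ha.le.trans ht.1) ω)]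
  exact qDensity_le ha ht ω

theorem ell1Density_pos [NeZero μ] (ha : 0 < a) (hμ : ∀ᵐ t ∂μ, t ∈ Set.Icc a b) (ω : E d) :
    0 < ell1Density μ ω := by
  have hb : 0 < b := by
    obtain ⟨t, ht⟩ := hμ.exists
    exact ha.trans_le (ht.1.trans ht.2)
  have h1 : ∫ _t, ∏ j, 2 * a / (4 * Real.pi ^ 2 * (ω j) ^ 2 + b ^ 2) ∂μ ≤ ell1Density μ ω :=
    integral_mono_ae (integrable_const _) (integrable_qDensity_left ha hμ ω)
      (hμ.mono fun t ht => le_qDensity ha ht ω)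
  refine lt_of_lt_of_le ?_ h1
  rw [integral_const, smul_eq_mul]
  refine mul_pos ?_ (Finset.prod_pos fun j _ => by positivity)
  rw [measureReal_def, ENNReal.toReal_pos_iff]
  exact ⟨Measure.measure_univ_pos.2 (NeZero.ne μ), measure_lt_top _ _⟩

theorem ell1Density_nonneg (ha : 0 < a) (hμ : ∀ᵐ t ∂μ, t ∈ Set.Icc a b) (ω : E d) :
    0 ≤ ell1Density μ ω :=
  integral_nonneg_of_ae (hμ.mono fun _ ht => qDensity_nonneg (ha.le.trans ht.1) ω)

theorem ell1Density_le (ha : 0 < a) (hμ : ∀ᵐ t ∂μ, t ∈ Set.Icc a b) (ω : E d) :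
    ell1Density μ ω ≤ (2 / a) ^ d * μ.real Set.univ := by
  have h1 : ell1Density μ ω ≤ ∫ _t, (2 / a) ^ d ∂μ :=
    integral_mono_ae (integrable_qDensity_left ha hμ ω) (integrable_const _)
      (hμ.mono fun t ht => qDensity_le ha ht ω)
  rwa [integral_const, smul_eq_mul, mul_comm] at h1

theorem measurable_ell1Density : Measurable (ell1Density μ : E d → ℝ) := by
  have : StronglyMeasurable (ell1Density μ : E d → ℝ) :=
    (measurable_qDensity.stronglyMeasurable).integral_prod_left' (μ := μ)
  exact this.measurable

theorem integrable_qDensity_prod (ha : 0 < a) (hμ : ∀ᵐ t ∂μ, t ∈ Set.Icc a b) :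
    Integrable (fun p : ℝ × E d => qDensity p.1 p.2) (μ.prod volume) := by
  rw [integrable_prod_iff measurable_qDensity.aestronglyMeasurable]
  refine ⟨hμ.mono fun t ht => integrable_qDensity (ha.trans_le ht.1), ?_⟩
  refine (integrable_const (1 : ℝ)).congr (hμ.mono fun t ht => ?_)
  simp only
  rw [← integral_qDensity (d := d) (ha.trans_le ht.1)]
  refine integral_congr_ae (Eventually.of_forall fun ω => ?_)
  simp only
  rw [Real.norm_eq_abs, abs_of_nonneg (qDensity_nonneg (ha.le.trans ht.1) ω)]

theorem integrable_ell1Density (ha : 0 < a) (hμ : ∀ᵐ t ∂μ, t ∈ Set.Icc a b) :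
    Integrable (ell1Density μ : E d → ℝ) :=
  (integrable_qDensity_prod ha hμ).integral_prod_right

theorem integral_ell1Density_mul_expChar (ha : 0 < a) (hμ : ∀ᵐ t ∂μ, t ∈ Set.Icc a b) (x : E d) :
    ∫ ω : E d, (ell1Density μ ω : ℂ) * expChar ω x = laplaceKernel μ x := by
  have hi : Integrable (fun p : ℝ × E d => (qDensity p.1 p.2 : ℂ) * expChar p.2 x)
      (μ.prod volume) := by
    refine ((integrable_qDensity_prod ha hμ).ofReal (𝕜 := ℂ)).mul_bdd (c := 1) ?_ ?_
    · have := continuous_expChar (d := d)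
      exact Continuous.aestronglyMeasurable (by fun_prop)
    · exact Eventually.of_forall fun p => (norm_expChar _ _).le
  have h1 := integral_integral_swap
    (f := fun (t : ℝ) (ω : E d) => (qDensity t ω : ℂ) * expChar ω x) hi
  have h2 : ∫ ω : E d, (ell1Density μ ω : ℂ) * expChar ω x
      = ∫ ω : E d, ∫ t, (qDensity t ω : ℂ) * expChar ω x ∂μ := by
    refine integral_congr_ae (Eventually.of_forall fun ω => ?_)
    simp only
    rw [integral_mul_const, integral_complex_ofReal]
    rfl
  rw [h2, ← h1, laplaceKernel, ← integral_complex_ofReal]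
  refine integral_congr_ae (hμ.mono fun t ht => ?_)
  exact integral_qDensity_mul_expChar (ha.trans_le ht.1) x

end Density

/-- The spectral lemmas use the location of `μ` only through an almost sure interval `[a, b]` with
`a > 0`. That condition passes to `t μ(dt)`, so the lemmas apply to the derivative kernel as well.
-/
theorem exists_Icc_of_support {μ : Measure ℝ} [IsProbabilityMeasure μ]
    (hμc : IsCompact μ.support) (hμ0 : μ.support ⊆ Set.Ioi 0) :
    ∃ a b : ℝ, 0 < a ∧ ∀ᵐ t ∂μ, t ∈ Set.Icc a b := by
  have hne : μ.support.Nonempty := Measure.nonempty_support (IsProbabilityMeasure.ne_zero μ)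
  obtain ⟨a, ha⟩ := hμc.exists_isLeast hne
  obtain ⟨b, hb⟩ := hμc.exists_isGreatest hne
  refine ⟨a, b, hμ0 ha.1, ?_⟩
  filter_upwards [Measure.support_mem_ae (μ := μ)] with t ht
  exact ⟨ha.2 ht, hb.2 ht⟩

/-! ### Averaged feature maps and their Gram kernels. -/

section Feature

variable {Ω Θ : Type*} [MeasurableSpace Ω] [MeasurableSpace Θ] {P : Measure Ω}
  [SFinite P] {ν : Measure Θ} [SFinite ν]

/-- Since `2|φ φ'| ≤ |φ|² + |φ'|²`, the product is dominated by `|r r'| |φ|²` and its mirror image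
under exchanging the two sample points. No integrability of `φ` in the first power is needed, which
matters for the singular weight `1 / ζ²`. -/
theorem integrable_feature_prod {φ : Θ × Ω → ℂ} (hφ : Measurable φ) {r : Ω → ℝ}
    (hr : Integrable r P) (h : Integrable (fun p : Θ × Ω => r p.2 * ‖φ p‖ ^ 2) (ν.prod P)) :
    Integrable (fun p : Θ × (Ω × Ω) => ((r p.2.1 : ℂ) * φ (p.1, p.2.1))
      * (starRingEnd ℂ) ((r p.2.2 : ℂ) * φ (p.1, p.2.2))) (ν.prod (P.prod P)) := by
  have hA : Integrable (fun q : (Θ × Ω) × Ω => (r q.1.2 * ‖φ q.1‖ ^ 2) * r q.2)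
      ((ν.prod P).prod P) := h.mul_prod hr
  have hB : Integrable (fun p : Θ × (Ω × Ω) => (r p.2.1 * ‖φ (p.1, p.2.1)‖ ^ 2) * r p.2.2)
      (ν.prod (P.prod P)) :=
    (measurePreserving_prodAssoc ν P P).integrable_comp_emb
      MeasurableEquiv.prodAssoc.measurableEmbedding |>.1 hA
  have hC : Integrable (fun p : Θ × (Ω × Ω) => (r p.2.2 * ‖φ (p.1, p.2.2)‖ ^ 2) * r p.2.1)
      (ν.prod (P.prod P)) :=
    ((MeasurePreserving.id ν).prod (Measure.measurePreserving_swap (μ := P) (ν := P))).integrable_comp_of_integrable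
      hB
  have hrm := hr.1
  have hm1 : AEStronglyMeasurable (fun p : Θ × (Ω × Ω) => (r p.2.1 : ℂ)) (ν.prod (P.prod P)) :=
    (Complex.continuous_ofReal.comp_aestronglyMeasurable hrm).comp_fst.comp_snd
  have hm2 : AEStronglyMeasurable (fun p : Θ × (Ω × Ω) => (r p.2.2 : ℂ)) (ν.prod (P.prod P)) :=
    (Complex.continuous_ofReal.comp_aestronglyMeasurable hrm).comp_snd.comp_snd
  refine (hB.norm.add hC.norm).mono' ?_ (Eventually.of_forall fun p => ?_)
  · refine (hm1.mul (Measurable.aestronglyMeasurable (by fun_prop))).mul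
      (Complex.continuous_conj.comp_aestronglyMeasurable
        (hm2.mul (Measurable.aestronglyMeasurable (by fun_prop))))
  · simp only [norm_mul, RCLike.norm_conj, Complex.norm_real, Pi.add_apply, norm_pow, norm_norm]
    have h1 := two_mul_le_add_sq ‖φ (p.1, p.2.1)‖ ‖φ (p.1, p.2.2)‖
    have h2 : 0 ≤ ‖r p.2.1‖ * ‖r p.2.2‖ := by positivity
    have h3 : 0 ≤ ‖φ (p.1, p.2.1)‖ * ‖φ (p.1, p.2.2)‖ := by positivity
    nlinarith [mul_le_mul_of_nonneg_left h1 h2, mul_nonneg h2 h3]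

/-- The squared norm of an averaged feature map is the quadratic form of its kernel. -/
theorem lintegral_enorm_integral_feature {φ : Θ × Ω → ℂ} (hφ : Measurable φ) {r : Ω → ℝ}
    (hr : Integrable r P) (h : Integrable (fun p : Θ × Ω => r p.2 * ‖φ p‖ ^ 2) (ν.prod P)) :
    ∫⁻ θ, ‖∫ w, (r w : ℂ) * φ (θ, w) ∂P‖ₑ ^ 2 ∂ν
      = ENNReal.ofReal (∫ z, (∫ θ, φ (θ, z.1) * (starRingEnd ℂ) (φ (θ, z.2)) ∂ν).re
          * (r z.1 * r z.2) ∂(P.prod P))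
    ∧ 0 ≤ ∫ z, (∫ θ, φ (θ, z.1) * (starRingEnd ℂ) (φ (θ, z.2)) ∂ν).re
          * (r z.1 * r z.2) ∂(P.prod P) := by
  have hi := integrable_feature_prod hφ hr h
  -- For fixed `θ` the double integral factors into a mean and its conjugate; Fubini then exchanges
  -- it with the integral over `θ`.
  have e1 : ∀ θ, ∫ z, ((r z.1 : ℂ) * φ (θ, z.1)) * (starRingEnd ℂ) ((r z.2 : ℂ) * φ (θ, z.2))
      ∂(P.prod P) = ((‖∫ w, (r w : ℂ) * φ (θ, w) ∂P‖ ^ 2 : ℝ) : ℂ) := by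
    intro θ
    rw [integral_prod_mul (fun w => (r w : ℂ) * φ (θ, w))
      (fun w => (starRingEnd ℂ) ((r w : ℂ) * φ (θ, w))), integral_conj, Complex.mul_conj,
      Complex.normSq_eq_norm_sq]
  have hi1 : Integrable (fun θ => ‖∫ w, (r w : ℂ) * φ (θ, w) ∂P‖ ^ 2) ν := by
    have := hi.integral_prod_left.re
    refine this.congr (Eventually.of_forall fun θ => ?_)
    simp only
    rw [e1, RCLike.re_eq_complex_re, Complex.ofReal_re]
  have e2 : ∫ θ, ‖∫ w, (r w : ℂ) * φ (θ, w) ∂P‖ ^ 2 ∂ν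
      = ∫ z, (∫ θ, φ (θ, z.1) * (starRingEnd ℂ) (φ (θ, z.2)) ∂ν).re
          * (r z.1 * r z.2) ∂(P.prod P) := by
    have h1 := integral_integral_swap (f := fun (θ : Θ) (z : Ω × Ω) => ((r z.1 : ℂ) * φ (θ, z.1))
      * (starRingEnd ℂ) ((r z.2 : ℂ) * φ (θ, z.2))) hi
    simp only [e1] at h1
    rw [integral_complex_ofReal] at h1
    have h2 := congrArg Complex.re h1
    rw [Complex.ofReal_re] at h2
    rw [h2, ← RCLike.re_eq_complex_re, ← integral_re hi.integral_prod_right]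
    refine integral_congr_ae (Eventually.of_forall fun z => ?_)
    simp only
    rw [RCLike.re_eq_complex_re]
    have : ∀ θ, ((r z.1 : ℂ) * φ (θ, z.1)) * (starRingEnd ℂ) ((r z.2 : ℂ) * φ (θ, z.2))
        = (φ (θ, z.1) * (starRingEnd ℂ) (φ (θ, z.2))) * ((r z.1 * r z.2 : ℝ) : ℂ) := by
      intro θ
      rw [map_mul, Complex.conj_ofReal]
      push_cast
      ring
    simp only [this]
    rw [integral_mul_const, Complex.re_mul_ofReal]
  rw [← e2]
  refine ⟨?_, integral_nonneg fun _ => by positivity⟩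
  rw [ofReal_integral_eq_lintegral_ofReal hi1 (Eventually.of_forall fun _ => by positivity)]
  refine lintegral_congr fun θ => ?_
  rw [ENNReal.ofReal_pow (norm_nonneg _), ofReal_norm]

end Feature

/-- Dominated convergence in `L²`. -/
theorem tendsto_toLp_of_dominated {Ω ι : Type*} [MeasurableSpace Ω] {Q : Measure Ω}
    {l : Filter ι} [l.IsCountablyGenerated] {F : ι → Ω → ℝ} {f g : Ω → ℝ}
    (hF : ∀ i, MemLp (F i) 2 Q) (hf : MemLp f 2 Q) (hg : MemLp g 2 Q)
    (hb : ∀ᶠ i in l, ∀ z, |F i z - f z| ≤ g z)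
    (hl : ∀ z, Tendsto (fun i => F i z) l (𝓝 (f z))) :
    Tendsto (fun i => (hF i).toLp (F i)) l (𝓝 (hf.toLp f)) := by
  rw [tendsto_iff_norm_sub_tendsto_zero]
  have h1 : ∀ i, ‖(hF i).toLp (F i) - hf.toLp f‖ = Real.sqrt (∫ z, (F i z - f z) ^ 2 ∂Q) := by
    intro i
    rw [← MemLp.toLp_sub, eq_comm, Real.sqrt_eq_iff_mul_self_eq
      (integral_nonneg fun _ => sq_nonneg _) (norm_nonneg _), ← real_inner_self_eq_norm_mul_norm,
      L2.inner_def]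
    refine integral_congr_ae ?_
    filter_upwards [((hF i).sub hf).coeFn_toLp] with z hz
    rw [hz]
    simp [pow_two]
  simp only [h1]
  have h2 : Tendsto (fun i => ∫ z, (F i z - f z) ^ 2 ∂Q) l (𝓝 (∫ _z, (0 : ℝ) ∂Q)) := by
    refine tendsto_integral_filter_of_dominated_convergence (fun z => g z ^ 2) ?_ ?_
      hg.integrable_sq ?_
    · exact Eventually.of_forall fun i => (((hF i).1.sub hf.1).pow 2)
    · filter_upwards [hb] with i hi
      refine Eventually.of_forall fun z => ?_
      rw [Real.norm_eq_abs, abs_pow]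
      exact pow_le_pow_left₀ (abs_nonneg _) (hi z) 2
    · refine Eventually.of_forall fun z => ?_
      have := ((hl z).sub_const (f z)).pow 2
      simpa using this
  have h3 := (Real.continuous_sqrt.tendsto _).comp h2
  simpa [Function.comp_def] using h3

/-! ### The kernel form on the Fourier side. -/

section Kernel

variable {d : ℕ} {Ω : Type*} [MeasurableSpace Ω] {P : Measure Ω} [IsProbabilityMeasure P]
  {μ : Measure ℝ} [IsFiniteMeasure μ] {a b : ℝ} {Z : Ω → E d}

/-- The kernel `(w, w') ↦ ψ(‖Z(w) - Z(w')‖₁)`. -/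
noncomputable def pairKernel (μ : Measure ℝ) (Z : Ω → E d) (z : Ω × Ω) : ℝ :=
  laplaceKernel μ (Z z.1 - Z z.2)

theorem measurable_pairKernel (ha : 0 < a) (hμ : ∀ᵐ t ∂μ, t ∈ Set.Icc a b) (hZ : Measurable Z) :
    Measurable (pairKernel μ Z) :=
  (continuous_laplaceKernel ha hμ).measurable.comp
    ((hZ.comp measurable_fst).sub (hZ.comp measurable_snd))

theorem memLp_pairKernel (ha : 0 < a) (hμ : ∀ᵐ t ∂μ, t ∈ Set.Icc a b) (hZ : Measurable Z) :
    MemLp (pairKernel μ Z) 2 (P.prod P) :=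
  MemLp.of_bound (measurable_pairKernel ha hμ hZ).aestronglyMeasurable _
    (Eventually.of_forall fun _ => abs_laplaceKernel_le ha hμ _)

theorem integrable_mul_expChar {r : Ω → ℝ} (hr : Integrable r P) (hZ : Measurable Z) (ω : E d) :
    Integrable (fun w => (r w : ℂ) * expChar ω (Z w)) P := by
  have hm : Measurable fun w => expChar ω (Z w) :=
    (continuous_expChar.comp (Continuous.prodMk_right ω)).measurable.comp hZ
  exact (hr.ofReal (𝕜 := ℂ)).mul_bdd (c := 1) hm.aestronglyMeasurable
    (Eventually.of_forall fun _ => (norm_expChar _ _).le)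

theorem continuous_integral_mul_expChar {r : Ω → ℝ} (hr : Integrable r P) (hZ : Measurable Z) :
    Continuous fun ω : E d => ∫ w, (r w : ℂ) * expChar ω (Z w) ∂P := by
  refine continuous_of_dominated (bound := fun w => ‖r w‖)
    (fun ω => (integrable_mul_expChar hr hZ ω).1) ?_ hr.norm ?_
  · refine fun ω => Eventually.of_forall fun w => ?_
    simp [norm_expChar]
  · refine Eventually.of_forall fun w => ?_
    have := continuous_expChar (d := d)
    fun_prop

theorem norm_integral_mul_expChar_le {r : Ω → ℝ} (ω : E d) :
    ‖∫ w, (r w : ℂ) * expChar ω (Z w) ∂P‖ ≤ ∫ w, ‖r w‖ ∂P := by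
  refine (norm_integral_le_integral_norm _).trans_eq ?_
  simp [norm_expChar]

theorem integral_withDensity_ofReal {Θ : Type*} [MeasurableSpace Θ] {ν : Measure Θ} {k : Θ → ℝ}
    (hk : Measurable k) (hk0 : ∀ θ, 0 ≤ k θ) (f : Θ → ℂ) :
    ∫ θ, f θ ∂(ν.withDensity fun θ => ENNReal.ofReal (k θ)) = ∫ θ, (k θ : ℂ) * f θ ∂ν := by
  rw [integral_withDensity_eq_integral_toReal_smul hk.ennreal_ofReal (by simp)]
  refine integral_congr_ae (Eventually.of_forall fun θ => ?_)
  simp [ENNReal.toReal_ofReal (hk0 θ), Complex.real_smul]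

theorem isFiniteMeasure_withDensity_ell1Density (ha : 0 < a) (hμ : ∀ᵐ t ∂μ, t ∈ Set.Icc a b) :
    IsFiniteMeasure ((volume : Measure (E d)).withDensity
      fun ω => ENNReal.ofReal (ell1Density μ ω)) :=
  isFiniteMeasure_withDensity_ofReal (integrable_ell1Density ha hμ).2

theorem integral_withDensity_expChar (ha : 0 < a) (hμ : ∀ᵐ t ∂μ, t ∈ Set.Icc a b) (x : E d) :
    ∫ ω, expChar ω x ∂((volume : Measure (E d)).withDensity
      fun ω => ENNReal.ofReal (ell1Density μ ω)) = laplaceKernel μ x := by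
  rw [integral_withDensity_ofReal measurable_ell1Density (ell1Density_nonneg ha hμ),
    integral_ell1Density_mul_expChar ha hμ]

theorem measurable_expChar_comp (hZ : Measurable Z) :
    Measurable fun p : E d × Ω => expChar p.1 (Z p.2) := by
  have h : Measurable fun p : E d × E d => expChar p.1 p.2 := continuous_expChar.measurable
  exact h.comp (f := fun p : E d × Ω => (p.1, Z p.2))
    (measurable_fst.prodMk (hZ.comp measurable_snd))

/-- The quadratic form of the kernel is the weighted energy of the characteristic function. -/
theorem lintegral_enorm_sq_mul_ell1Density (ha : 0 < a) (hμ : ∀ᵐ t ∂μ, t ∈ Set.Icc a b)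
    (hZ : Measurable Z) (r : Lp ℝ 2 P) :
    ∫⁻ ω : E d, ENNReal.ofReal (ell1Density μ ω) * ‖∫ w, (r w : ℂ) * expChar ω (Z w) ∂P‖ₑ ^ 2
      = ENNReal.ofReal (kernelForm ((memLp_pairKernel ha hμ hZ).toLp _) r r)
    ∧ 0 ≤ kernelForm ((memLp_pairKernel (P := P) ha hμ hZ).toLp _) r r := by
  have hr : Integrable r P := (Lp.memLp r).integrable one_le_two
  have := isFiniteMeasure_withDensity_ell1Density (d := d) ha hμ
  have h := lintegral_enorm_integral_feature (P := P)
    (ν := (volume : Measure (E d)).withDensity fun ω => ENNReal.ofReal (ell1Density μ ω))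
    (measurable_expChar_comp hZ) hr (by simpa [norm_expChar] using hr.comp_snd _)
  simp only [expChar_mul_conj, integral_withDensity_expChar ha hμ, Complex.ofReal_re] at h
  rw [kernelForm_toLp]
  refine ⟨?_, h.2⟩
  refine Eq.trans (lintegral_withDensity_eq_lintegral_mul volume
    (measurable_ell1Density (d := d) (μ := μ)).ennreal_ofReal ?_).symm h.1
  exact (continuous_integral_mul_expChar hr hZ).measurable.enorm.pow_const 2

theorem kernelForm_pairKernel_nonneg (ha : 0 < a) (hμ : ∀ᵐ t ∂μ, t ∈ Set.Icc a b)
    (hZ : Measurable Z) (r : Lp ℝ 2 P) :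
    0 ≤ kernelForm ((memLp_pairKernel (P := P) ha hμ hZ).toLp _) r r :=
  (lintegral_enorm_sq_mul_ell1Density ha hμ hZ r).2

/-- The form is an energy with a strictly positive weight, so the characteristic function vanishes
almost everywhere, and everywhere by continuity. -/
theorem integral_mul_expChar_eq_zero_of_kernelForm [NeZero μ] (ha : 0 < a)
    (hμ : ∀ᵐ t ∂μ, t ∈ Set.Icc a b) (hZ : Measurable Z) {r : Lp ℝ 2 P}
    (h : kernelForm ((memLp_pairKernel (P := P) ha hμ hZ).toLp _) r r = 0) (ω : E d) :
    ∫ w, (r w : ℂ) * expChar ω (Z w) ∂P = 0 := by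
  have hr : Integrable r P := (Lp.memLp r).integrable one_le_two
  have hc := continuous_integral_mul_expChar hr hZ
  have h1 := (lintegral_enorm_sq_mul_ell1Density ha hμ hZ r).1
  have hm : Measurable fun ω : E d => ENNReal.ofReal (ell1Density μ ω)
      * ‖∫ w, (r w : ℂ) * expChar ω (Z w) ∂P‖ₑ ^ 2 :=
    measurable_ell1Density.ennreal_ofReal.mul (hc.measurable.enorm.pow_const 2)
  rw [h, ENNReal.ofReal_zero, lintegral_eq_zero_iff hm] at h1
  have h2 : (fun ω : E d => ∫ w, (r w : ℂ) * expChar ω (Z w) ∂P) =ᵐ[volume] fun _ => 0 := by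
    filter_upwards [h1] with ω hω
    have hk : ENNReal.ofReal (ell1Density μ ω) ≠ 0 :=
      (ENNReal.ofReal_pos.2 (ell1Density_pos ha hμ ω)).ne'
    simpa [hk] using hω
  exact congrFun ((hc.ae_eq_iff_eq volume continuous_const).1 h2) ω

theorem kernelForm_eq_zero_of_integral_mul_expChar (ha : 0 < a)
    (hμ : ∀ᵐ t ∂μ, t ∈ Set.Icc a b) (hZ : Measurable Z) {r : Lp ℝ 2 P}
    (h : ∀ ω : E d, ∫ w, (r w : ℂ) * expChar ω (Z w) ∂P = 0) :
    kernelForm ((memLp_pairKernel (P := P) ha hμ hZ).toLp _) r r = 0 := by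
  obtain ⟨h1, h2⟩ := lintegral_enorm_sq_mul_ell1Density ha hμ hZ r
  simp only [h, enorm_zero, ne_eq, OfNat.ofNat_ne_zero, not_false_eq_true, zero_pow, mul_zero,
    lintegral_zero] at h1
  exact le_antisymm (ENNReal.ofReal_eq_zero.1 h1.symm) h2

theorem kernelForm_pairKernel_comm (ha : 0 < a) (hμ : ∀ᵐ t ∂μ, t ∈ Set.Icc a b)
    (hZ : Measurable Z) (u v : Lp ℝ 2 P) :
    kernelForm ((memLp_pairKernel (P := P) ha hμ hZ).toLp _) u v
      = kernelForm ((memLp_pairKernel (P := P) ha hμ hZ).toLp _) v u := by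
  rw [kernelForm_toLp, kernelForm_toLp, ← integral_prod_swap]
  refine integral_congr_ae (Eventually.of_forall fun z => ?_)
  simp only [pairKernel, Prod.fst_swap, Prod.snd_swap]
  rw [← laplaceKernel_neg, neg_sub, mul_comm (u z.2)]

/-- The kernel mean as a Fourier integral. -/
theorem integral_laplaceKernel_mul (ha : 0 < a) (hμ : ∀ᵐ t ∂μ, t ∈ Set.Icc a b)
    (hZ : Measurable Z) {r : Ω → ℝ} (hr : Integrable r P) (x : E d) :
    ((∫ w, laplaceKernel μ (x - Z w) * r w ∂P : ℝ) : ℂ)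
      = ∫ ω, (ell1Density μ ω : ℂ) * (expChar ω (-x) * ∫ w, (r w : ℂ) * expChar ω (Z w) ∂P) := by
  have := isFiniteMeasure_withDensity_ell1Density (d := d) ha hμ
  set ν := (volume : Measure (E d)).withDensity fun ω => ENNReal.ofReal (ell1Density μ ω) with hν
  rw [← integral_withDensity_ofReal measurable_ell1Density (ell1Density_nonneg ha hμ), ← hν]
  have hi : Integrable (fun p : E d × Ω => (r p.2 : ℂ) * expChar p.1 (Z p.2 - x)) (ν.prod P) := by
    refine ((hr.comp_snd ν).ofReal (𝕜 := ℂ)).mul_bdd (c := 1) ?_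
      (Eventually.of_forall fun _ => (norm_expChar _ _).le)
    exact (measurable_expChar_comp (hZ.sub_const x)).aestronglyMeasurable
  have h1 := integral_integral_swap
    (f := fun (ω : E d) (w : Ω) => (r w : ℂ) * expChar ω (Z w - x)) hi
  rw [← integral_complex_ofReal]
  refine Eq.trans ?_ (h1.symm.trans ?_)
  · refine integral_congr_ae (Eventually.of_forall fun w => ?_)
    simp only
    rw [integral_const_mul, integral_withDensity_expChar ha hμ, ← laplaceKernel_neg, neg_sub]
    push_cast
    ring
  · refine integral_congr_ae (Eventually.of_forall fun ω => ?_)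
    simp only
    rw [← integral_const_mul]
    refine integral_congr_ae (Eventually.of_forall fun w => ?_)
    simp only
    rw [← expChar_mul_conj, conj_expChar]
    ring

theorem integral_laplaceKernel_mul_eq_zero (ha : 0 < a) (hμ : ∀ᵐ t ∂μ, t ∈ Set.Icc a b)
    (hZ : Measurable Z) {r : Ω → ℝ} (hr : Integrable r P)
    (h : ∀ ω : E d, ∫ w, (r w : ℂ) * expChar ω (Z w) ∂P = 0) (x : E d) :
    ∫ w, laplaceKernel μ (x - Z w) * r w ∂P = 0 := by
  have := integral_laplaceKernel_mul ha hμ hZ hr x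
  simp only [h, mul_zero, integral_zero] at this
  exact_mod_cast this

end Kernel

/-! ### Dependence of the kernel on `β`, and its one-sided derivative. -/

section Hadamard

variable {d : ℕ} {Ω : Type*} [MeasurableSpace Ω] {P : Measure Ω} [IsProbabilityMeasure P]
  {μ : Measure ℝ} [IsFiniteMeasure μ] {a b : ℝ} {X : Ω → E d}

theorem hadamard_apply (β x : E d) (j : Fin d) : hadamard β x j = β j * x j := rfl

theorem continuous_hadamard : Continuous fun p : E d × E d => hadamard p.1 p.2 := by
  unfold hadamard
  fun_prop

theorem measurable_hadamard_comp (hX : Measurable X) (β : E d) :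
    Measurable fun w => hadamard β (X w) :=
  (continuous_hadamard.comp (Continuous.prodMk_right β)).measurable.comp hX

/-- The kernel `(w, w') ↦ ψ(‖β ∘ X(w) - β ∘ X(w')‖₁)` as an element of `L²`. -/
noncomputable def gramLp (P : Measure Ω) [IsProbabilityMeasure P] (ha : 0 < a)
    (hμ : ∀ᵐ t ∂μ, t ∈ Set.Icc a b) (hX : Measurable X) (β : E d) : Lp ℝ 2 (P.prod P) :=
  (memLp_pairKernel (P := P) ha hμ (measurable_hadamard_comp hX β)).toLp _

theorem continuous_pairKernel_hadamard (ha : 0 < a) (hμ : ∀ᵐ t ∂μ, t ∈ Set.Icc a b) (z : Ω × Ω) :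
    Continuous fun β : E d => pairKernel μ (fun w => hadamard β (X w)) z := by
  have h1 := continuous_laplaceKernel (d := d) ha hμ
  have h2 := continuous_hadamard (d := d)
  unfold pairKernel
  fun_prop

theorem continuous_gramLp (ha : 0 < a) (hμ : ∀ᵐ t ∂μ, t ∈ Set.Icc a b) (hX : Measurable X) :
    Continuous fun β : E d => gramLp P ha hμ hX β := by
  rw [continuous_iff_continuousAt]
  intro β
  refine tendsto_toLp_of_dominated (g := fun _ => μ.real Set.univ + μ.real Set.univ)
    (fun β' => memLp_pairKernel ha hμ (measurable_hadamard_comp hX β')) _ (memLp_const _)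
    (Eventually.of_forall fun β' z => ?_)
    (fun z => (continuous_pairKernel_hadamard ha hμ z).tendsto β)
  exact (abs_sub _ _).trans (add_le_add (abs_laplaceKernel_le ha hμ _)
    (abs_laplaceKernel_le ha hμ _))

/-- The kernel `(w, w') ↦ |X_i(w) - X_i(w')| ψ(‖β ∘ X(w) - β ∘ X(w')‖₁)`. -/
noncomputable def slopeKernel (μ : Measure ℝ) (X : Ω → E d) (i : Fin d) (β : E d) (z : Ω × Ω) : ℝ :=
  |X z.1 i - X z.2 i| * pairKernel μ (fun w => hadamard β (X w)) z

theorem measurable_coord (hX : Measurable X) (i : Fin d) : Measurable fun w => X w i :=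
  (by fun_prop : Measurable fun x : E d => x i).comp hX

theorem memLp_coord (hX2 : MemLp X 2 P) (i : Fin d) : MemLp (fun w => X w i) 2 P := by
  refine hX2.mono ?_ (Eventually.of_forall fun w => PiLp.norm_apply_le (X w) i)
  exact (by fun_prop : Continuous fun x : E d => x i).comp_aestronglyMeasurable hX2.1

theorem memLp_coord_diff (hX2 : MemLp X 2 P) (i : Fin d) :
    MemLp (fun z : Ω × Ω => |X z.1 i - X z.2 i|) 2 (P.prod P) :=
  (((memLp_coord hX2 i).comp_fst P).sub ((memLp_coord hX2 i).comp_snd P)).norm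

theorem abs_slopeKernel_le (ha : 0 < a) (hμ : ∀ᵐ t ∂μ, t ∈ Set.Icc a b) (i : Fin d) (β : E d)
    (z : Ω × Ω) : |slopeKernel μ X i β z| ≤ μ.real Set.univ * |X z.1 i - X z.2 i| := by
  rw [slopeKernel, abs_mul, abs_abs, mul_comm]
  exact mul_le_mul_of_nonneg_right (abs_laplaceKernel_le ha hμ _) (abs_nonneg _)

theorem memLp_slopeKernel (ha : 0 < a) (hμ : ∀ᵐ t ∂μ, t ∈ Set.Icc a b) (hX : Measurable X)
    (hX2 : MemLp X 2 P) (i : Fin d) (β : E d) : MemLp (slopeKernel μ X i β) 2 (P.prod P) := by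
  refine ((memLp_coord_diff hX2 i).const_mul (μ.real Set.univ)).mono' ?_
    (Eventually.of_forall fun z => abs_slopeKernel_le ha hμ i β z)
  exact (memLp_coord_diff hX2 i).1.mul
    (measurable_pairKernel ha hμ (measurable_hadamard_comp hX β)).aestronglyMeasurable

/-- The slope kernel as an element of `L²`. -/
noncomputable def slopeLp (ha : 0 < a) (hμ : ∀ᵐ t ∂μ, t ∈ Set.Icc a b) (hX : Measurable X)
    (hX2 : MemLp X 2 P) (i : Fin d) (β : E d) : Lp ℝ 2 (P.prod P) :=
  (memLp_slopeKernel (P := P) ha hμ hX hX2 i β).toLp _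

theorem continuous_slopeLp (ha : 0 < a) (hμ : ∀ᵐ t ∂μ, t ∈ Set.Icc a b) (hX : Measurable X)
    (hX2 : MemLp X 2 P) (i : Fin d) : Continuous fun β : E d => slopeLp ha hμ hX hX2 i β := by
  rw [continuous_iff_continuousAt]
  intro β
  refine tendsto_toLp_of_dominated
    (fun β' => memLp_slopeKernel ha hμ hX hX2 i β') _
    (((memLp_coord_diff hX2 i).const_mul (μ.real Set.univ)).add
      ((memLp_coord_diff hX2 i).const_mul (μ.real Set.univ)))
    (Eventually.of_forall fun β' z => ?_)
    (fun z => ((continuous_pairKernel_hadamard ha hμ z).tendsto β).const_mul _)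
  exact (abs_sub _ _).trans (add_le_add (abs_slopeKernel_le ha hμ _ _ _)
    (abs_slopeKernel_le ha hμ _ _ _))

/-- The measure `t μ(dt)`. -/
noncomputable def tilt (μ : Measure ℝ) : Measure ℝ := μ.withDensity ENNReal.ofReal

theorem ae_tilt (hμ : ∀ᵐ t ∂μ, t ∈ Set.Icc a b) : ∀ᵐ t ∂(tilt μ), t ∈ Set.Icc a b :=
  (withDensity_absolutelyContinuous _ _).ae_le hμ

theorem integrable_id_of_Icc (hμ : ∀ᵐ t ∂μ, t ∈ Set.Icc a b) : Integrable (fun t : ℝ => t) μ := by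
  refine Integrable.of_bound (C := max |a| |b|) measurable_id.aestronglyMeasurable ?_
  filter_upwards [hμ] with t ht
  exact abs_le_max_abs_abs ht.1 ht.2

theorem isFiniteMeasure_tilt (hμ : ∀ᵐ t ∂μ, t ∈ Set.Icc a b) : IsFiniteMeasure (tilt μ) :=
  isFiniteMeasure_withDensity_ofReal (integrable_id_of_Icc hμ).2

theorem neZero_tilt [NeZero μ] (ha : 0 < a) (hμ : ∀ᵐ t ∂μ, t ∈ Set.Icc a b) :
    NeZero (tilt μ) := by
  refine ⟨fun h => ?_⟩
  rw [tilt, withDensity_eq_zero_iff ENNReal.measurable_ofReal.aemeasurable] at h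
  obtain ⟨t, ht, h'⟩ := (hμ.and h).exists
  simp only [Pi.zero_apply, ENNReal.ofReal_eq_zero] at h'
  linarith [ht.1]

theorem integral_tilt (ha : 0 < a) (hμ : ∀ᵐ t ∂μ, t ∈ Set.Icc a b) (f : ℝ → ℝ) :
    ∫ t, f t ∂(tilt μ) = ∫ t, t * f t ∂μ := by
  rw [tilt, integral_withDensity_eq_integral_toReal_smul ENNReal.measurable_ofReal (by simp)]
  refine integral_congr_ae (hμ.mono fun t ht => ?_)
  simp [ENNReal.toReal_ofReal (ha.le.trans ht.1)]

/-- Coordinate `i` contributes nothing at `β`, so switching it on changes the distance exactly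
linearly in `s ≥ 0`. For a signed `s` the increment would involve `|s|`, hence the one-sided
derivative. -/
theorem l1norm_hadamard_add_single {β : E d} {i : Fin d} (hβ : β i = 0) {s : ℝ} (hs : 0 ≤ s)
    (x y : E d) :
    l1norm (hadamard (β + s • EuclideanSpace.single i 1) x
        - hadamard (β + s • EuclideanSpace.single i 1) y)
      = l1norm (hadamard β x - hadamard β y) + s * |x i - y i| := by
  have h : ∀ j, |(hadamard (β + s • EuclideanSpace.single i 1) x
        - hadamard (β + s • EuclideanSpace.single i 1) y) j|
      = |(hadamard β x - hadamard β y) j| + if j = i then s * |x i - y i| else 0 := by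
    intro j
    simp only [PiLp.sub_apply, hadamard_apply, PiLp.add_apply, PiLp.smul_apply,
      PiLp.single_apply, smul_eq_mul]
    split_ifs with hj
    · subst hj
      rw [hβ]
      simp only [zero_add, mul_one, zero_mul, sub_self, abs_zero]
      rw [← mul_sub, abs_mul, abs_of_nonneg hs]
    · simp
  simp only [l1norm]
  rw [Finset.sum_congr rfl fun j _ => h j, Finset.sum_add_distrib]
  simp

theorem tendsto_slope_exp (L δ t : ℝ) :
    Tendsto (fun s : ℝ => s⁻¹ * (Real.exp (-t * (L + s * δ)) - Real.exp (-t * L))) (𝓝[>] 0)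
      (𝓝 (-(δ * (t * Real.exp (-t * L))))) := by
  have hd : HasDerivAt (fun s : ℝ => Real.exp (-t * (L + s * δ)))
      (Real.exp (-t * (L + 0 * δ)) * (-t * (1 * δ))) 0 :=
    ((((hasDerivAt_id (0 : ℝ)).mul_const δ).const_add L).const_mul (-t)).exp
  have := hd.tendsto_slope_zero_right
  simp only [zero_add, zero_mul, add_zero, one_mul, smul_eq_mul] at this
  convert this using 2
  ring

theorem abs_slope_exp_le {L δ t b s : ℝ} (hL : 0 ≤ L) (hδ : 0 ≤ δ) (ht : 0 ≤ t) (htb : t ≤ b)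
    (hs : 0 < s) :
    |s⁻¹ * (Real.exp (-t * (L + s * δ)) - Real.exp (-t * L))| ≤ b * δ := by
  have h1 : Real.exp (-t * (L + s * δ)) = Real.exp (-t * L) * Real.exp (-(t * (s * δ))) := by
    rw [← Real.exp_add]
    ring_nf
  have hp : 0 ≤ t * (s * δ) := by positivity
  have h2 : Real.exp (-(t * (s * δ))) ≤ 1 := Real.exp_le_one_iff.2 (by linarith)
  have h3 := Real.add_one_le_exp (-(t * (s * δ)))
  have h4 : Real.exp (-t * L) ≤ 1 := Real.exp_le_one_iff.2 (by nlinarith)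
  have h5 := Real.exp_pos (-t * L)
  rw [h1, ← mul_sub_one, abs_mul, abs_of_pos (inv_pos.2 hs), inv_mul_le_iff₀ hs, abs_mul,
    abs_of_pos h5, abs_of_nonpos (by linarith)]
  calc Real.exp (-t * L) * -(Real.exp (-(t * (s * δ))) - 1) ≤ 1 * (t * (s * δ)) := by
        gcongr
        · linarith
        · linarith
    _ ≤ s * (b * δ) := by nlinarith [mul_nonneg hs.le hδ]

/-- Differentiating under the integral in `t` brings down `-t |X_i - X_i'|`, and the factor `t` is
absorbed into `tilt μ`. Convergence holds in `L²` because the quotients are dominated by a multiple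
of `|X_i - X_i'|`, square integrable by the second moments of `X`. -/
theorem tendsto_slope_gramLp [IsFiniteMeasure (tilt μ)] (ha : 0 < a)
    (hμ : ∀ᵐ t ∂μ, t ∈ Set.Icc a b) (hX : Measurable X) (hX2 : MemLp X 2 P) {β : E d} {i : Fin d}
    (hβ : β i = 0) :
    Tendsto (fun s : ℝ => s⁻¹ • (gramLp P ha hμ hX (β + s • EuclideanSpace.single i 1)
        - gramLp P ha hμ hX β)) (𝓝[>] 0)
      (𝓝 (-slopeLp ha (ae_tilt hμ) hX hX2 i β)) := by
  have hm : ∀ β : E d, MemLp (pairKernel μ fun w => hadamard β (X w)) 2 (P.prod P) :=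
    fun β => memLp_pairKernel ha hμ (measurable_hadamard_comp hX β)
  have hF : ∀ s : ℝ, MemLp (s⁻¹ • ((pairKernel μ fun w =>
      hadamard (β + s • EuclideanSpace.single i 1) (X w))
        - pairKernel μ fun w => hadamard β (X w))) 2 (P.prod P) :=
    fun s => ((hm _).sub (hm β)).const_smul s⁻¹
  have hS := memLp_slopeKernel (P := P) ha (ae_tilt hμ) hX hX2 i β
  have hint : ∀ {z : ℝ}, 0 ≤ z → Integrable (fun t => Real.exp (-t * z)) μ :=
    fun hz => integrable_exp_neg_mul ha hμ hz
  have hpt : ∀ s : ℝ, 0 < s → ∀ z : Ω × Ω, (s⁻¹ • ((pairKernel μ fun w =>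
      hadamard (β + s • EuclideanSpace.single i 1) (X w))
        - pairKernel μ fun w => hadamard β (X w))) z
      = ∫ t, s⁻¹ * (Real.exp (-t * (l1norm (hadamard β (X z.1) - hadamard β (X z.2))
        + s * |X z.1 i - X z.2 i|))
        - Real.exp (-t * l1norm (hadamard β (X z.1) - hadamard β (X z.2)))) ∂μ := by
    intro s hs z
    have hL := l1norm_nonneg (hadamard β (X z.1) - hadamard β (X z.2))
    rw [integral_const_mul, integral_sub (hint (by positivity)) (hint hL)]
    simp only [Pi.smul_apply, Pi.sub_apply, pairKernel, laplaceKernel, smul_eq_mul,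
      l1norm_hadamard_add_single hβ hs.le]
  have hbd : ∀ s : ℝ, 0 < s → ∀ z : Ω × Ω, ∀ᵐ t ∂μ,
      ‖s⁻¹ * (Real.exp (-t * (l1norm (hadamard β (X z.1) - hadamard β (X z.2))
        + s * |X z.1 i - X z.2 i|))
        - Real.exp (-t * l1norm (hadamard β (X z.1) - hadamard β (X z.2))))‖
      ≤ b * |X z.1 i - X z.2 i| := by
    intro s hs z
    filter_upwards [hμ] with t ht
    exact abs_slope_exp_le (l1norm_nonneg _) (abs_nonneg _) (ha.le.trans ht.1) ht.2 hs
  have hlim := tendsto_toLp_of_dominated (l := 𝓝[>] (0 : ℝ)) hF hS.neg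
    (((memLp_coord_diff hX2 i).const_mul (b * μ.real Set.univ)).add
      ((memLp_coord_diff hX2 i).const_mul ((tilt μ).real Set.univ))) (by
      filter_upwards [self_mem_nhdsWithin] with s hs z
      refine (abs_sub _ _).trans (add_le_add ?_ ?_)
      · rw [hpt s hs z]
        refine (norm_integral_le_of_norm_le_const (hbd s hs z)).trans_eq ?_
        ring
      · rw [Pi.neg_apply, abs_neg]
        exact abs_slopeKernel_le ha (ae_tilt hμ) i β z) (by
      intro z
      have h1 : Tendsto (fun s : ℝ => ∫ t,
          s⁻¹ * (Real.exp (-t * (l1norm (hadamard β (X z.1) - hadamard β (X z.2))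
          + s * |X z.1 i - X z.2 i|))
          - Real.exp (-t * l1norm (hadamard β (X z.1) - hadamard β (X z.2)))) ∂μ) (𝓝[>] 0)
          (𝓝 (∫ t, -(|X z.1 i - X z.2 i| * (t * Real.exp (-t *
            l1norm (hadamard β (X z.1) - hadamard β (X z.2))))) ∂μ)) := by
        refine tendsto_integral_filter_of_dominated_convergence
          (fun _ => b * |X z.1 i - X z.2 i|) ?_ ?_ (integrable_const _)
          (Eventually.of_forall fun t => tendsto_slope_exp _ _ t)
        · exact Eventually.of_forall fun s => Continuous.aestronglyMeasurable (by fun_prop)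
        · filter_upwards [self_mem_nhdsWithin] with s hs
          exact hbd s hs z
      have h2 : ∫ t, -(|X z.1 i - X z.2 i| * (t * Real.exp (-t *
            l1norm (hadamard β (X z.1) - hadamard β (X z.2))))) ∂μ
          = (-slopeKernel (tilt μ) X i β) z := by
        rw [integral_neg, integral_const_mul, ← integral_tilt ha hμ]
        rfl
      rw [h2] at h1
      refine h1.congr' ?_
      filter_upwards [self_mem_nhdsWithin] with s hs
      rw [hpt s hs z])
  rw [slopeLp, ← MemLp.toLp_neg]
  refine hlim.congr fun s => ?_
  rw [MemLp.toLp_const_smul _ ((hm _).sub (hm β)), MemLp.toLp_sub]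
  rfl

end Hadamard

/-! ### The RKHS problem and its optimal value. -/

section Objective

variable {d : ℕ} {Ω : Type*} [MeasurableSpace Ω] {P : Measure Ω} [IsProbabilityMeasure P]
  {μ : Measure ℝ} [IsFiniteMeasure μ] {a b : ℝ} {Z : Ω → E d}

theorem fourierInv_eq_integral_expChar (g : E d → ℂ) (x : E d) :
    𝓕⁻ g x = ∫ ω, expChar ω (-x) * g ω := by
  rw [Real.fourierInv_eq']
  refine integral_congr_ae (Eventually.of_forall fun ω => ?_)
  simp only [expChar, smul_eq_mul, inner_neg_right]
  congr 3
  push_cast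
  ring

/-- The `L²` Fourier transform of a member of the RKHS. -/
noncomputable def RKHS.hat {k : E d → ℝ} (f : RKHS k) : Lp ℂ 2 (volume : Measure (E d)) :=
  𝓕 (f.memLp_toFun.toLp (fun x => (f.toFun x : ℂ)))

theorem enorm_sq_div_ofReal {k : ℝ} (hk : 0 < k) (z : ℂ) :
    ‖z‖ₑ ^ 2 / ENNReal.ofReal k = ENNReal.ofReal (‖z‖ ^ 2 / k) := by
  rw [ENNReal.ofReal_div_of_pos hk, ENNReal.ofReal_pow (norm_nonneg _), ofReal_norm]

theorem RKHS.integrable_energy {k : E d → ℝ} (hk : ∀ ω, 0 < k ω) (hkm : Measurable k)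
    (f : RKHS k) : Integrable (fun ω => ‖f.hat ω‖ ^ 2 / k ω) := by
  have h := f.energy_lt_top
  simp only [fun ω => enorm_sq_div_ofReal (hk ω)] at h
  refine ⟨?_, ?_⟩
  · exact ((Lp.stronglyMeasurable f.hat).measurable.norm.pow_const 2 |>.div hkm).aestronglyMeasurable
  · rw [hasFiniteIntegral_iff_ofReal (Eventually.of_forall fun ω => by
      have := hk ω
      positivity)]
    exact h

theorem RKHS.normSq_eq_integral {k : E d → ℝ} (hk : ∀ ω, 0 < k ω) (hkm : Measurable k)
    (f : RKHS k) : f.normSq = ∫ ω, ‖f.hat ω‖ ^ 2 / k ω := by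
  rw [integral_eq_lintegral_of_nonneg_ae (Eventually.of_forall fun ω => by
      have := hk ω
      positivity) (f.integrable_energy hk hkm).1]
  simp only [← fun ω => enorm_sq_div_ofReal (hk ω)]
  rfl

/-- The pointwise bound `2|f̂| ≤ |f̂|² / k + k` has integrable right side. -/
theorem RKHS.integrable_hat {k : E d → ℝ} (hk : ∀ ω, 0 < k ω) (hkm : Measurable k)
    (hki : Integrable k) (f : RKHS k) : Integrable f.hat := by
  refine ((f.integrable_energy hk hkm).add hki).mono' (Lp.aestronglyMeasurable _)
    (Eventually.of_forall fun ω => ?_)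
  have h1 := hk ω
  have h2 := two_mul_le_add_sq (‖f.hat ω‖ / Real.sqrt (k ω)) (Real.sqrt (k ω))
  have h3 : ‖f.hat ω‖ / Real.sqrt (k ω) * Real.sqrt (k ω) = ‖f.hat ω‖ :=
    div_mul_cancel₀ _ (Real.sqrt_pos.2 h1).ne'
  rw [mul_assoc, h3, div_pow, Real.sq_sqrt h1.le] at h2
  simp only [Pi.add_apply]
  linarith [norm_nonneg (f.hat ω)]

/-- `L²` inversion gives the formula almost everywhere. Both sides are continuous and Lebesgue
measure charges open sets, so it holds at every point; this matters because the law of `β ∘ X` may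
be singular. -/
theorem RKHS.apply_eq_integral {k : E d → ℝ} (hk : ∀ ω, 0 < k ω) (hkm : Measurable k)
    (hki : Integrable k) (f : RKHS k) (x : E d) :
    (f.toFun x : ℂ) = ∫ ω, expChar ω (-x) * f.hat ω := by
  have hi := f.integrable_hat hk hkm hki
  have h1 := coeFn_fourierInv_toLp hi (Lp.memLp f.hat)
  rw [Lp.toLp_coeFn, RKHS.hat, FourierTransform.fourierInv_fourier_eq] at h1
  have h2 := f.memLp_toFun.coeFn_toLp.symm.trans h1
  have h3 := ((Complex.continuous_ofReal.comp f.continuous_toFun).ae_eq_iff_eq volume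
    (continuous_fourierInv_of_integrable hi)).1 h2
  rw [← fourierInv_eq_integral_expChar]
  exact congrFun h3 x

theorem RKHS.abs_apply_le {k : E d → ℝ} (hk : ∀ ω, 0 < k ω) (hkm : Measurable k)
    (hki : Integrable k) (f : RKHS k) (x : E d) : |f.toFun x| ≤ ∫ ω, ‖f.hat ω‖ := by
  have h := norm_integral_le_integral_norm (μ := volume) (fun ω => expChar ω (-x) * f.hat ω)
  rw [← f.apply_eq_integral hk hkm hki] at h
  simpa [norm_expChar] using h

theorem RKHS.memLp_comp {k : E d → ℝ} (hk : ∀ ω, 0 < k ω) (hkm : Measurable k)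
    (hki : Integrable k) (f : RKHS k) (hZ : Measurable Z) :
    MemLp (fun w => f.toFun (Z w)) 2 P :=
  MemLp.of_bound (f.continuous_toFun.measurable.comp hZ).aestronglyMeasurable _
    (Eventually.of_forall fun _ => f.abs_apply_le hk hkm hki _)

/-- Pairing with a function of `Z` in the RKHS, on the Fourier side. -/
theorem RKHS.integral_mul_comp {k : E d → ℝ} (hk : ∀ ω, 0 < k ω) (hkm : Measurable k)
    (hki : Integrable k) (f : RKHS k) (hZ : Measurable Z) {r : Ω → ℝ} (hr : Integrable r P) :
    ((∫ w, r w * f.toFun (Z w) ∂P : ℝ) : ℂ)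
      = ∫ ω, f.hat ω * (starRingEnd ℂ) (∫ w, (r w : ℂ) * expChar ω (Z w) ∂P) := by
  have hi : Integrable (fun p : Ω × E d => ((r p.1 : ℂ) * f.hat p.2) * expChar p.2 (-Z p.1))
      (P.prod volume) := by
    refine ((hr.ofReal (𝕜 := ℂ)).mul_prod (f.integrable_hat hk hkm hki)).mul_bdd (c := 1) ?_
      (Eventually.of_forall fun _ => (norm_expChar _ _).le)
    exact ((measurable_expChar_comp hZ.neg).comp measurable_swap).aestronglyMeasurable
  have h1 := integral_integral_swap
    (f := fun (w : Ω) (ω : E d) => ((r w : ℂ) * f.hat ω) * expChar ω (-Z w)) hi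
  rw [← integral_complex_ofReal]
  refine Eq.trans ?_ (h1.trans ?_)
  · refine integral_congr_ae (Eventually.of_forall fun w => ?_)
    simp only
    rw [Complex.ofReal_mul, f.apply_eq_integral hk hkm hki, ← integral_const_mul]
    refine integral_congr_ae (Eventually.of_forall fun ω => ?_)
    simp only
    ring
  · refine integral_congr_ae (Eventually.of_forall fun ω => ?_)
    simp only
    rw [← integral_conj, ← integral_const_mul]
    refine integral_congr_ae (Eventually.of_forall fun w => ?_)
    simp only
    rw [map_mul, Complex.conj_ofReal, conj_expChar]
    ring

theorem integrable_ell1Density_mul_norm_sq (ha : 0 < a) (hμ : ∀ᵐ t ∂μ, t ∈ Set.Icc a b)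
    (hZ : Measurable Z) {r : Ω → ℝ} (hr : Integrable r P) :
    Integrable fun ω : E d => ell1Density μ ω * ‖∫ w, (r w : ℂ) * expChar ω (Z w) ∂P‖ ^ 2 := by
  refine (integrable_ell1Density ha hμ).mul_bdd (c := (∫ w, ‖r w‖ ∂P) ^ 2) ?_
    (Eventually.of_forall fun ω => ?_)
  · exact ((continuous_integral_mul_expChar hr hZ).norm.pow 2).aestronglyMeasurable
  · rw [norm_pow, norm_norm]
    exact pow_le_pow_left₀ (norm_nonneg _) (norm_integral_mul_expChar_le ω) 2

theorem integral_ell1Density_mul_norm_sq (ha : 0 < a) (hμ : ∀ᵐ t ∂μ, t ∈ Set.Icc a b)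
    (hZ : Measurable Z) (r : Lp ℝ 2 P) :
    ∫ ω : E d, ell1Density μ ω * ‖∫ w, (r w : ℂ) * expChar ω (Z w) ∂P‖ ^ 2
      = kernelForm ((memLp_pairKernel (P := P) ha hμ hZ).toLp _) r r := by
  have hr : Integrable r P := (Lp.memLp r).integrable one_le_two
  obtain ⟨h1, h2⟩ := lintegral_enorm_sq_mul_ell1Density ha hμ hZ r
  rw [integral_eq_lintegral_of_nonneg_ae (Eventually.of_forall fun ω => by
      have := ell1Density_nonneg (d := d) ha hμ ω
      positivity) (integrable_ell1Density_mul_norm_sq ha hμ hZ hr).1,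
    ← ENNReal.toReal_ofReal h2, ← h1]
  congr 1
  refine lintegral_congr fun ω => ?_
  rw [ENNReal.ofReal_mul (ell1Density_nonneg ha hμ ω), ENNReal.ofReal_pow (norm_nonneg _),
    ofReal_norm]

/-- The dual half of the minimisation. On the Fourier side it is the pointwise inequality `2gc ≤ λ
g² / k + λ⁻¹ k c²`, whose defect is a perfect square. -/
theorem two_mul_integral_mul_comp_le [NeZero μ] (ha : 0 < a) (hμ : ∀ᵐ t ∂μ, t ∈ Set.Icc a b)
    (hZ : Measurable Z) (r : Lp ℝ 2 P) (f : RKHS (ell1Density (d := d) μ)) {lam : ℝ}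
    (hlam : 0 < lam) :
    2 * ∫ w, r w * f.toFun (Z w) ∂P ≤ lam * f.normSq
      + lam⁻¹ * kernelForm ((memLp_pairKernel (P := P) ha hμ hZ).toLp _) r r := by
  have hr : Integrable r P := (Lp.memLp r).integrable one_le_two
  have hk := ell1Density_pos (d := d) ha hμ
  have hkm := measurable_ell1Density (d := d) (μ := μ)
  have hki := integrable_ell1Density (d := d) ha hμ
  have h1 := f.integral_mul_comp hk hkm hki hZ hr
  rw [← integral_ell1Density_mul_norm_sq ha hμ hZ, f.normSq_eq_integral hk hkm,
    ← integral_const_mul lam, ← integral_const_mul lam⁻¹, ← integral_add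
      ((f.integrable_energy hk hkm).const_mul _)
      ((integrable_ell1Density_mul_norm_sq ha hμ hZ hr).const_mul _)]
  have h2 : 2 * ∫ w, r w * f.toFun (Z w) ∂P ≤
      ∫ ω, 2 * ‖f.hat ω * (starRingEnd ℂ) (∫ w, (r w : ℂ) * expChar ω (Z w) ∂P)‖ := by
    rw [integral_const_mul]
    refine mul_le_mul_of_nonneg_left ?_ two_pos.le
    refine le_trans ?_ (norm_integral_le_integral_norm _)
    rw [← h1, Complex.norm_real]
    exact le_abs_self _
  refine h2.trans (integral_mono_of_nonneg (Eventually.of_forall fun ω => by positivity)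
    (((f.integrable_energy hk hkm).const_mul _).add
      ((integrable_ell1Density_mul_norm_sq ha hμ hZ hr).const_mul _))
    (Eventually.of_forall fun ω => ?_))
  simp only [norm_mul, RCLike.norm_conj]
  set c := ‖∫ w, (r w : ℂ) * expChar ω (Z w) ∂P‖
  set g := ‖f.hat ω‖
  have hkω := hk ω
  have e1 : lam * (g ^ 2 / ell1Density μ ω) + lam⁻¹ * (ell1Density μ ω * c ^ 2) - 2 * (g * c)
      = (lam * g - ell1Density μ ω * c) ^ 2 / (lam * ell1Density μ ω) := by
    field_simp
    ring
  have e2 : 0 ≤ (lam * g - ell1Density μ ω * c) ^ 2 / (lam * ell1Density μ ω) := by positivity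
  linarith

variable [NeZero μ]

/-- The kernel mean of `r`, divided by `lam`, as a member of the RKHS. -/
theorem exists_rkhs_of_residual (ha : 0 < a) (hμ : ∀ᵐ t ∂μ, t ∈ Set.Icc a b)
    (hZ : Measurable Z) (r : Lp ℝ 2 P) (lam : ℝ) :
    ∃ f : RKHS (ell1Density (d := d) μ),
      (∀ x, f.toFun x = lam⁻¹ * ∫ w, laplaceKernel μ (x - Z w) * r w ∂P) ∧
      f.normSq = (lam⁻¹) ^ 2 * kernelForm ((memLp_pairKernel (P := P) ha hμ hZ).toLp _) r r := by
  have hr : Integrable r P := (Lp.memLp r).integrable one_le_two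
  have hk := ell1Density_pos (d := d) ha hμ
  have hkm := measurable_ell1Density (d := d) (μ := μ)
  have hki := integrable_ell1Density (d := d) ha hμ
  have hc := continuous_integral_mul_expChar hr hZ
  set c : E d → ℂ := fun ω => ∫ w, (r w : ℂ) * expChar ω (Z w) ∂P with hcdef
  -- The candidate Fourier transform of `F`. Its factor `k` cancels the weight `1 / k` of the norm
  -- and leaves the kernel energy.
  set g : E d → ℂ := fun ω => (ell1Density μ ω : ℂ) * ((lam⁻¹ : ℝ) * c ω) with hg
  set F : E d → ℝ := fun x => lam⁻¹ * ∫ w, laplaceKernel μ (x - Z w) * r w ∂P with hF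
  have hgi : Integrable g := by
    refine (hki.ofReal (𝕜 := ℂ)).mul_bdd (c := |lam⁻¹| * ∫ w, ‖r w‖ ∂P)
      (continuous_const.mul hc).aestronglyMeasurable (Eventually.of_forall fun ω => ?_)
    rw [norm_mul, Complex.norm_real, Real.norm_eq_abs]
    exact mul_le_mul_of_nonneg_left (norm_integral_mul_expChar_le ω) (abs_nonneg _)
  have hgsq : ∀ ω, ‖g ω‖ ^ 2 = ell1Density μ ω * ((lam⁻¹) ^ 2 * (ell1Density μ ω * ‖c ω‖ ^ 2)) := by
    intro ω
    rw [hg]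
    simp only [norm_mul, Complex.norm_real, Real.norm_eq_abs, mul_pow, sq_abs]
    ring
  have hEi := (integrable_ell1Density_mul_norm_sq ha hμ hZ hr).const_mul ((lam⁻¹) ^ 2)
  have hg2 : MemLp g 2 := by
    rw [memLp_two_iff_integrable_sq_norm hgi.1]
    simp only [hgsq]
    refine hEi.bdd_mul (c := (2 / a) ^ d * μ.real Set.univ) hkm.aestronglyMeasurable
      (Eventually.of_forall fun ω => ?_)
    rw [Real.norm_eq_abs, abs_of_pos (hk ω)]
    exact ell1Density_le ha hμ ω
  have hFg : ∀ x, (F x : ℂ) = 𝓕⁻ g x := by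
    intro x
    rw [fourierInv_eq_integral_expChar, hF]
    simp only
    rw [Complex.ofReal_mul, integral_laplaceKernel_mul ha hμ hZ hr, ← integral_const_mul]
    refine integral_congr_ae (Eventually.of_forall fun ω => ?_)
    simp only [hg, hcdef]
    ring
  have hFg' : (fun x => (F x : ℂ)) = 𝓕⁻ g := funext hFg
  have hFc : Continuous F := by
    have h1 : Continuous fun x => (F x : ℂ) := hFg' ▸ continuous_fourierInv_of_integrable hgi
    exact Complex.continuous_re.comp h1
  have hae := coeFn_fourierInv_toLp hgi hg2
  have hF2 : MemLp (fun x => (F x : ℂ)) 2 (volume : Measure (E d)) := by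
    rw [hFg']
    exact (memLp_congr_ae hae).1 (Lp.memLp _)
  have hhat : (𝓕 (hF2.toLp (fun x => (F x : ℂ))) : Lp ℂ 2 (volume : Measure (E d)))
      = hg2.toLp g := by
    have : hF2.toLp (fun x => (F x : ℂ)) = 𝓕⁻ (hg2.toLp g) := by
      refine Lp.ext ?_
      refine hF2.coeFn_toLp.trans ?_
      rw [hFg']
      exact hae.symm
    rw [this, FourierTransform.fourier_fourierInv_eq]
  have hen : ∫⁻ ω, ‖(𝓕 (hF2.toLp (fun x => (F x : ℂ))) : Lp ℂ 2 (volume : Measure (E d))) ω‖ₑ ^ 2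
      / ENNReal.ofReal (ell1Density μ ω)
      = ENNReal.ofReal ((lam⁻¹) ^ 2 *
        kernelForm ((memLp_pairKernel (P := P) ha hμ hZ).toLp _) r r) := by
    rw [hhat, ← integral_ell1Density_mul_norm_sq ha hμ hZ, ← integral_const_mul,
      ofReal_integral_eq_lintegral_ofReal hEi (Eventually.of_forall fun ω => by
        have := hk ω
        positivity)]
    refine lintegral_congr_ae ?_
    filter_upwards [hg2.coeFn_toLp] with ω hω
    rw [hω, enorm_sq_div_ofReal (hk ω), hgsq, mul_div_cancel_left₀ _ (hk ω).ne']
  refine ⟨⟨F, hFc, hF2, by rw [hen]; exact ENNReal.ofReal_lt_top⟩, fun x => rfl, ?_⟩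
  rw [RKHS.normSq]
  simp only
  rw [hen, ENNReal.toReal_ofReal]
  exact mul_nonneg (sq_nonneg _) (kernelForm_pairKernel_nonneg ha hμ hZ r)

theorem inner_comp_eq_kernelForm (ha : 0 < a) (hμ : ∀ᵐ t ∂μ, t ∈ Set.Icc a b)
    (hZ : Measurable Z) (r h : Lp ℝ 2 P) :
    ∫ w, (∫ w', laplaceKernel μ (Z w - Z w') * r w' ∂P) * h w ∂P
      = kernelForm ((memLp_pairKernel (P := P) ha hμ hZ).toLp _) r h := by
  rw [kernelForm_pairKernel_comm ha hμ hZ, kernelForm_toLp, integral_prod]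
  · refine integral_congr_ae (Eventually.of_forall fun w => ?_)
    simp only
    rw [← integral_mul_const]
    refine integral_congr_ae (Eventually.of_forall fun w' => ?_)
    simp only [pairKernel]
    ring
  · exact (memLp_pairKernel ha hμ hZ).integrable_mul (memLp_mul_prod (Lp.memLp h) (Lp.memLp r))

theorem integral_sq_eq_norm_sq (u : Lp ℝ 2 P) : ∫ w, u w ^ 2 ∂P = ‖u‖ ^ 2 := by
  rw [← real_inner_self_eq_norm_sq, L2.inner_def]
  refine integral_congr_ae (Eventually.of_forall fun w => ?_)
  simp [pow_two]

/-- The optimal value is the pairing of the response with the residual. -/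
theorem objective_eq_inner (ha : 0 < a) (hμ : ∀ᵐ t ∂μ, t ∈ Set.Icc a b) {X : Ω → E d}
    (hX : Measurable X) {Y : Ω → ℝ} (hY2 : MemLp Y 2 P) {β : E d} {lam : ℝ} (hlam : 0 < lam)
    {r : Lp ℝ 2 P} (hr : IsRidgeResidual (gramLp P ha hμ hX β) lam (hY2.toLp Y) r) :
    objective P X Y μ β lam = inner ℝ (hY2.toLp Y) r := by
  have hZ := measurable_hadamard_comp hX β
  have hk := ell1Density_pos (d := d) ha hμ
  have hkm := measurable_ell1Density (d := d) (μ := μ)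
  have hki := integrable_ell1Density (d := d) ha hμ
  have hloss : ∀ f : RKHS (ell1Density (d := d) μ),
      ∫ w, (Y w - f.toFun (hadamard β (X w))) ^ 2 ∂P
        = ‖hY2.toLp Y - (f.memLp_comp hk hkm hki hZ).toLp _‖ ^ 2 := by
    intro f
    rw [← integral_sq_eq_norm_sq]
    refine integral_congr_ae ?_
    filter_upwards [Lp.coeFn_sub (hY2.toLp Y) ((f.memLp_comp hk hkm hki hZ).toLp _),
      hY2.coeFn_toLp, (f.memLp_comp hk hkm hki hZ).coeFn_toLp] with w h1 h2 h3
    rw [h1, Pi.sub_apply, h2, h3]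
  have hself := hr r
  refine le_antisymm ?_ (le_ciInf fun f => ?_)
  · obtain ⟨f, hf, hfn⟩ := exists_rkhs_of_residual (P := P) ha hμ hZ r lam
    refine (ciInf_le ⟨0, ?_⟩ f).trans_eq ?_
    · rintro _ ⟨f, rfl⟩
      exact add_nonneg (integral_nonneg fun _ => sq_nonneg _)
        (mul_nonneg hlam.le ENNReal.toReal_nonneg)
    -- For the kernel mean of `r` divided by `λ`, the ridge equation says precisely that the
    -- regression residual is `r`, so its loss equals the claimed value.
    · have hu : hY2.toLp Y - (f.memLp_comp hk hkm hki hZ).toLp _ = r := by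
        refine ext_inner_right ℝ fun h => ?_
        rw [inner_sub_left, ← hr h, sub_eq_iff_eq_add]
        congr 1
        rw [gramLp, ← inner_comp_eq_kernelForm ha hμ hZ, L2.inner_def, ← integral_const_mul]
        refine integral_congr_ae ?_
        filter_upwards [(f.memLp_comp (P := P) hk hkm hki hZ).coeFn_toLp] with w hw
        rw [hw, hf]
        simp
        ring
      rw [ridgeLoss, hloss, hu, hfn, ← hself, real_inner_self_eq_norm_sq, gramLp]
      field_simp
  -- For arbitrary `f`, expand `‖y - u - r‖² ≥ 0` with `u = f(β ∘ X)`, bound `2⟨u, r⟩` by the dual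
  -- inequality, and insert the ridge equation tested at `r`.
  · rw [ridgeLoss, hloss]
    set u := (f.memLp_comp (P := P) hk hkm hki hZ).toLp _ with hu
    have h1 := two_mul_integral_mul_comp_le (P := P) ha hμ hZ r f hlam
    have h2 : ∫ w, r w * f.toFun (hadamard β (X w)) ∂P = inner ℝ u r := by
      rw [L2.inner_def]
      refine integral_congr_ae ?_
      filter_upwards [(f.memLp_comp (P := P) hk hkm hki hZ).coeFn_toLp] with w hw
      rw [hw]
      simp
    rw [h2] at h1
    have h3 := norm_sub_sq_real (hY2.toLp Y - u) r
    have h4 : 0 ≤ ‖hY2.toLp Y - u - r‖ ^ 2 := sq_nonneg _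
    rw [inner_sub_left] at h3
    rw [real_inner_self_eq_norm_sq, gramLp] at hself
    linarith

end Objective

/-! ### One-dimensional characters and the weight `1 / (2π²ζ²)`. -/

section LineFeature

/-- The one-dimensional character `x ↦ e^{-2πiζx}`. -/
noncomputable def lineChar (ζ x : ℝ) : ℂ :=
  Complex.exp (((-2 * Real.pi * ζ * x : ℝ) : ℂ) * Complex.I)

theorem norm_lineChar (ζ x : ℝ) : ‖lineChar ζ x‖ = 1 := Complex.norm_exp_ofReal_mul_I _

theorem continuous_lineChar : Continuous fun p : ℝ × ℝ => lineChar p.1 p.2 := by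
  unfold lineChar; fun_prop

theorem measurable_lineChar {A : Type*} [MeasurableSpace A] {f g : A → ℝ} (hf : Measurable f)
    (hg : Measurable g) : Measurable fun p => lineChar (f p) (g p) := by
  unfold lineChar; fun_prop

theorem measurable_expChar {d : ℕ} {A : Type*} [MeasurableSpace A] {f g : A → E d}
    (hf : Measurable f) (hg : Measurable g) : Measurable fun p => expChar (f p) (g p) := by
  have := hf.inner (𝕜 := ℝ) hg
  unfold expChar; fun_prop

theorem lineChar_re (ζ x : ℝ) : (lineChar ζ x).re = Real.cos (2 * Real.pi * ζ * x) := by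
  rw [lineChar, Complex.exp_ofReal_mul_I_re, ← Real.cos_neg]
  ring_nf

theorem lineChar_im (ζ x : ℝ) : (lineChar ζ x).im = -Real.sin (2 * Real.pi * ζ * x) := by
  rw [lineChar, Complex.exp_ofReal_mul_I_im, ← Real.sin_neg]
  ring_nf

theorem re_lineChar_sub_one_mul_conj (ζ x y : ℝ) :
    ((lineChar ζ x - 1) * (starRingEnd ℂ) (lineChar ζ y - 1)).re
      = (1 - Real.cos (2 * Real.pi * ζ * x)) + (1 - Real.cos (2 * Real.pi * ζ * y))
        - (1 - Real.cos (2 * Real.pi * ζ * (x - y))) := by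
  have h : 2 * Real.pi * ζ * (x - y) = 2 * Real.pi * ζ * x - 2 * Real.pi * ζ * y := by ring
  rw [h, Real.cos_sub]
  simp [lineChar_re, lineChar_im]
  ring

theorem norm_lineChar_sub_one_sq (ζ x : ℝ) :
    ‖lineChar ζ x - 1‖ ^ 2 = 2 * (1 - Real.cos (2 * Real.pi * ζ * x)) := by
  have h := re_lineChar_sub_one_mul_conj ζ x x
  rw [Complex.mul_conj, Complex.ofReal_re, Complex.normSq_eq_norm_sq] at h
  rw [h]
  simp
  ring

/-- The measure `dζ / (2π²ζ²)`. -/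
noncomputable def inverseSquare : Measure ℝ :=
  volume.withDensity fun ζ => ENNReal.ofReal (1 / (2 * Real.pi ^ 2 * ζ ^ 2))

theorem measurable_inverseSquare_density :
    Measurable fun ζ : ℝ => 1 / (2 * Real.pi ^ 2 * ζ ^ 2) := by fun_prop

instance : SFinite inverseSquare := by unfold inverseSquare; infer_instance

theorem integrable_one_sub_cos_inverseSquare (z : ℝ) :
    Integrable (fun ζ : ℝ => 1 - Real.cos (2 * Real.pi * ζ * z)) inverseSquare := by
  rw [inverseSquare, integrable_withDensity_iff_integrable_smul'
    measurable_inverseSquare_density.ennreal_ofReal (by simp)]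
  refine (integrable_one_sub_cos_div z).congr (Eventually.of_forall fun ζ => ?_)
  simp only [smul_eq_mul]
  rw [ENNReal.toReal_ofReal (by positivity)]
  ring

theorem integral_one_sub_cos_inverseSquare (z : ℝ) :
    ∫ ζ : ℝ, (1 - Real.cos (2 * Real.pi * ζ * z)) ∂inverseSquare = |z| := by
  rw [inverseSquare, integral_withDensity_eq_integral_toReal_smul
    measurable_inverseSquare_density.ennreal_ofReal (by simp), ← integral_one_sub_cos_div]
  refine integral_congr_ae (Eventually.of_forall fun ζ => ?_)
  simp only [smul_eq_mul]
  rw [ENNReal.toReal_ofReal (by positivity)]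
  ring

/-- Subtracting 1 makes each factor of order `ζ` at the origin, which compensates the singular
weight. -/
theorem integrable_lineChar_mul_conj (x y : ℝ) :
    Integrable (fun ζ => (lineChar ζ x - 1) * (starRingEnd ℂ) (lineChar ζ y - 1))
      inverseSquare := by
  refine ((integrable_one_sub_cos_inverseSquare x).add
    (integrable_one_sub_cos_inverseSquare y)).mono' ?_ (Eventually.of_forall fun ζ => ?_)
  · have := continuous_lineChar
    exact Continuous.aestronglyMeasurable (by fun_prop)
  · rw [norm_mul, RCLike.norm_conj, Pi.add_apply]
    have h := two_mul_le_add_sq ‖lineChar ζ x - 1‖ ‖lineChar ζ y - 1‖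
    rw [norm_lineChar_sub_one_sq, norm_lineChar_sub_one_sq] at h
    linarith

/-- Up to a factor 2 this is the covariance of two-sided Brownian motion. It exhibits `-|x - y|` as
positive semidefinite modulo functions of one variable. -/
theorem re_integral_lineChar_mul_conj (x y : ℝ) :
    (∫ ζ, (lineChar ζ x - 1) * (starRingEnd ℂ) (lineChar ζ y - 1) ∂inverseSquare).re
      = |x| + |y| - |x - y| := by
  rw [← RCLike.re_eq_complex_re, ← integral_re (integrable_lineChar_mul_conj x y)]
  have hx := integrable_one_sub_cos_inverseSquare x
  have hy := integrable_one_sub_cos_inverseSquare y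
  have h1 := integral_sub (hx.add hy) (integrable_one_sub_cos_inverseSquare (x - y))
  have h2 := integral_add hx hy
  simp only [Pi.add_apply, integral_one_sub_cos_inverseSquare] at h1 h2
  rw [h2] at h1
  simp only [RCLike.re_eq_complex_re, re_lineChar_sub_one_mul_conj]
  exact h1

theorem lintegral_prod_inverseSquare {d : ℕ} {k : E d → ℝ} (hk : Measurable k)
    {F : E d × ℝ → ℂ} (hF : Measurable F) :
    ∫⁻ p, ‖F p‖ₑ ^ 2 ∂((volume.withDensity fun ω => ENNReal.ofReal (k ω)).prod inverseSquare)
      = ∫⁻ ω : E d, (∫⁻ ζ : ℝ, ‖F (ω, ζ)‖ₑ ^ 2 * ENNReal.ofReal (1 / (2 * Real.pi ^ 2 * ζ ^ 2)))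
        * ENNReal.ofReal (k ω) := by
  have hmm : Measurable fun p => ‖F p‖ₑ ^ 2 := hF.enorm.pow_const 2
  have hin : ∀ ω : E d, ∫⁻ ζ : ℝ, ‖F (ω, ζ)‖ₑ ^ 2
        * ENNReal.ofReal (1 / (2 * Real.pi ^ 2 * ζ ^ 2))
      = ∫⁻ ζ : ℝ, ‖F (ω, ζ)‖ₑ ^ 2 ∂inverseSquare := by
    intro ω
    have hmω : Measurable fun ζ : ℝ => ‖F (ω, ζ)‖ₑ ^ 2 := hmm.comp measurable_prodMk_left
    rw [inverseSquare, lintegral_withDensity_eq_lintegral_mul _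
      measurable_inverseSquare_density.ennreal_ofReal hmω]
    refine lintegral_congr fun ζ => ?_
    rw [Pi.mul_apply, mul_comm]
  rw [lintegral_prod _ hmm.aemeasurable, lintegral_withDensity_eq_lintegral_mul _
    hk.ennreal_ofReal hmm.lintegral_prod_right']
  refine lintegral_congr fun ω => ?_
  rw [hin, Pi.mul_apply, mul_comm]

/-- The weights are positive off `ζ = 0`. Continuity removes the exceptional null sets, first in `ζ`
for almost every `ω`, then in `ω` for fixed `ζ`. -/
theorem eq_zero_of_lintegral_inverseSquare {d : ℕ} {k : E d → ℝ} (hk : Measurable k)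
    (hk0 : ∀ ω, 0 < k ω) {F : E d × ℝ → ℂ} (hF : Continuous F)
    (h : ∫⁻ ω : E d, (∫⁻ ζ : ℝ, ‖F (ω, ζ)‖ₑ ^ 2
      * ENNReal.ofReal (1 / (2 * Real.pi ^ 2 * ζ ^ 2))) * ENNReal.ofReal (k ω) = 0)
    (p : E d × ℝ) : F p = 0 := by
  have hw : Measurable fun ζ : ℝ => ENNReal.ofReal (1 / (2 * Real.pi ^ 2 * ζ ^ 2)) :=
    measurable_inverseSquare_density.ennreal_ofReal
  have hm2 : Measurable fun p : E d × ℝ => ‖F p‖ₑ ^ 2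
        * ENNReal.ofReal (1 / (2 * Real.pi ^ 2 * p.2 ^ 2)) :=
    (hF.measurable.enorm.pow_const 2).mul (hw.comp measurable_snd)
  have hm3 : Measurable fun ω : E d => (∫⁻ ζ : ℝ, ‖F (ω, ζ)‖ₑ ^ 2
        * ENNReal.ofReal (1 / (2 * Real.pi ^ 2 * ζ ^ 2))) * ENNReal.ofReal (k ω) :=
    hm2.lintegral_prod_right'.mul hk.ennreal_ofReal
  rw [lintegral_eq_zero_iff hm3] at h
  have h2 : ∀ᵐ ω : E d, ∀ ζ, F (ω, ζ) = 0 := by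
    filter_upwards [h] with ω hω
    have hω1 := (mul_eq_zero.1 hω).resolve_right (ENNReal.ofReal_pos.2 (hk0 ω)).ne'
    have hcω : Continuous fun ζ : ℝ => F (ω, ζ) := by fun_prop
    have hmω : Measurable fun ζ : ℝ => ‖F (ω, ζ)‖ₑ ^ 2
        * ENNReal.ofReal (1 / (2 * Real.pi ^ 2 * ζ ^ 2)) :=
      (hcω.measurable.enorm.pow_const 2).mul hw
    rw [lintegral_eq_zero_iff hmω] at hω1
    have hae : ∀ᵐ ζ : ℝ, ζ ≠ 0 := by simp [ae_iff]
    have h3 : (fun ζ => F (ω, ζ)) =ᵐ[volume] fun _ => 0 := by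
      filter_upwards [hω1, hae] with ζ hζ hζ0
      have : ENNReal.ofReal (1 / (2 * Real.pi ^ 2 * ζ ^ 2)) ≠ 0 :=
        (ENNReal.ofReal_pos.2 (by positivity)).ne'
      have h4 := (mul_eq_zero.1 hζ).resolve_right this
      exact enorm_eq_zero.1 ((pow_eq_zero_iff two_ne_zero).1 h4)
    exact congrFun ((hcω.ae_eq_iff_eq volume continuous_const).1 h3)
  have hcζ : Continuous fun ω => F (ω, p.2) := by fun_prop
  have h4 : (fun ω => F (ω, p.2)) =ᵐ[volume] fun _ => 0 := by
    filter_upwards [h2] with ω hω using hω p.2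
  exact congrFun ((hcζ.ae_eq_iff_eq volume continuous_const).1 h4) p.1

end LineFeature

/-! ### The slope form as an energy of averaged features. -/

section SlopeEnergy

variable {d : ℕ} {Ω : Type*} [MeasurableSpace Ω] {P : Measure Ω} [IsProbabilityMeasure P]
  {μ : Measure ℝ} [IsFiniteMeasure μ] {a b : ℝ} {X : Ω → E d}

theorem measurable_mul_chars (hX : Measurable X) (r : Lp ℝ 2 P) (i : Fin d) (β : E d) :
    Measurable fun p : (E d × ℝ) × Ω =>
      (r p.2 : ℂ) * expChar p.1.1 (hadamard β (X p.2)) * lineChar p.1.2 (X p.2 i) := by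
  have h1 : Measurable fun p : (E d × ℝ) × Ω => expChar p.1.1 (hadamard β (X p.2)) :=
    measurable_expChar measurable_fst.fst ((measurable_hadamard_comp hX β).comp measurable_snd)
  have h2 : Measurable fun p : (E d × ℝ) × Ω => lineChar p.1.2 (X p.2 i) :=
    measurable_lineChar measurable_fst.snd ((measurable_coord hX i).comp measurable_snd)
  have h3 : Measurable fun p : (E d × ℝ) × Ω => (r p.2 : ℂ) :=
    Complex.measurable_ofReal.comp ((Lp.stronglyMeasurable r).measurable.comp measurable_snd)
  exact (h3.mul h1).mul h2

/-- The averaged feature `E[r e^{-2πi⟨ω, β ∘ X⟩} e^{-2πiζX_i}]`. -/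
noncomputable def meanFeature (P : Measure Ω) (X : Ω → E d) (r : Ω → ℝ) (i : Fin d) (β ω : E d)
    (ζ : ℝ) : ℂ :=
  ∫ w, (r w : ℂ) * expChar ω (hadamard β (X w)) * lineChar ζ (X w i) ∂P

theorem continuous_meanFeature (hX : Measurable X) (r : Lp ℝ 2 P) (i : Fin d) (β : E d) :
    Continuous fun p : E d × ℝ => meanFeature P X r i β p.1 p.2 := by
  have hr : Integrable r P := (Lp.memLp r).integrable one_le_two
  refine continuous_of_dominated (bound := fun w => ‖r w‖) (fun p => ?_) ?_ hr.norm ?_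
  · exact ((measurable_mul_chars hX r i β).comp
      (measurable_prodMk_left (x := p))).aestronglyMeasurable
  · refine fun ω => Eventually.of_forall fun w => ?_
    simp [norm_expChar, norm_lineChar]
  · refine Eventually.of_forall fun w => ?_
    have h1 := continuous_expChar (d := d)
    have h2 := continuous_lineChar
    fun_prop

theorem integrable_mul_coord (hX2 : MemLp X 2 P) (r : Lp ℝ 2 P) (i : Fin d) :
    Integrable (fun w => r w * |X w i|) P :=
  (Lp.memLp r).integrable_mul (memLp_coord hX2 i).norm

/-- The squared modulus of the feature integrates to a constant multiple of `|X_i|`, so the claim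
reduces to integrability of `r |X_i|`, a product of two square integrable functions. -/
theorem integrable_slope_feature (ha : 0 < a)
    (hμ : ∀ᵐ t ∂μ, t ∈ Set.Icc a b) (hX : Measurable X)
    (hX2 : MemLp X 2 P) (r : Lp ℝ 2 P) (i : Fin d) (β : E d) :
    Integrable (fun p : (E d × ℝ) × Ω => r p.2 *
      ‖expChar p.1.1 (hadamard β (X p.2)) * (lineChar p.1.2 (X p.2 i) - 1)‖ ^ 2)
      ((((volume : Measure (E d)).withDensity fun ω => ENNReal.ofReal (ell1Density μ ω)).prod
        inverseSquare).prod P) := by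
  have := isFiniteMeasure_withDensity_ell1Density (d := d) ha hμ
  set ν := (volume : Measure (E d)).withDensity fun ω => ENNReal.ofReal (ell1Density μ ω)
  simp only [norm_mul, norm_expChar, one_mul, norm_lineChar_sub_one_sq]
  have hm : Measurable fun p : (E d × ℝ) × Ω =>
      r p.2 * (2 * (1 - Real.cos (2 * Real.pi * p.1.2 * X p.2 i))) := by
    have h1 := (Lp.stronglyMeasurable r).measurable
    have h2 := measurable_coord hX i
    fun_prop
  have hθ : ∀ x : ℝ, Integrable (fun θ : E d × ℝ => 2 * (1 - Real.cos (2 * Real.pi * θ.2 * x)))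
      (ν.prod inverseSquare) := fun x =>
    ((integrable_one_sub_cos_inverseSquare x).const_mul 2).comp_snd ν
  rw [integrable_prod_iff' hm.aestronglyMeasurable]
  refine ⟨Eventually.of_forall fun w => (hθ (X w i)).const_mul (r w), ?_⟩
  refine ((integrable_mul_coord hX2 r i).norm.const_mul (2 * ν.real Set.univ)).congr
    (Eventually.of_forall fun w => ?_)
  simp only [norm_mul]
  rw [integral_const_mul]
  have h1 : ∫ θ : E d × ℝ, ‖(2 : ℝ)‖ * ‖1 - Real.cos (2 * Real.pi * θ.2 * X w i)‖
      ∂(ν.prod inverseSquare) = ν.real Set.univ * (2 * |X w i|) := by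
    have h2 := integral_prod_mul (μ := ν) (ν := inverseSquare) (L := ℝ) (fun _ => (1 : ℝ))
      (fun ζ : ℝ => 2 * (1 - Real.cos (2 * Real.pi * ζ * X w i)))
    have h3 := integral_const_mul (μ := inverseSquare) (2 : ℝ)
      (fun ζ : ℝ => 1 - Real.cos (2 * Real.pi * ζ * X w i))
    rw [integral_one_sub_cos_inverseSquare] at h3
    rw [h3, integral_const, smul_eq_mul, mul_one] at h2
    rw [← h2]
    refine integral_congr_ae (Eventually.of_forall fun θ => ?_)
    simp only
    rw [one_mul, Real.norm_eq_abs, Real.norm_eq_abs, abs_of_pos two_pos,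
      abs_of_nonneg (sub_nonneg.2 (Real.cos_le_one _))]
  rw [h1, Real.norm_eq_abs |X w i|, abs_abs]
  ring

/-- The inner integral is the kernel mean of `r`, which vanishes with its characteristic function.
This removes the one-variable terms `|X_i|` and `|X_i'|` from the Gram kernel. -/
theorem integral_pairKernel_coord_mul_eq_zero (ha : 0 < a) (hμ : ∀ᵐ t ∂μ, t ∈ Set.Icc a b)
    (hX : Measurable X) (hX2 : MemLp X 2 P) {r : Lp ℝ 2 P} {i : Fin d} {β : E d}
    (h : ∀ ω : E d, ∫ w, (r w : ℂ) * expChar ω (hadamard β (X w)) ∂P = 0) :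
    Integrable (fun z : Ω × Ω => pairKernel μ (fun w => hadamard β (X w)) z *
      ((r z.1 * |X z.1 i|) * r z.2)) (P.prod P) ∧
    ∫ z : Ω × Ω, pairKernel μ (fun w => hadamard β (X w)) z *
      ((r z.1 * |X z.1 i|) * r z.2) ∂(P.prod P) = 0 := by
  have hr : Integrable r P := (Lp.memLp r).integrable one_le_two
  have hZ := measurable_hadamard_comp hX β
  have hi : Integrable (fun z : Ω × Ω => pairKernel μ (fun w => hadamard β (X w)) z *
      ((r z.1 * |X z.1 i|) * r z.2)) (P.prod P) :=
    ((integrable_mul_coord hX2 r i).mul_prod hr).bdd_mul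
      (measurable_pairKernel ha hμ hZ).aestronglyMeasurable
      (Eventually.of_forall fun _ => abs_laplaceKernel_le ha hμ _)
  refine ⟨hi, ?_⟩
  rw [integral_prod _ hi]
  refine integral_eq_zero_of_ae (Eventually.of_forall fun w => ?_)
  have h1 := integral_laplaceKernel_mul_eq_zero ha hμ hZ hr h (hadamard β (X w))
  have h2 : ∀ w', pairKernel μ (fun w => hadamard β (X w)) (w, w') * ((r w * |X w i|) * r w')
      = (r w * |X w i|) * (laplaceKernel μ (hadamard β (X w) - hadamard β (X w')) * r w') := by
    intro w'
    rw [pairKernel]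
    ring
  simp only [h2, Pi.zero_apply]
  rw [integral_const_mul, h1, mul_zero]

/-- On functions orthogonal to the characters of `β ∘ X`, minus the slope form is an energy. -/
theorem lintegral_enorm_meanFeature (ha : 0 < a) (hμ : ∀ᵐ t ∂μ, t ∈ Set.Icc a b)
    (hX : Measurable X) (hX2 : MemLp X 2 P) {r : Lp ℝ 2 P} {i : Fin d} {β : E d}
    (h : ∀ ω : E d, ∫ w, (r w : ℂ) * expChar ω (hadamard β (X w)) ∂P = 0) :
    ∫⁻ ω : E d, (∫⁻ ζ : ℝ, ‖meanFeature P X r i β ω ζ‖ₑ ^ 2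
        * ENNReal.ofReal (1 / (2 * Real.pi ^ 2 * ζ ^ 2))) * ENNReal.ofReal (ell1Density μ ω)
      = ENNReal.ofReal (-kernelForm (slopeLp ha hμ hX hX2 i β) r r)
    ∧ 0 ≤ -kernelForm (slopeLp ha hμ hX hX2 i β) r r := by
  have hr : Integrable r P := (Lp.memLp r).integrable one_le_two
  have hZ := measurable_hadamard_comp hX β
  have := isFiniteMeasure_withDensity_ell1Density (d := d) ha hμ
  set ν := (volume : Measure (E d)).withDensity fun ω => ENNReal.ofReal (ell1Density μ ω) with hν
  set φ : (E d × ℝ) × Ω → ℂ := fun p =>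
    expChar p.1.1 (hadamard β (X p.2)) * (lineChar p.1.2 (X p.2 i) - 1) with hφ
  have hφm : Measurable φ := by
    have h1 : Measurable fun p : (E d × ℝ) × Ω => expChar p.1.1 (hadamard β (X p.2)) :=
      measurable_expChar measurable_fst.fst (hZ.comp measurable_snd)
    have h2 : Measurable fun p : (E d × ℝ) × Ω => lineChar p.1.2 (X p.2 i) :=
      measurable_lineChar measurable_fst.snd ((measurable_coord hX i).comp measurable_snd)
    exact h1.mul (h2.sub_const 1)
  have hfe := lintegral_enorm_integral_feature (ν := ν.prod inverseSquare) hφm hr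
    (integrable_slope_feature ha hμ hX hX2 r i β)
  -- The `-1` in the recentred feature contributes a character of `β ∘ X`, which `r` annihilates.
  have hmean : ∀ θ : E d × ℝ, ∫ w, (r w : ℂ) * φ (θ, w) ∂P = meanFeature P X r i β θ.1 θ.2 := by
    intro θ
    have hI : Integrable (fun w => (r w : ℂ) * expChar θ.1 (hadamard β (X w))
        * lineChar θ.2 (X w i)) P :=
      hr.norm.mono' ((measurable_mul_chars hX r i β).comp
        (measurable_prodMk_left (x := θ))).aestronglyMeasurable
        (Eventually.of_forall fun w => by simp [norm_expChar, norm_lineChar])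
    have hs := integral_sub hI (integrable_mul_expChar hr hZ θ.1)
    rw [h θ.1, sub_zero] at hs
    rw [meanFeature, ← hs]
    refine integral_congr_ae (Eventually.of_forall fun w => ?_)
    simp only [hφ]
    ring
  -- The feature kernel is the product of `ψ` and `|x| + |y| - |x - y|`; only the last of the three
  -- resulting terms survives integration.
  have hker : ∀ z : Ω × Ω, (∫ θ, φ (θ, z.1) * (starRingEnd ℂ) (φ (θ, z.2))
      ∂(ν.prod inverseSquare)).re * (r z.1 * r z.2)
      = pairKernel μ (fun w => hadamard β (X w)) z * ((r z.1 * |X z.1 i|) * r z.2)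
        + pairKernel μ (fun w => hadamard β (X w)) z * ((r z.2 * |X z.2 i|) * r z.1)
        - slopeKernel μ X i β z * (r z.1 * r z.2) := by
    intro z
    have h1 := integral_prod_mul (μ := ν) (ν := inverseSquare)
      (fun ω => expChar ω (hadamard β (X z.1) - hadamard β (X z.2)))
      (fun ζ => (lineChar ζ (X z.1 i) - 1) * (starRingEnd ℂ) (lineChar ζ (X z.2 i) - 1))
    have h2 : ∀ θ : E d × ℝ, φ (θ, z.1) * (starRingEnd ℂ) (φ (θ, z.2))
        = expChar θ.1 (hadamard β (X z.1) - hadamard β (X z.2)) *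
          ((lineChar θ.2 (X z.1 i) - 1) * (starRingEnd ℂ) (lineChar θ.2 (X z.2 i) - 1)) := by
      intro θ
      rw [← expChar_mul_conj, hφ]
      simp only [map_mul]
      ring
    simp only [h2]
    rw [h1, integral_withDensity_expChar ha hμ, Complex.re_ofReal_mul,
      re_integral_lineChar_mul_conj, slopeKernel, pairKernel]
    ring
  obtain ⟨hi1, h01⟩ := integral_pairKernel_coord_mul_eq_zero (i := i) ha hμ hX hX2 h
  have hsw : ∀ z : Ω × Ω, pairKernel μ (fun w => hadamard β (X w)) z.swap
      = pairKernel μ (fun w => hadamard β (X w)) z := by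
    intro z
    rw [pairKernel, pairKernel, ← laplaceKernel_neg, neg_sub]
    rfl
  have hi2 := hi1.swap
  have h02 := h01
  rw [← integral_prod_swap] at h02
  simp only [Function.comp_def, hsw, Prod.fst_swap, Prod.snd_swap] at hi2 h02
  have hi3 : Integrable (fun z : Ω × Ω => slopeKernel μ X i β z * (r z.1 * r z.2)) (P.prod P) :=
    (memLp_slopeKernel ha hμ hX hX2 i β).integrable_mul
      (memLp_mul_prod (Lp.memLp r) (Lp.memLp r))
  have hval : ∫ z, (∫ θ, φ (θ, z.1) * (starRingEnd ℂ) (φ (θ, z.2))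
      ∂(ν.prod inverseSquare)).re * (r z.1 * r z.2) ∂(P.prod P)
      = -kernelForm (slopeLp ha hμ hX hX2 i β) r r := by
    have hs := integral_sub (hi1.add hi2) hi3
    have ht := integral_add hi1 hi2
    simp only [Pi.add_apply] at hs
    rw [ht, h01, h02] at hs
    simp only [hker]
    rw [hs, slopeLp, kernelForm_toLp]
    ring
  rw [hval] at hfe
  refine ⟨?_, hfe.2⟩
  rw [← hfe.1]
  simp only [hmean]
  exact (lintegral_prod_inverseSquare measurable_ell1Density
    (continuous_meanFeature hX r i β).measurable).symm

theorem meanFeature_eq_zero [NeZero μ] (ha : 0 < a) (hμ : ∀ᵐ t ∂μ, t ∈ Set.Icc a b)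
    (hX : Measurable X) (hX2 : MemLp X 2 P) {r : Lp ℝ 2 P} {i : Fin d} {β : E d}
    (h : ∀ ω : E d, ∫ w, (r w : ℂ) * expChar ω (hadamard β (X w)) ∂P = 0)
    (h0 : kernelForm (slopeLp ha hμ hX hX2 i β) r r = 0) (ω : E d) (ζ : ℝ) :
    meanFeature P X r i β ω ζ = 0 := by
  have h1 := (lintegral_enorm_meanFeature (i := i) ha hμ hX hX2 h).1
  rw [h0, neg_zero, ENNReal.ofReal_zero] at h1
  exact eq_zero_of_lintegral_inverseSquare measurable_ell1Density (ell1Density_pos ha hμ)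
    (continuous_meanFeature hX r i β) h1 (ω, ζ)

/-- Since coordinate `i` enters the character additively, the characters of `(β + e_i) ∘ X` are the
features with `ζ = ω i`. Vanishing of all mean features thus also covers functions of `X_i`. -/
theorem integral_mul_expChar_add_single (r : Ω → ℝ) (i : Fin d) (β ω : E d) :
    ∫ w, (r w : ℂ) * expChar ω (hadamard (β + EuclideanSpace.single i 1) (X w)) ∂P
      = meanFeature P X r i β ω (ω i) := by
  refine integral_congr_ae (Eventually.of_forall fun w => ?_)
  simp only
  rw [mul_assoc]
  congr 1
  have h : hadamard (β + EuclideanSpace.single i 1) (X w)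
      = hadamard β (X w) + EuclideanSpace.single i (X w i) := by
    ext j
    simp only [hadamard_apply, PiLp.add_apply, PiLp.single_apply]
    split_ifs with hj
    · subst hj; ring
    · ring
  rw [h, expChar, expChar, lineChar, ← Complex.exp_add, ← add_mul, inner_add_right,
    EuclideanSpace.inner_single_right]
  congr 2
  simp
  ring

theorem lintegral_ofReal_mul_qDensity (ha : 0 < a) (hμ : ∀ᵐ t ∂μ, t ∈ Set.Icc a b) (ω : E d) :
    ∫⁻ t, ENNReal.ofReal (t * qDensity t ω) ∂μ = ENNReal.ofReal (ell1Density (tilt μ) ω) := by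
  rw [ell1Density, integral_tilt ha hμ, ofReal_integral_eq_lintegral_ofReal]
  · refine (integrable_id_of_Icc hμ).mul_bdd (c := (2 / a) ^ d)
      (measurable_qDensity.comp (measurable_id.prodMk measurable_const)).aestronglyMeasurable ?_
    filter_upwards [hμ] with t ht
    rw [Real.norm_eq_abs, abs_of_nonneg (qDensity_nonneg (ha.le.trans ht.1) ω)]
    exact qDensity_le ha ht ω
  · filter_upwards [hμ] with t ht
    exact mul_nonneg (ha.le.trans ht.1) (qDensity_nonneg (ha.le.trans ht.1) ω)

/-- After exchanging the integrals over `t` and `ω`, the `t`-integral of the weight `t q_t` is the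
spectral density of `tilt μ`, the measure governing the slope kernel. -/
theorem mainTerm_eq_ofReal [IsFiniteMeasure (tilt μ)] (ha : 0 < a)
    (hμ : ∀ᵐ t ∂μ, t ∈ Set.Icc a b)
    (hX : Measurable X) (hX2 : MemLp X 2 P) {Y : Ω → ℝ} {r : Lp ℝ 2 P} {i : Fin d} {β : E d}
    (hr : r =ᵐ[P] fun w => Y w - condOn P X Y (supp β) w)
    (h : ∀ ω : E d, ∫ w, (r w : ℂ) * expChar ω (hadamard β (X w)) ∂P = 0) :
    mainTerm P X Y μ i β
      = ENNReal.ofReal (-kernelForm (slopeLp ha (ae_tilt hμ) hX hX2 i β) r r) := by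
  rw [← (lintegral_enorm_meanFeature ha (ae_tilt hμ) hX hX2 h).1]
  have hΦ : ∀ (ω : E d) (ζ : ℝ), ∫ w, ((Y w - condOn P X Y (supp β) w : ℝ) : ℂ)
          * Complex.exp (((-2 * Real.pi * inner ℝ ω (hadamard β (X w)) : ℝ) : ℂ) * Complex.I)
          * Complex.exp (((-2 * Real.pi * ζ * X w i : ℝ) : ℂ) * Complex.I) ∂P
        = meanFeature P X r i β ω ζ := by
    intro ω ζ
    refine integral_congr_ae ?_
    filter_upwards [hr] with w hw
    rw [hw]
    rfl
  have hmm := (continuous_meanFeature hX r i β).measurable.enorm.pow_const 2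
  have hw : Measurable fun ζ : ℝ => ENNReal.ofReal (1 / (2 * Real.pi ^ 2 * ζ ^ 2)) :=
    measurable_inverseSquare_density.ennreal_ofReal
  have hm2 : Measurable fun p : E d × ℝ => ‖meanFeature P X r i β p.1 p.2‖ₑ ^ 2
        * ENNReal.ofReal (1 / (2 * Real.pi ^ 2 * p.2 ^ 2)) := hmm.mul (hw.comp measurable_snd)
  have hq : Measurable fun p : ℝ × E d => ENNReal.ofReal (p.1 * qDensity p.1 p.2) :=
    (measurable_fst.mul measurable_qDensity).ennreal_ofReal
  unfold mainTerm
  simp only [hΦ]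
  rw [lintegral_lintegral_swap
    ((hm2.lintegral_prod_right'.comp measurable_snd).mul hq).aemeasurable]
  refine lintegral_congr fun ω => ?_
  have hqω : Measurable fun t => ENNReal.ofReal (t * qDensity t ω) :=
    hq.comp (measurable_prodMk_right (y := ω))
  rw [lintegral_const_mul _ hqω, lintegral_ofReal_mul_qDensity ha hμ]

end SlopeEnergy

/-! ### Independence of generated `σ`-algebras. -/

section SigmaAlgebras

variable {Ω : Type*}

theorem sup_eq_generateFrom_inter (m₁ m₂ : MeasurableSpace Ω) :
    m₁ ⊔ m₂ = MeasurableSpace.generateFrom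
      {s | ∃ A B, MeasurableSet[m₁] A ∧ MeasurableSet[m₂] B ∧ A ∩ B = s} := by
  refine le_antisymm (sup_le (fun A hA => ?_) fun B hB => ?_)
    (MeasurableSpace.generateFrom_le ?_)
  · exact MeasurableSpace.measurableSet_generateFrom ⟨A, Set.univ, hA, .univ, Set.inter_univ A⟩
  · exact MeasurableSpace.measurableSet_generateFrom ⟨Set.univ, B, .univ, hB, Set.univ_inter B⟩
  · rintro _ ⟨A, B, hA, hB, rfl⟩
    have h1 : MeasurableSet[m₁ ⊔ m₂] A := (le_sup_left : m₁ ≤ m₁ ⊔ m₂) A hA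
    have h2 : MeasurableSet[m₁ ⊔ m₂] B := (le_sup_right : m₂ ≤ m₁ ⊔ m₂) B hB
    exact h1.inter h2

theorem isPiSystem_inter (m₁ m₂ : MeasurableSpace Ω) :
    IsPiSystem {s | ∃ A B, MeasurableSet[m₁] A ∧ MeasurableSet[m₂] B ∧ A ∩ B = s} := by
  rintro _ ⟨A, B, hA, hB, rfl⟩ _ ⟨A', B', hA', hB', rfl⟩ -
  exact ⟨A ∩ A', B ∩ B', hA.inter hA', hB.inter hB', Set.inter_inter_inter_comm _ _ _ _⟩

theorem indep_sup_right {m₁ m₂ m₃ m₀ : MeasurableSpace Ω} {P : Measure Ω}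
    [IsProbabilityMeasure P] (h₁ : m₁ ≤ m₀) (h₂ : m₂ ≤ m₀) (h₃ : m₃ ≤ m₀) (h12 : Indep m₁ m₂ P) (h123 : Indep (m₁ ⊔ m₂) m₃ P) :
    Indep m₁ (m₂ ⊔ m₃) P := by
  refine IndepSets.indep h₁ (sup_le h₂ h₃) (@MeasurableSpace.isPiSystem_measurableSet Ω m₁)
    (isPiSystem_inter m₂ m₃) (@MeasurableSpace.generateFrom_measurableSet Ω m₁).symm
    (sup_eq_generateFrom_inter m₂ m₃) ((IndepSets_iff _ _ _).2 ?_)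
  rintro A _ hA ⟨B, C, hB, hC, rfl⟩
  rw [Indep_iff] at h12 h123
  have hA' : MeasurableSet[m₁ ⊔ m₂] A := (le_sup_left : m₁ ≤ m₁ ⊔ m₂) A hA
  have hB' : MeasurableSet[m₁ ⊔ m₂] B := (le_sup_right : m₂ ≤ m₁ ⊔ m₂) B hB
  rw [← Set.inter_assoc, h123 _ _ (hA'.inter hB') hC, h123 _ _ hB' hC, h12 _ _ hA hB, mul_assoc]

/-- Mutual independence separates `i` from the rest of `T`, and all of `T` is independent of its
complement; `indep_sup_right` joins the two facts. -/
theorem indep_biSup_compl_singleton {ι : Type*} {M : ι → MeasurableSpace Ω}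
    {m₀ : MeasurableSpace Ω} {P : Measure Ω} [IsProbabilityMeasure P] (hle : ∀ j, M j ≤ m₀)
    {T : Set ι} {i : ι} (hi : i ∈ T) (h2 : Indep (⨆ j ∈ T, M j) (⨆ j ∈ Tᶜ, M j) P)
    (hmut : iIndep (fun j : T => M j) P) : Indep (⨆ j ∈ ({i}ᶜ : Set ι), M j) (M i) P := by
  obtain ⟨N, hN⟩ : ∃ N, N = ⨆ j ∈ ({⟨i, hi⟩} : Set T)ᶜ, M j := ⟨_, rfl⟩
  have hNle : N ≤ m₀ := by rw [hN]; exact iSup₂_le fun j _ => hle j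
  have h1 : Indep (M i) N P := by
    have := indep_iSup_of_disjoint (m := fun j : T => M j) (fun j => hle j) hmut
      (disjoint_compl_right (a := ({⟨i, hi⟩} : Set T)))
    rwa [iSup_singleton, ← hN] at this
  have h3 : M i ⊔ N ≤ ⨆ j ∈ T, M j := by
    rw [hN]
    exact sup_le (le_biSup M hi) (iSup₂_le fun j _ => le_biSup M j.2)
  have hle' : (⨆ j ∈ Tᶜ, M j) ≤ m₀ := iSup₂_le fun j _ => hle j
  have h4 := indep_sup_right (hle i) hNle hle' h1 (indep_of_indep_of_le_left h2 h3)
  refine indep_of_indep_of_le_left h4.symm (iSup₂_le fun j hj => ?_)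
  by_cases hjT : j ∈ T
  · have hjT' : (⟨j, hjT⟩ : T) ∈ ({⟨i, hi⟩} : Set T)ᶜ := fun h => hj (Subtype.ext_iff.1 h)
    refine le_sup_of_le_left ?_
    rw [hN]
    exact le_biSup (fun j : T => M j) hjT'
  · exact le_sup_of_le_right (le_biSup M hjT)

/-- By independence the conditional expectation of `1_A f` given `m₂` is constant. -/
theorem setIntegral_inter_of_indep {m₁ m₂ m₀ : MeasurableSpace Ω} {P : Measure Ω}
    [IsProbabilityMeasure P] (h₁ : m₁ ≤ m₀) (h₂ : m₂ ≤ m₀) (h12 : Indep m₁ m₂ P) {f : Ω → ℝ} (hf : StronglyMeasurable[m₁] f) (hfi : Integrable f P)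
    {A B : Set Ω} (hA : MeasurableSet[m₁] A) (hB : MeasurableSet[m₂] B) :
    ∫ w in A ∩ B, f w ∂P = P.real B * ∫ w in A, f w ∂P := by
  have h := condExp_indep_eq h₁ h₂ (hf.indicator hA) h12
  have h3 := setIntegral_condExp h₂ (hfi.indicator (h₁ A hA)) hB
  rw [setIntegral_congr_ae (g := fun _ => ∫ w, A.indicator f w ∂P) (h₂ B hB)
    (h.mono fun w hw _ => hw), setIntegral_const, integral_indicator (h₁ A hA),
    setIntegral_indicator (h₁ A hA), Set.inter_comm, smul_eq_mul] at h3
  exact h3.symm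

end SigmaAlgebras

/-! ### The `σ`-algebras of subvectors and of `β ∘ X`. -/

section Features

variable {d : ℕ} {Ω : Type*} [MeasurableSpace Ω] {P : Measure Ω} [IsProbabilityMeasure P]
  {X : Ω → E d}

theorem comap_subvec (X : Ω → E d) (S : Set (Fin d)) :
    MeasurableSpace.comap (subvec X S) inferInstance
      = ⨆ j ∈ S, MeasurableSpace.comap (fun w => X w j) inferInstance := by
  rw [iSup_subtype']
  change MeasurableSpace.comap (subvec X S) (⨆ j, _) = _
  rw [MeasurableSpace.comap_iSup]
  refine iSup_congr fun j => ?_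
  rw [MeasurableSpace.comap_comp]
  rfl

theorem comap_subvec_le (hX : Measurable X) (S : Set (Fin d)) :
    MeasurableSpace.comap (subvec X S) inferInstance ≤ ‹MeasurableSpace Ω› := by
  rw [comap_subvec]
  exact iSup₂_le fun j _ => (measurable_coord hX j).comap_le

theorem comap_subvec_mono (X : Ω → E d) {S T : Set (Fin d)} (h : S ⊆ T) :
    MeasurableSpace.comap (subvec X S) inferInstance
      ≤ MeasurableSpace.comap (subvec X T) inferInstance := by
  rw [comap_subvec, comap_subvec]
  exact biSup_mono h

theorem comap_subvec_eq_sup (X : Ω → E d) {S : Set (Fin d)} {i : Fin d} (hi : i ∈ S) :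
    MeasurableSpace.comap (subvec X S) inferInstance
      = MeasurableSpace.comap (subvec X (S \ {i})) inferInstance
        ⊔ MeasurableSpace.comap (fun w => X w i) inferInstance := by
  conv_lhs => rw [← Set.insert_sdiff_self_of_mem hi, comap_subvec]
  rw [iSup_insert, sup_comm, comap_subvec]

theorem comap_subvec_le_comap_hadamard (X : Ω → E d) {β : E d} {S : Set (Fin d)}
    (h : ∀ j ∈ S, β j ≠ 0) :
    MeasurableSpace.comap (subvec X S) inferInstance
      ≤ MeasurableSpace.comap (fun w => hadamard β (X w)) inferInstance := by
  rw [comap_subvec]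
  refine iSup₂_le fun j hj => ?_
  have h1 : (fun w => X w j) = (fun z : E d => (β j)⁻¹ * z j) ∘ fun w => hadamard β (X w) := by
    ext w
    simp [hadamard_apply, h j hj]
  rw [h1, ← MeasurableSpace.comap_comp]
  exact MeasurableSpace.comap_mono (by fun_prop : Measurable fun z : E d => (β j)⁻¹ * z j).comap_le

theorem comap_hadamard_le_comap_subvec (X : Ω → E d) (β : E d) :
    MeasurableSpace.comap (fun w => hadamard β (X w)) inferInstance
      ≤ MeasurableSpace.comap (subvec X (supp β)) inferInstance := by
  classical
  set g : (supp β → ℝ) → E d := fun v => WithLp.toLp 2 fun j =>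
    if hj : j ∈ supp β then β j * v ⟨j, hj⟩ else 0 with hg
  have hgm : Measurable g := by
    refine (WithLp.measurable_toLp 2 _).comp (measurable_pi_iff.2 fun j => ?_)
    by_cases hj : j ∈ supp β
    · simp only [hj, dite_true]
      fun_prop
    · simp only [hj, dite_false]
      fun_prop
  have h1 : (fun w => hadamard β (X w)) = g ∘ subvec X (supp β) := by
    ext w j
    simp only [hadamard_apply, hg, Function.comp_apply, subvec]
    split_ifs with hj
    · rfl
    · simp [not_not.1 hj]
  rw [h1, ← MeasurableSpace.comap_comp]
  exact MeasurableSpace.comap_mono hgm.comap_le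

theorem indep_subvec_compl_coord (hX : Measurable X) {T : Set (Fin d)}
    (hindep : IndepFun (subvec X T) (subvec X Tᶜ) P)
    (hmut : iIndepFun (fun (j : T) (w : Ω) => X w j) P) {i : Fin d} (hi : i ∈ T) :
    Indep (MeasurableSpace.comap (subvec X {i}ᶜ) inferInstance)
      (MeasurableSpace.comap (fun w => X w i) inferInstance) P := by
  rw [IndepFun_iff_Indep, comap_subvec, comap_subvec] at hindep
  rw [comap_subvec]
  exact indep_biSup_compl_singleton (fun j => (measurable_coord hX j).comap_le) hi hindep
    ((iIndepFun_iff_iIndep (fun _ : T => inferInstance) (fun (j : T) w => X w j) P).1 hmut)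

/-- The sets `A ∩ B` form a `π`-system generating `σ(X_S)`, so the conditional expectation on the
smaller `σ`-algebra already has the defining property of the one on the larger. -/
theorem condOn_ae_eq_of_setIntegral_inter (hX : Measurable X) {Y : Ω → ℝ} (hY : Integrable Y P)
    {S : Set (Fin d)} {i : Fin d} (hi : i ∈ S)
    (h : ∀ A B, MeasurableSet[MeasurableSpace.comap (subvec X (S \ {i})) inferInstance] A →
      MeasurableSet[MeasurableSpace.comap (fun w => X w i) inferInstance] B →
      ∫ w in A ∩ B, condOn P X Y (S \ {i}) w ∂P = ∫ w in A ∩ B, Y w ∂P) :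
    condOn P X Y (S \ {i}) =ᵐ[P] condOn P X Y S := by
  have hc : Integrable (condOn P X Y (S \ {i})) P := integrable_condExp
  have hz : ∀ s, MeasurableSet[MeasurableSpace.comap (subvec X S) inferInstance] s →
      ∫ w in s, (condOn P X Y (S \ {i}) w - Y w) ∂P = 0 := by
    intro s hs
    have h0 : ∀ A B, MeasurableSet[MeasurableSpace.comap (subvec X (S \ {i})) inferInstance] A →
      MeasurableSet[MeasurableSpace.comap (fun w => X w i) inferInstance] B →
      ∫ w in A ∩ B, (condOn P X Y (S \ {i}) w - Y w) ∂P = 0 := fun A B hA hB => by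
      rw [integral_sub hc.integrableOn hY.integrableOn, h A B hA hB, sub_self]
    refine setIntegral_eq_zero_of_isPiSystem (comap_subvec_le hX S) (hc.sub hY)
      ((comap_subvec_eq_sup X hi).trans (sup_eq_generateFrom_inter _ _)) (isPiSystem_inter _ _)
      ?_ ?_ hs
    · rintro _ ⟨A, B, hA, hB, rfl⟩
      exact h0 A B hA hB
    · have := h0 Set.univ Set.univ MeasurableSet.univ MeasurableSet.univ
      simpa using this
  refine ae_eq_condExp_of_forall_setIntegral_eq (comap_subvec_le hX S) hY
    (fun s _ _ => hc.integrableOn) (fun s hs _ => ?_) ?_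
  · have := hz s hs
    rw [integral_sub hc.integrableOn hY.integrableOn] at this
    exact sub_eq_zero.1 this
  · exact (stronglyMeasurable_condExp.mono
      (comap_subvec_mono X Set.sdiff_subset)).aestronglyMeasurable

end Features

theorem integral_sub_condExp_mul {Ω : Type*} {m m₀ : MeasurableSpace Ω} {P : Measure Ω}
    [IsFiniteMeasure P] (hm : m ≤ m₀) {Y g : Ω → ℝ} (hY : Integrable Y P)
    (hg : StronglyMeasurable[m] g) {c : ℝ} (hc : ∀ w, ‖g w‖ ≤ c) :
    ∫ w, (Y w - (P[Y | m]) w) * g w ∂P = 0 := by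
  have hgm : AEStronglyMeasurable g P := (hg.mono hm).aestronglyMeasurable
  have h1 : Integrable (Y * g) P := hY.mul_bdd hgm (Eventually.of_forall hc)
  have h2 : Integrable (P[Y | m] * g) P :=
    integrable_condExp.mul_bdd hgm (Eventually.of_forall hc)
  have h3 := integral_congr_ae (condExp_mul_of_stronglyMeasurable_right hg h1 hY)
  rw [integral_condExp hm] at h3
  have h4 := integral_sub h1 h2
  rw [h3, sub_self] at h4
  rw [← h4]
  refine integral_congr_ae (Eventually.of_forall fun w => ?_)
  simp only [Pi.mul_apply]
  ring

theorem integral_sub_condExp_mul_complex {Ω : Type*} {m m₀ : MeasurableSpace Ω} {P : Measure Ω}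
    [IsFiniteMeasure P] (hm : m ≤ m₀) {Y : Ω → ℝ} {g : Ω → ℂ} (hY : Integrable Y P)
    (hg : Measurable[m] g) {c : ℝ} (hc : ∀ w, ‖g w‖ ≤ c) :
    ∫ w, ((Y w - (P[Y | m]) w : ℝ) : ℂ) * g w ∂P = 0 := by
  have hi : Integrable (fun w => ((Y w - (P[Y | m]) w : ℝ) : ℂ) * g w) P :=
    ((hY.sub integrable_condExp).ofReal (𝕜 := ℂ)).mul_bdd (c := c)
      (hg.mono hm le_rfl).aestronglyMeasurable (Eventually.of_forall hc)
  have hre : Measurable[m] fun w => (g w).re := Complex.measurable_re.comp hg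
  have him : Measurable[m] fun w => (g w).im := Complex.measurable_im.comp hg
  apply Complex.ext
  · rw [← RCLike.re_eq_complex_re, ← integral_re hi]
    simp only [RCLike.re_eq_complex_re, Complex.re_ofReal_mul]
    exact integral_sub_condExp_mul hm hY hre.stronglyMeasurable
      fun w => (Complex.abs_re_le_norm _).trans (hc w)
  · rw [← RCLike.im_eq_complex_im, ← integral_im hi]
    simp only [RCLike.im_eq_complex_im, Complex.im_ofReal_mul]
    exact integral_sub_condExp_mul hm hY him.stronglyMeasurable
      fun w => (Complex.abs_im_le_norm _).trans (hc w)

/-! ### Test functions detecting the effect of feature `i`. -/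

section ProductGap

variable {Ω : Type*} [m₀ : MeasurableSpace Ω] {P : Measure Ω} [IsProbabilityMeasure P]

/-- The functions `1_{A ∩ B} - P(B) 1_A` with `A`, `B` in two given `σ`-algebras. -/
def productGaps (P : Measure Ω) (m₁ m₂ : MeasurableSpace Ω) : Set (Lp ℝ 2 P) :=
  {h | ∃ A B, MeasurableSet[m₁] A ∧ MeasurableSet[m₂] B ∧
    h =ᵐ[P] fun w => (A ∩ B).indicator 1 w - P.real B * A.indicator 1 w}

theorem integral_mul_gap {A B : Set Ω} (hA : MeasurableSet A) (hB : MeasurableSet B)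
    {u : Ω → ℝ} (hu : Integrable u P) {h : Ω → ℝ}
    (hh : h =ᵐ[P] fun w => (A ∩ B).indicator 1 w - P.real B * A.indicator 1 w) :
    ∫ w, u w * h w ∂P = ∫ w in A ∩ B, u w ∂P - P.real B * ∫ w in A, u w ∂P := by
  have h1 := integral_sub (hu.indicator (hA.inter hB)) ((hu.indicator hA).const_mul (P.real B))
  rw [integral_const_mul, integral_indicator hA, integral_indicator (hA.inter hB)] at h1
  rw [← h1]
  refine integral_congr_ae ?_
  filter_upwards [hh] with w hw
  rw [hw]
  by_cases h1 : w ∈ A <;> by_cases h2 : w ∈ B <;> simp [h1, h2] <;> ring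

theorem inner_gap (u : Lp ℝ 2 P) {A B : Set Ω} (hA : MeasurableSet A) (hB : MeasurableSet B)
    {h : Lp ℝ 2 P}
    (hh : h =ᵐ[P] fun w => (A ∩ B).indicator 1 w - P.real B * A.indicator 1 w) :
    inner ℝ u h = ∫ w in A ∩ B, u w ∂P - P.real B * ∫ w in A, u w ∂P := by
  rw [← integral_mul_gap hA hB ((Lp.memLp u).integrable one_le_two) hh, L2.inner_def]
  refine integral_congr_ae (Eventually.of_forall fun w => ?_)
  simp [mul_comm]

theorem exists_gap {A B : Set Ω} (hA : MeasurableSet A) (hB : MeasurableSet B) :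
    ∃ h : Lp ℝ 2 P, h =ᵐ[P] fun w => (A ∩ B).indicator 1 w - P.real B * A.indicator 1 w := by
  have hone : MemLp (1 : Ω → ℝ) 2 P := memLp_const 1
  have h1 : MemLp (fun w => (A ∩ B).indicator (1 : Ω → ℝ) w - P.real B * A.indicator 1 w) 2 P :=
    (hone.indicator (hA.inter hB)).sub ((hone.indicator hA).const_mul _)
  exact ⟨h1.toLp _, h1.coeFn_toLp⟩

end ProductGap

theorem integral_mul_productGap_eq_zero {Ω : Type*} {m₁ m₁' m₂ m₀ : MeasurableSpace Ω}
    {P : Measure Ω} [IsProbabilityMeasure P] (h₁ : m₁' ≤ m₀)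
    (h₂ : m₂ ≤ m₀) (h12 : Indep m₁' m₂ P) (hle : m₁ ≤ m₁') {g : Ω → ℝ}
    (hg : StronglyMeasurable[m₁'] g) (hgi : Integrable g P) {h : Lp ℝ 2 P}
    (hh : h ∈ productGaps P m₁ m₂) : ∫ w, g w * h w ∂P = 0 := by
  obtain ⟨A, B, hA, hB, hAB⟩ := hh
  rw [integral_mul_gap (h₁ A (hle A hA)) (h₂ B hB) hgi hAB,
    setIntegral_inter_of_indep h₁ h₂ h12 hg hgi (hle A hA) hB, sub_self]

/-! ### The uniform margin, and the two residuals it applies to. -/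

section Margin

variable {d : ℕ} {Ω : Type*} [MeasurableSpace Ω] {P : Measure Ω} [IsProbabilityMeasure P]
  {μ : Measure ℝ} [IsFiniteMeasure μ] {a b : ℝ} {X : Ω → E d} {Y : Ω → ℝ} {S : Set (Fin d)}
  {i : Fin d}

theorem setIntegral_eq_zero_of_integral_mul_expChar (hX : Measurable X) {β : E d}
    {T : Set (Fin d)} (hT : ∀ j ∈ T, β j ≠ 0) {r : Lp ℝ 2 P}
    (h : ∀ ω : E d, ∫ w, (r w : ℂ) * expChar ω (hadamard β (X w)) ∂P = 0) {A : Set Ω}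
    (hA : MeasurableSet[MeasurableSpace.comap (subvec X T) inferInstance] A) :
    ∫ w in A, r w ∂P = 0 := by
  obtain ⟨A', hA', rfl⟩ := comap_subvec_le_comap_hadamard X hT A hA
  exact setIntegral_preimage_eq_zero_of_charFun ((Lp.memLp r).integrable one_le_two)
    (measurable_hadamard_comp hX β) h hA'

/-- A residual that is orthogonal to the functions of `X_S` forces `E[Y | X_S] = E[Y | X_{S \ i}]`. -/
theorem condOn_ae_eq_of_residual (hX : Measurable X) (hY2 : MemLp Y 2 P) (hi : i ∈ S)
    (hind : Indep (MeasurableSpace.comap (subvec X {i}ᶜ) inferInstance)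
      (MeasurableSpace.comap (fun w => X w i) inferInstance) P) {r : Lp ℝ 2 P}
    (hgap : ∀ h ∈ productGaps P (MeasurableSpace.comap (subvec X (S \ {i})) inferInstance)
      (MeasurableSpace.comap (fun w => X w i) inferInstance), inner ℝ (hY2.toLp Y - r) h = 0)
    (hr : ∀ A, MeasurableSet[MeasurableSpace.comap (subvec X S) inferInstance] A →
      ∫ w in A, r w ∂P = 0) :
    condOn P X Y (S \ {i}) =ᵐ[P] condOn P X Y S := by
  have hY := hY2.integrable one_le_two
  have hmS := comap_subvec_le hX S
  have hmU := comap_subvec_le hX (S \ {i})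
  have hmi := (measurable_coord hX i).comap_le
  have hUc : MeasurableSpace.comap (subvec X (S \ {i})) inferInstance
      ≤ MeasurableSpace.comap (subvec X {i}ᶜ) inferInstance :=
    comap_subvec_mono X fun j hj => hj.2
  have hsup := comap_subvec_eq_sup X hi
  refine condOn_ae_eq_of_setIntegral_inter hX hY hi fun A B hA hB => ?_
  have hAS : MeasurableSet[MeasurableSpace.comap (subvec X S) inferInstance] A :=
    comap_subvec_mono X Set.sdiff_subset A hA
  have hBS : MeasurableSet[MeasurableSpace.comap (subvec X S) inferInstance] B := by
    rw [hsup]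
    exact (le_sup_right : MeasurableSpace.comap (fun w => X w i) inferInstance ≤ _) B hB
  obtain ⟨h, hh⟩ := exists_gap (P := P) (hmU A hA) (hmi B hB)
  -- As `r` integrates to zero over `A` and `A ∩ B`, the constraint becomes a statement about `Y`
  -- alone: its integral over `A ∩ B` is `P(B)` times its integral over `A`. Independence gives the
  -- same factorisation for `E[Y | X_{S \ i}]`.
  have hz := hgap h ⟨A, B, hA, hB, hh⟩
  rw [inner_sub_left, inner_gap _ (hmU A hA) (hmi B hB) hh, inner_gap _ (hmU A hA) (hmi B hB) hh,
    hr A hAS, hr (A ∩ B) (hAS.inter hBS), mul_zero, sub_zero, sub_zero,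
    setIntegral_congr_ae (g := Y) (hmS _ (hAS.inter hBS)) (hY2.coeFn_toLp.mono fun w hw _ => hw),
    setIntegral_congr_ae (g := Y) (hmU A hA) (hY2.coeFn_toLp.mono fun w hw _ => hw)] at hz
  rw [setIntegral_inter_of_indep (f := condOn P X Y (S \ {i}))
    (comap_subvec_le hX {i}ᶜ) hmi hind (stronglyMeasurable_condExp.mono hUc) integrable_condExp
    (hUc A hA) hB, sub_eq_zero.1 hz]
  congr 1
  exact setIntegral_condExp hmU hY hA

/-- Only pointwise positivity has to be checked. If it failed, the Gram form would be zero, so minus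
the slope form would be a genuine energy, also zero; then `r` annihilates the characters of `(β +
e_i) ∘ X`, hence all events of `σ(X_S)`, contradicting `hne`. -/
theorem exists_margin [NeZero μ] (ha : 0 < a) (hμ : ∀ᵐ t ∂μ, t ∈ Set.Icc a b)
    [IsFiniteMeasure (tilt μ)] (hX : Measurable X) (hX2 : MemLp X 2 P) (hY2 : MemLp Y 2 P)
    (hi : i ∈ S) (hind : Indep (MeasurableSpace.comap (subvec X {i}ᶜ) inferInstance)
      (MeasurableSpace.comap (fun w => X w i) inferInstance) P)
    (hne : ¬ condOn P X Y (S \ {i}) =ᵐ[P] condOn P X Y S) {C : Set (E d)} (hC : IsCompact C)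
    (hCS : C ⊆ {β | β i = 0 ∧ ∀ j ∈ S \ {i}, 0 < β j}) (c : ℝ) :
    ∃ ε : ℝ, 0 < ε ∧ ∀ β ∈ C, ∀ r : Lp ℝ 2 P, ‖r‖ ≤ c →
      (∀ h ∈ productGaps P (MeasurableSpace.comap (subvec X (S \ {i})) inferInstance)
        (MeasurableSpace.comap (fun w => X w i) inferInstance),
        inner ℝ (hY2.toLp Y - r) h = 0) →
      ε ≤ max (kernelForm (-slopeLp ha (ae_tilt hμ) hX hX2 i β) r r)
        (kernelForm (gramLp P ha hμ hX β) r r) := by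
  have := neZero_tilt ha hμ
  refine exists_forall_le_max_kernelForm hC
    (continuous_slopeLp ha (ae_tilt hμ) hX hX2 i).neg.continuousOn
    (continuous_gramLp ha hμ hX).continuousOn (hY2.toLp Y) _ c fun β hβ r hr => ?_
  by_contra! hle
  obtain ⟨hle1, hle2⟩ := max_le_iff.1 hle
  have hZ := measurable_hadamard_comp hX β
  have h := integral_mul_expChar_eq_zero_of_kernelForm ha hμ hZ
    (le_antisymm hle2 (kernelForm_pairKernel_nonneg ha hμ hZ r))
  change kernelForm (-slopeLp ha (ae_tilt hμ) hX hX2 i β) r r ≤ 0 at hle1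
  rw [kernelForm_neg] at hle1
  have h0 := le_antisymm hle1 (lintegral_enorm_meanFeature (i := i) ha (ae_tilt hμ) hX hX2 h).2
  have hf := meanFeature_eq_zero ha (ae_tilt hμ) hX hX2 h (neg_eq_zero.1 h0)
  refine hne (condOn_ae_eq_of_residual hX hY2 hi hind hr fun A hA => ?_)
  refine setIntegral_eq_zero_of_integral_mul_expChar (β := β + EuclideanSpace.single i 1) hX
    (fun j hj => ?_) (fun ω => ?_) hA
  · obtain ⟨hβi, hβ'⟩ := hCS hβ
    by_cases hji : j = i
    · subst hji
      simp [hβi]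
    · have := (hβ' j ⟨hj, hji⟩).ne'
      simpa [hji] using this
  · rw [integral_mul_expChar_add_single, hf]

/-- By the ridge equation `y - r` is `λ⁻¹` times a kernel mean evaluated at `β ∘ X`. With `β i = 0`
it does not involve `X_i`, so independence makes it orthogonal to the gaps. -/
theorem inner_ridgeResidual_gap [NeZero μ] (ha : 0 < a) (hμ : ∀ᵐ t ∂μ, t ∈ Set.Icc a b)
    (hX : Measurable X) (hind : Indep (MeasurableSpace.comap (subvec X {i}ᶜ) inferInstance)
      (MeasurableSpace.comap (fun w => X w i) inferInstance) P) {β : E d} (hβ : β i = 0)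
    {lam : ℝ} {y r : Lp ℝ 2 P} (hr : IsRidgeResidual (gramLp P ha hμ hX β) lam y r)
    {U : Set (Fin d)} (hU : i ∉ U) {h : Lp ℝ 2 P}
    (hh : h ∈ productGaps P (MeasurableSpace.comap (subvec X U) inferInstance)
        (MeasurableSpace.comap (fun w => X w i) inferInstance)) :
    inner ℝ (y - r) h = 0 := by
  have hZ := measurable_hadamard_comp hX β
  have hri : Integrable r P := (Lp.memLp r).integrable one_le_two
  rw [inner_sub_left, ← hr h, add_sub_cancel_left, gramLp, ← inner_comp_eq_kernelForm ha hμ hZ]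
  have hr' : StronglyMeasurable r := Lp.stronglyMeasurable r
  have hl := continuous_laplaceKernel (d := d) ha hμ
  have hG : Measurable fun x : E d => ∫ w', laplaceKernel μ (x - hadamard β (X w')) * r w' ∂P := by
    refine (StronglyMeasurable.integral_prod_right (f := fun (x : E d) w' =>
      laplaceKernel μ (x - hadamard β (X w')) * r w') ?_).measurable
    exact ((hl.measurable.comp (measurable_fst.sub (hZ.comp measurable_snd))).mul
      (hr'.measurable.comp measurable_snd)).stronglyMeasurable
  have hm : MeasurableSpace.comap (fun w => hadamard β (X w)) inferInstance
      ≤ MeasurableSpace.comap (subvec X {i}ᶜ) inferInstance :=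
    (comap_hadamard_le_comap_subvec X β).trans
      (comap_subvec_mono X fun j hj hji => hj (by rw [hji, hβ]))
  rw [integral_mul_productGap_eq_zero (comap_subvec_le hX {i}ᶜ) (measurable_coord hX i).comap_le
    hind (comap_subvec_mono X fun j hj hji => hU (hji ▸ hj)) ?_ ?_ hh, mul_zero]
  · refine Measurable.stronglyMeasurable ?_
    exact (hG.comp (comap_measurable _)).mono hm le_rfl
  · refine Integrable.mono' (integrable_const (∫ w', μ.real Set.univ * ‖r w'‖ ∂P))
      (hG.comp hZ).aestronglyMeasurable (Eventually.of_forall fun w => ?_)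
    refine norm_integral_le_of_norm_le (hri.norm.const_mul _) (Eventually.of_forall fun w' => ?_)
    rw [norm_mul]
    exact mul_le_mul_of_nonneg_right (abs_laplaceKernel_le ha hμ _) (norm_nonneg _)

/-- The unregularised counterpart of the ridge residual, meeting the same constraint because `E[Y |
X_supp(β)]` does not involve `X_i`. Here the characters of `β ∘ X` are annihilated exactly. -/
theorem exists_populationResidual (hX : Measurable X) (hY2 : MemLp Y 2 P)
    (hind : Indep (MeasurableSpace.comap (subvec X {i}ᶜ) inferInstance)
      (MeasurableSpace.comap (fun w => X w i) inferInstance) P) {β : E d} (hβ : β i = 0)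
    {U : Set (Fin d)} (hU : i ∉ U) :
    ∃ r : Lp ℝ 2 P, r =ᵐ[P] (fun w => Y w - condOn P X Y (supp β) w) ∧
      ‖r‖ ≤ 2 * ‖hY2.toLp Y‖ ∧
      (∀ ω : E d, ∫ w, (r w : ℂ) * expChar ω (hadamard β (X w)) ∂P = 0) ∧
      ∀ h ∈ productGaps P (MeasurableSpace.comap (subvec X U) inferInstance)
        (MeasurableSpace.comap (fun w => X w i) inferInstance),
        inner ℝ (hY2.toLp Y - r) h = 0 := by
  have hm := comap_subvec_le hX (supp β)
  have hsupp : supp β ⊆ {i}ᶜ := fun j hj hji => hj (by rw [hji, hβ])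
  set q : Lp ℝ 2 P := (condExpL2 ℝ ℝ hm (hY2.toLp Y) : Lp ℝ 2 P) with hq
  have hqe : q =ᵐ[P] condOn P X Y (supp β) := hY2.condExpL2_ae_eq_condExp hm
  have hr : hY2.toLp Y - q =ᵐ[P] fun w => Y w - condOn P X Y (supp β) w := by
    filter_upwards [Lp.coeFn_sub (hY2.toLp Y) q, hY2.coeFn_toLp, hqe] with w h1 h2 h3
    rw [h1, Pi.sub_apply, h2, h3]
  refine ⟨hY2.toLp Y - q, hr, ?_, fun ω => ?_, fun h hh => ?_⟩
  · have h1 : ‖q‖ ≤ ‖hY2.toLp Y‖ := norm_condExpL2_coe_le hm _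
    linarith [norm_sub_le (hY2.toLp Y) q]
  · rw [integral_congr_ae (g := fun w => ((Y w - condOn P X Y (supp β) w : ℝ) : ℂ)
      * expChar ω (hadamard β (X w))) (hr.mono fun w hw => by simp only [hw])]
    refine integral_sub_condExp_mul_complex hm (hY2.integrable one_le_two) ?_
      (c := 1) (fun w => (norm_expChar _ _).le)
    exact ((measurable_expChar measurable_const measurable_id).comp
      (comap_measurable fun w => hadamard β (X w))).mono
        (comap_hadamard_le_comap_subvec X β) le_rfl
  · rw [sub_sub_cancel]
    have h1 : inner ℝ q h = ∫ w, condOn P X Y (supp β) w * h w ∂P := by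
      rw [L2.inner_def]
      refine integral_congr_ae (hqe.mono fun w hw => ?_)
      simp [hw, mul_comm]
    rw [h1]
    exact integral_mul_productGap_eq_zero (comap_subvec_le hX {i}ᶜ)
      (measurable_coord hX i).comap_le hind (comap_subvec_mono X fun j hj hji => hU (hji ▸ hj))
      (stronglyMeasurable_condExp.mono (comap_subvec_mono X hsupp)) integrable_condExp hh

theorem hasDirDeriv_objective [NeZero μ] [IsFiniteMeasure (tilt μ)] (ha : 0 < a)
    (hμ : ∀ᵐ t ∂μ, t ∈ Set.Icc a b) (hX : Measurable X) (hX2 : MemLp X 2 P) (hY2 : MemLp Y 2 P)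
    {β : E d} (hβ : β i = 0) {lam : ℝ} (hlam : 0 < lam) {r : Lp ℝ 2 P}
    (hr : IsRidgeResidual (gramLp P ha hμ hX β) lam (hY2.toLp Y) r) :
    HasDirDeriv (fun b => objective P X Y μ b lam) β (EuclideanSpace.single i 1)
      (lam⁻¹ * kernelForm (slopeLp ha (ae_tilt hμ) hX hX2 i β) r r) := by
  have hpos : ∀ (β : E d) r, 0 ≤ kernelForm (gramLp P ha hμ hX β) r r := fun β r =>
    kernelForm_pairKernel_nonneg ha hμ (measurable_hadamard_comp hX β) r
  choose R hR using fun β : E d =>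
    exists_isRidgeResidual (hpos β) hlam (hY2.toLp Y)
  have ht := tendsto_slope_gramLp ha hμ hX hX2 hβ
  set κ : ℝ → Lp ℝ 2 (P.prod P) := fun s => gramLp P ha hμ hX (β + s • EuclideanSpace.single i 1)
    with hκ
  have hκ0 : κ 0 = gramLp P ha hμ hX β := by simp [hκ]
  rw [← hκ0] at ht hr
  -- The chosen residuals are overwritten at `0` by the given `r`, so that the derivative is
  -- expressed through `r` without appealing to uniqueness.
  set ρ : ℝ → Lp ℝ 2 P := Function.update (fun s => R (β + s • EuclideanSpace.single i 1)) 0 r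
    with hρ
  have hρ0 : ρ 0 = r := by simp [hρ]
  have hρs : ∀ s, IsRidgeResidual (κ s) lam (hY2.toLp Y) (ρ s) := by
    intro s
    rcases eq_or_ne s 0 with rfl | hs
    · rwa [hρ0]
    · rw [hρ, Function.update_of_ne hs]
      exact hR _
  have hd := tendsto_slope_inner_ridgeResidual (κ := κ) (fun s r => hpos _ r)
    (fun s u v => kernelForm_pairKernel_comm ha hμ (measurable_hadamard_comp hX _) u v) ht hlam hρs
  rw [hρ0, kernelForm_neg, mul_neg, neg_neg] at hd
  refine hd.congr fun s => ?_
  rw [← objective_eq_inner ha hμ hX hY2 hlam (hρs s),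
    ← objective_eq_inner ha hμ hX hY2 hlam (hκ0 ▸ hr)]

end Margin

/-! ### Descent along `e_i` and stationary points. -/

section Main

variable {d : ℕ} {Ω : Type*} [MeasurableSpace Ω] {P : Measure Ω} [IsProbabilityMeasure P]
  {μ : Measure ℝ} [IsFiniteMeasure μ] [NeZero μ] {a b : ℝ} {X : Ω → E d} {Y : Ω → ℝ}
  {S : Set (Fin d)} {i : Fin d}

/-- Descent along the coordinate `i`, uniformly over a compact set of parameters. -/
theorem mainTerm_and_descent (ha : 0 < a) (hμ : ∀ᵐ t ∂μ, t ∈ Set.Icc a b)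
    (hX : Measurable X) (hX2 : MemLp X 2 P) (hY2 : MemLp Y 2 P)
    (hi : i ∈ S) (hind : Indep (MeasurableSpace.comap (subvec X {i}ᶜ) inferInstance)
      (MeasurableSpace.comap (fun w => X w i) inferInstance) P)
    (hne : ¬ condOn P X Y (S \ {i}) =ᵐ[P] condOn P X Y S) {C : Set (E d)} (hC : IsCompact C)
    (hCS : C ⊆ {β | β i = 0 ∧ ∀ j ∈ S \ {i}, 0 < β j}) :
    (0 < ⨅ β ∈ C, mainTerm P X Y μ i β) ∧ (∀ β ∈ C, mainTerm P X Y μ i β < ⊤) ∧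
      ∃ ε : ℝ, 0 < ε ∧ ∃ lam₀ : ℝ, 0 < lam₀ ∧ ∀ lam : ℝ, 0 < lam → lam < lam₀ → ∀ β ∈ C,
        ∃ D : ℝ, HasDirDeriv (fun b => objective P X Y μ b lam) β (EuclideanSpace.single i 1) D ∧
          lam * D ≤ -ε := by
  have := isFiniteMeasure_tilt hμ
  have hiU : i ∉ S \ {i} := fun h => h.2 rfl
  set y := hY2.toLp Y with hy
  -- The radius `2‖y‖` accommodates the population residual as well as the ridge residual, so one
  -- `ε` serves all three conclusions.
  obtain ⟨ε, hε, hmargin⟩ := exists_margin ha hμ hX hX2 hY2 hi hind hne hC hCS (2 * ‖y‖)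
  simp only [kernelForm_neg] at hmargin
  have hmain : ∀ β ∈ C, ∃ v : ℝ, ε ≤ v ∧ mainTerm P X Y μ i β = ENNReal.ofReal v := by
    intro β hβ
    have hZ := measurable_hadamard_comp hX β
    obtain ⟨r, hr, hrn, hrh, hrg⟩ := exists_populationResidual hX hY2 hind (hCS hβ).1 hiU
    refine ⟨_, ?_, mainTerm_eq_ofReal ha hμ hX hX2 hr hrh⟩
    have h1 := hmargin β hβ r hrn hrg
    rw [gramLp, kernelForm_eq_zero_of_integral_mul_expChar ha hμ hZ hrh] at h1
    rcases le_max_iff.1 h1 with h2 | h2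
    · exact h2
    · exact absurd h2 hε.not_ge
  -- Below this threshold the Gram form, at most `λ‖y‖²`, is less than `ε`, leaving only the slope
  -- alternative in the margin. The `+ 1` covers `y = 0`.
  refine ⟨?_, fun β hβ => ?_, ε, hε, ε / (‖y‖ ^ 2 + 1), by positivity,
    fun lam hlam hlam0 β hβ => ?_⟩
  · refine (ENNReal.ofReal_pos.2 hε).trans_le (le_iInf₂ fun β hβ => ?_)
    obtain ⟨v, hv, hm⟩ := hmain β hβ
    rw [hm]
    exact ENNReal.ofReal_le_ofReal hv
  · obtain ⟨v, -, hm⟩ := hmain β hβ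
    rw [hm]
    exact ENNReal.ofReal_lt_top
  · have hpos : ∀ r, 0 ≤ kernelForm (gramLp P ha hμ hX β) r r :=
      kernelForm_pairKernel_nonneg ha hμ (measurable_hadamard_comp hX β)
    obtain ⟨r, hr⟩ := exists_isRidgeResidual hpos hlam y
    refine ⟨_, hasDirDeriv_objective ha hμ hX hX2 hY2 (hCS hβ).1 hlam hr, ?_⟩
    rw [mul_inv_cancel_left₀ hlam.ne']
    have h1 := hmargin β hβ r (by linarith [hr.norm_le hpos hlam, norm_nonneg y])
      fun h hh => inner_ridgeResidual_gap ha hμ hX hind (hCS hβ).1 hr hiU hh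
    have h2 := hr.kernelForm_le hpos hlam
    rw [lt_div_iff₀ (by positivity)] at hlam0
    rcases le_max_iff.1 h1 with h3 | h3 <;> linarith

/-- Intersecting `C` with the closed hyperplane `β i = 0` keeps it compact, so the descent estimate
applies there. Uniqueness of limits identifies its derivative with the nonnegative one supplied by
stationarity. -/
theorem mem_supp_or_notMem_of_isDirStationary (ha : 0 < a) (hμ : ∀ᵐ t ∂μ, t ∈ Set.Icc a b)
    (hX : Measurable X) (hX2 : MemLp X 2 P) (hY2 : MemLp Y 2 P)
    (hi : i ∈ S) (hind : Indep (MeasurableSpace.comap (subvec X {i}ᶜ) inferInstance)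
      (MeasurableSpace.comap (fun w => X w i) inferInstance) P)
    (hne : ¬ condOn P X Y (S \ {i}) =ᵐ[P] condOn P X Y S) {C : Set (E d)} (hC : IsCompact C)
    (hCS : ∀ β ∈ C, ∀ j ∈ S \ {i}, 0 < β j) :
    ∃ lam₀ : ℝ, 0 < lam₀ ∧ ∀ lam : ℝ, 0 < lam → lam < lam₀ → ∀ β : E d,
      IsDirStationary (fun b => objective P X Y μ b lam) β → i ∈ supp β ∨ β ∉ C := by
  have hcl : IsClosed {β : E d | β i = 0} := isClosed_eq (by fun_prop) continuous_const
  obtain ⟨-, -, ε, hε, lam₀, hlam₀, h⟩ := mainTerm_and_descent ha hμ hX hX2 hY2 hi hind hne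
    (hC.inter_right hcl) fun β hβ => ⟨hβ.2, hCS β hβ.1⟩
  refine ⟨lam₀, hlam₀, fun lam hlam hlt β hst => ?_⟩
  by_contra! hcon
  obtain ⟨D, hD, hle⟩ := h lam hlam hlt β ⟨hcon.2, not_not.1 hcon.1⟩
  obtain ⟨D', hD', hD0⟩ := hst (EuclideanSpace.single i 1)
  rw [tendsto_nhds_unique hD hD'] at hle
  linarith [mul_nonneg hlam.le hD0]

end Main

end CompKernel

theorem mainTheorem3 {d : ℕ} {Ω : Type*} [MeasurableSpace Ω]
    (P : Measure Ω) [IsProbabilityMeasure P]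
    (X : Ω → CompKernel.E d) (Y : Ω → ℝ)
    (hX : Measurable X) (hX2 : MemLp X 2 P)
    (hY : Measurable Y) (hY2 : MemLp Y 2 P) (hY0 : ∫ w, Y w ∂P = 0)
    -- the mixing measure of the kernel: a probability measure with compact support in `(0, ∞)`
    (μ : Measure ℝ) [IsProbabilityMeasure μ]
    (hμc : IsCompact μ.support) (hμ0 : μ.support ⊆ Set.Ioi 0)
    -- the core sufficient feature set exists
    (Sstar : Set (Fin d)) (hS : CompKernel.IsCoreSufficient P X Y Sstar)
    -- relevant and irrelevant features are independent
    (hindep : IndepFun (CompKernel.subvec X Sstar) (CompKernel.subvec X Sstarᶜ) P)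
    -- the relevant features are mutually independent
    (hmut : iIndepFun (fun (j : Sstar) (w : Ω) => X w j) P)
    (S : Set (Fin d)) (i : Fin d) (hiS : i ∈ S) (hSS : S ⊆ Sstar)
    (hne : ¬ CompKernel.condOn P X Y (S \ {i}) =ᵐ[P] CompKernel.condOn P X Y S) :
    (∀ C : Set (CompKernel.E d), IsCompact C →
      C ⊆ {β | β i = 0 ∧ ∀ j ∈ S \ {i}, 0 < β j} →
        (0 < ⨅ β ∈ C, CompKernel.mainTerm P X Y μ i β) ∧
        (∀ β ∈ C, CompKernel.mainTerm P X Y μ i β < ⊤) ∧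
        ∃ ε : ℝ, 0 < ε ∧ ∃ lam₀ : ℝ, 0 < lam₀ ∧ ∀ lam : ℝ, 0 < lam → lam < lam₀ → ∀ β ∈ C,
          ∃ D : ℝ,
            CompKernel.HasDirDeriv (fun b => CompKernel.objective P X Y μ b lam) β
              (EuclideanSpace.single i 1) D ∧
            lam * D ≤ -ε) ∧
    (∀ C : Set (CompKernel.E d), IsCompact C →
      (∀ β ∈ C, ∀ j ∈ S \ {i}, 0 < β j) →
        ∃ lam₀ : ℝ, 0 < lam₀ ∧ ∀ lam : ℝ, 0 < lam → lam < lam₀ → ∀ β : CompKernel.E d,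
          CompKernel.IsDirStationary (fun b => CompKernel.objective P X Y μ b lam) β →
            i ∈ CompKernel.supp β ∨ β ∉ C) := by
  obtain ⟨a, b, ha, hμ⟩ := CompKernel.exists_Icc_of_support hμc hμ0
  have hind := CompKernel.indep_subvec_compl_coord hX hindep hmut (hSS hiS)
  exact ⟨fun C hC hCS => CompKernel.mainTerm_and_descent ha hμ hX hX2 hY2 hiS hind hne hC hCS,
    fun C hC hCS =>
      CompKernel.mem_supp_or_notMem_of_isDirStationary ha hμ hX hX2 hY2 hiS hind hne hC hCS⟩
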